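/- Let $\mathfrak g$ be a compact semisimple Lie algebra, $\mathfrak g^{\mathbb C}$ its complexification, $\theta$ the conjugation of $\mathfrak g^{\mathbb C}$ with fixed point set $\mathfrak g$, and $\sigma$ a conjugate linear involutive Lie algebra automorphism of $\mathfrak g^{\mathbb C}$ commuting with $\theta$. Let $\mathrm G$, $\mathrm G^{\mathbb C}$ and $\mathrm K^{\mathbb C}$ be the connected groups of inner automorphisms of $\mathfrak g^{\mathbb C}$ with Lie algebras $\mathfrak g$, $\mathfrak g^{\mathbb C}$ and $\{u:\theta\sigma u=u\}$. Let $x\in i\mathfrak g$ with $\sigma x=x$, and put $X=\mathrm G(x)\subset i\mathfrak g$, $\mathcal O=\mathrm G^{\mathbb C}(x)$. For $y\in\mathcal O$ let $\mathfrak n(y)$ be the sum of the eigenspaces of $\mathrm{ad}\,y$ with positive eigenvalue. The Iwasawa fibre through $y$ is $y+\mathfrak n(y)$; the fibres partition $\mathcal O$ and each meets $X$ in exactly one point. The Iwasawa projection $\Pi:\mathcal O\to X$ sends a point to the point of $X$ in its fibre. The group $\mathrm K^{\mathbb C}$ acts on $X$ by $(k,y)\mapsto\Pi(ky)$; let $X^*\subset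 X$ be the open dense orbit, $\mathcal A=\Pi^{-1}(X^*)\subset\mathcal O$ and $\mathcal B=\mathcal A\cap-\theta(\mathcal A)$. Let $\langle\cdot,\cdot\rangle$ be the complex Killing form, $\Omega_y([u,y],[v,y])=\langle y,[u,v]\rangle$ the holomorphic Kostant–Kirillov–Souriau form on $\mathcal O$, $\omega=-\operatorname{Im}\Omega|_X$, and $J$ the complex structure on $X$ given by $Jv=\Pi_*(iv)$. For $y\in X^*$ let $s(y)$ be the unique point of $\mathrm K^{\mathbb C}(x)$ in the Iwasawa fibre through $y$, and let $\beta$ be the 1-form on $X^*$ with $\beta_y([v,y])=\operatorname{Re}\langle y-s(y),v\rangle$ for $v\in\mathfrak g$. Let $h:X^*\to\mathbb R$ be the function with $dh=2\beta$ and $h(x)=0$; it is a Kähler potential, $\omega=i\partial\bar\partial h$. Let $Y$ be one half of the gradient of $h$ with respect to the Kähler metric $\omega(\cdot,J\cdot)$ on $X^*$. Then $\mathcal B$ is open in $\mathcal O$ (indeed Zariski open in $\mathcal O$), connected and $\mathrm K^{\mathbb C}$-invariant, it contains $X^*$, the function $h$ exists, and the vector field $-Y$ on $X^*$ has a complexification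 defined on all of $\mathcal B$: there is a unique holomorphic vector field $\Lambda$ on $\mathcal B$ with $\Lambda|_{X^*}=-Y$. Moreover $\Lambda$ is $\mathrm K^{\mathbb C}$-equivariant, i.e. $\Lambda(kz)=k\,\Lambda(z)$ for all $k\in\mathrm K^{\mathbb C}$, $z\in\mathcal B$. -/

import Mathlib

/-- A Lie ring with a norm on its additive group; no relation between norm and bracket. -/
class NormedLieRing (L : Type*) extends NormedAddCommGroup L, LieRing L

/-- A Lie algebra with a norm. In finite dimension all norms are equivalent, so the norm only
serves to fix the usual topology (and calculus) of the underlying vector space. -/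
class NormedLieAlgebra (𝕜 : Type*) (L : Type*) [NormedField 𝕜] [NormedLieRing L] extends
  NormedSpace 𝕜 L, LieAlgebra 𝕜 L

noncomputable section

namespace HyperbolicOrbit

variable {L : Type*} [NormedLieRing L] [NormedLieAlgebra ℂ L] [FiniteDimensional ℂ L]

/-- A conjugate linear involutive automorphism of a complex Lie algebra. -/
structure IsConjugation (θ : L →ₛₗ[starRingEnd ℂ] L) : Prop where
  map_lie : ∀ u v, θ ⁅u, v⁆ = ⁅θ u, θ v⁆
  involutive : ∀ u, θ (θ u) = u

/-- `θ` is the conjugation with respect to a compact semisimple real form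
`𝔤 = {u | θ u = u}`, i.e. the Killing form is negative definite on `𝔤`. (The complex Killing form
of `L` restricts to the real Killing form of the real form `𝔤`.) -/
structure IsCompactConjugation (θ : L →ₛₗ[starRingEnd ℂ] L) : Prop extends IsConjugation θ where
  neg_def : ∀ u, θ u = u → u ≠ 0 → (killingForm ℂ L u u).re < 0

/-- `exp (ad u)` -/
def expAd (u : L) : L →L[ℂ] L :=
  NormedSpace.exp (LinearMap.toContinuousLinearMap (LieAlgebra.ad ℂ L u : L →ₗ[ℂ] L))

/-- The group generated by `exp (ad u)`, `u ∈ S`. If `S` is a real Lie subalgebra of `L`, this is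
the image in the adjoint group of the connected Lie subgroup with Lie algebra `S`. -/
def adGroup (S : Set L) : Subgroup (L ≃L[ℂ] L) :=
  Subgroup.closure {g | ∃ u ∈ S, (g : L →L[ℂ] L) = expAd u}

/-- `𝒪 = G^ℂ(x)`. -/
def complexOrbit (x : L) : Set L := {y | ∃ g ∈ adGroup (Set.univ : Set L), y = g x}

/-- `X = G(x)`, where `G` has Lie algebra `𝔤 = {u | θ u = u}`. -/
def compactOrbit (θ : L →ₛₗ[starRingEnd ℂ] L) (x : L) : Set L :=
  {y | ∃ g ∈ adGroup {u : L | θ u = u}, y = g x}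

/-- `K^ℂ`, the connected group whose Lie algebra is the fixed point set of the complex linear
involution `θσ`. -/
def sphericalGroup (θ σ : L →ₛₗ[starRingEnd ℂ] L) : Subgroup (L ≃L[ℂ] L) :=
  adGroup {u : L | θ (σ u) = u}

/-- `K^ℂ(x) ⊆ 𝒪`. -/
def sphericalOrbit (θ σ : L →ₛₗ[starRingEnd ℂ] L) (x : L) : Set L :=
  {y | ∃ k ∈ sphericalGroup θ σ, y = k x}

/-- `𝔫(y)`, the sum of the eigenspaces of `ad y` with positive eigenvalue. -/
def nilradical (y : L) : Submodule ℂ L :=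
  ⨆ c : {c : ℝ // 0 < c}, Module.End.eigenspace (LieAlgebra.ad ℂ L y) ((c : ℝ) : ℂ)

/-- The Iwasawa fibre `y + 𝔫(y)` through `y`. For `y = g x`, `g ∈ G^ℂ`, one has
`𝔫(y) = g 𝔫(x)`, so this is the translate by `g` of the fibre `x + 𝔫(x)` through `x`. -/
def iwasawaFiber (y : L) : Set L := {z | z - y ∈ nilradical y}

open Classical in
/-- The Iwasawa projection `Π : 𝒪 → X`: `Π z` is the point of `X` whose Iwasawa fibre
contains `z`. -/
def iwasawaProj (θ : L →ₛₗ[starRingEnd ℂ] L) (x z : L) : L :=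
  if h : ∃ y ∈ compactOrbit θ x, z ∈ iwasawaFiber y then h.choose else 0

/-- The orbit of `y ∈ X` for the action `(k, y) ↦ Π (k y)` of `K^ℂ` on `X ≅ G^ℂ/P`. -/
def flagOrbit (θ σ : L →ₛₗ[starRingEnd ℂ] L) (x y : L) : Set L :=
  {y' | ∃ k ∈ sphericalGroup θ σ, y' = iwasawaProj θ x (k y)}

/-- `B` is a relatively open subset of `M`. -/
def IsOpenIn (M B : Set L) : Prop := ∃ U : Set L, IsOpen U ∧ B = M ∩ U

/-- `X*`, the open dense orbit of `K^ℂ` on `X` (two open dense orbits meet, so there is at most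
one). -/
def openOrbit (θ σ : L →ₛₗ[starRingEnd ℂ] L) (x : L) : Set L :=
  {y ∈ compactOrbit θ x | IsOpenIn (compactOrbit θ x) (flagOrbit θ σ x y) ∧
    compactOrbit θ x ⊆ closure (flagOrbit θ σ x y)}

/-- `𝒜 = Π⁻¹(X*) ⊆ 𝒪`. -/
def domainA (θ σ : L →ₛₗ[starRingEnd ℂ] L) (x : L) : Set L :=
  {z ∈ complexOrbit x | iwasawaProj θ x z ∈ openOrbit θ σ x}

/-- `ℬ = 𝒜 ∩ -θ(𝒜)`. -/
def domainB (θ σ : L →ₛₗ[starRingEnd ℂ] L) (x : L) : Set L :=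
  domainA θ σ x ∩ (fun z => -θ z) '' domainA θ σ x

/-- Polynomial functions on `L`. -/
def polyFun (L : Type*) [NormedLieRing L] [NormedLieAlgebra ℂ L] : Subalgebra ℂ (L → ℂ) :=
  Algebra.adjoin ℂ (Set.range fun (φ : Module.Dual ℂ L) (y : L) => φ y)

/-- `B` is open in `M` for the topology induced by the Zariski topology of `L`. -/
def IsZariskiOpenIn (M B : Set L) : Prop :=
  ∃ S : Set (L → ℂ), S ⊆ polyFun L ∧ B = {y ∈ M | ∃ f ∈ S, f y ≠ 0}

/-- `kks y u v = ω_y([u,y],[v,y])` for `y ∈ X`, `u, v ∈ 𝔤`, where `ω = -Im Ω` and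
`Ω_y([u,y],[v,y]) = ⟨y,[u,v]⟩` is the holomorphic Kostant-Kirillov-Souriau form. -/
def kks (y u v : L) : ℝ := -(killingForm ℂ L y ⁅u, v⁆).im

/-- `J[v,y] = [v',y]` for `y ∈ X`, `v, v' ∈ 𝔤`, where `J` is the complex structure of
`X ≅ G^ℂ/P`: `[v',y] = Π_*(i[v,y])`, the tangent space of the fibre through `y` being `𝔫(y)`. -/
def IsJ (y v v' : L) : Prop := ⁅v', y⁆ - Complex.I • ⁅v, y⁆ ∈ nilradical y

/-- The normalized Kähler potential `h` of `ω` on `X*`.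

For `y ∈ X*` let `s` be the point in which the section `K^ℂ(x)` meets the Iwasawa fibre of `y`. The
vector `y - s`, tangent to the fibre, is identified by the Killing form with the covector
`[v,y] ↦ ⟨y - s, v⟩`; its real part is the 1-form `β`, and `h` is the primitive of `2β`
vanishing at `x`. It satisfies `i∂∂̄h = ω`; evaluated on `([v,y], J[v,y])` this says that half the
Laplacian at `0` of `h` along the holomorphic curve `z ↦ Π(exp(z ad v) y)` is `ω([v,y],J[v,y])`. -/
structure IsKahlerPotential (θ σ : L →ₛₗ[starRingEnd ℂ] L) (x : L) (h : L → ℝ) : Prop where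
  normalized : h x = 0
  primitive : ∀ y ∈ openOrbit θ σ x, ∃ s ∈ sphericalOrbit θ σ x, s ∈ iwasawaFiber y ∧
    ∀ v, θ v = v →
      HasDerivAt (fun t : ℝ => h (expAd ((t : ℂ) • v) y)) (2 * (killingForm ℂ L (y - s) v).re) 0
  potential : ∀ y ∈ openOrbit θ σ x, ∀ v v', θ v = v → θ v' = v' → IsJ y v v' →
    ContDiffAt ℝ 2 (fun z : ℂ => h (iwasawaProj θ x (expAd (z • v) y))) 0 ∧
    (1 / 2) * Laplacian.laplacian (fun z : ℂ => h (iwasawaProj θ x (expAd (z • v) y))) 0 =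
      kks y v v'

/-- On `X*`, `Y` is one half of the gradient of `h` for the Kähler metric `ω(·,J·)`:
`Y_y = [u,y]` is tangent to `X` and `ω([u,y],J[v,y]) = ½ dh([v,y])` for all `v ∈ 𝔤`. -/
def IsHalfGradient (θ σ : L →ₛₗ[starRingEnd ℂ] L) (x : L) (h : L → ℝ) (Y : L → L) : Prop :=
  ∀ y ∈ openOrbit θ σ x, ∃ u, θ u = u ∧ Y y = ⁅u, y⁆ ∧
    ∀ v v', θ v = v → θ v' = v' → IsJ y v v' →
      HasDerivAt (fun t : ℝ => h (expAd ((t : ℂ) • v) y)) (2 * kks y u v') 0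

/-- `Λ` is a holomorphic vector field on the open subset `B` of `𝒪` and restricts on the subset
`S` of the real form `X` to the vector field `V`. As `𝒪` is a complex submanifold of `L`, a map on
an open subset `B` of `𝒪` is holomorphic iff it is complex differentiable within `B`. -/
structure IsComplexification (V : L → L) (S B : Set L) (Λ : L → L) : Prop where
  subset : S ⊆ B
  tangent : ∀ z ∈ B, ∃ u : L, Λ z = ⁅u, z⁆
  holomorphic : DifferentiableOn ℂ Λ B
  restrict : ∀ y ∈ S, Λ y = V y

end HyperbolicOrbit

end

noncomputable section

set_option linter.unusedSectionVars false

namespace HyperbolicOrbit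

open Filter Topology

variable {L : Type*} [NormedLieRing L] [NormedLieAlgebra ℂ L] [FiniteDimensional ℂ L]

/-! On `𝒪` every `ad z` is diagonalizable with the same real spectrum as `ad x`, because `ad x` is
self-adjoint for the Hermitian form `-⟨u, θ v⟩`. By Lagrange interpolation the projection `E_I(z)`
onto the eigenspaces with eigenvalue in `I` is a fixed polynomial in `ad z`, hence polynomial in
`z`.

An Iwasawa fibre is encoded by the filtration of `L` by eigenspaces of large eigenvalue. Points of
`𝒪` in one fibre have the same filtration (`filEq_of_mem_iwasawaFiber`), a point of `X` is
determined by its filtration (`eq_of_filEq`), and every fibre meets `X` (`exists_mem_compactOrbit`).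
So `Π` can be studied through filtrations.

Let `τ = θσ`, a complex linear involution with `τ x = -x`. The condition for `z ∈ 𝒜` is that `τ`
followed by projection maps `𝔫(z)` injectively to the negative eigenspaces; the condition for `-θ z
∈ 𝒜` is the same with signs exchanged. Both together say that the operator `oppOp` is invertible, so
`ℬ` is the subset of `𝒪` where the polynomial `discr = det oppOp` does not vanish (`mem_domainB`).
Where it is nonzero, `𝔨^ℂ + 𝔭(z) = L`, so nearby filtrations are `K^ℂ`-translates of that of `z`.
Two points of `𝒪` lie on an entire curve in `𝒪`, and an entire function has connected nonvanishing
set. This gives connectedness of `ℬ`, transitivity of `K^ℂ` on the fibres that meet `ℬ`, and `X* = X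
∩ ℬ` (`openOrbit_eq`).

The point `s(z)` of `z + 𝔫(z)` with `τ s = -s` solves a linear equation with coefficient `oppOp`. So
`s(z) - z` is holomorphic on all of `ℬ`, as is its analogue in the negative eigenspaces; `Λ` is half
of their sum. Over `X*` the second vector is `-θ` of the first, and orthogonality of `𝔫(y)` and
`𝔭(y)` identifies `Λ` with `-Y` (`isHalfGradient`). Uniqueness is the identity theorem along entire
curves in `𝒪` that lie in `X` for real parameter (`eqOn_domainB`).

The potential is explicit: up to a constant, minus the sum over `l > 0` of `l` times the difference
of `log |det|` of `oppOp` for `[l, ∞)` and for `(l, ∞)`. Its differential is a trace that sums up to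
`-2 Re ⟨s, v⟩` (`hasDerivAt_rawPotential`), and `i∂∂̄h = ω` holds because `s` is holomorphic
(`potential_equation`). -/

instance completeSpace : CompleteSpace L := FiniteDimensional.complete ℂ L

/-! ### The adjoint representation by continuous operators -/

/-- `ad` as a continuous linear map into the Banach algebra of operators on `L`. -/
def adC : L →L[ℂ] L →L[ℂ] L :=
  LinearMap.toContinuousLinearMap
    ((LinearMap.toContinuousLinearMap (𝕜 := ℂ) (E := L) (F' := L)).toLinearMap ∘ₗ
      (LieAlgebra.ad ℂ L : L →ₗ[ℂ] Module.End ℂ L))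

@[simp] theorem adC_apply (u v : L) : adC u v = ⁅u, v⁆ := rfl

theorem clm_mul_apply (A B : L →L[ℂ] L) (u : L) : (A * B) u = A (B u) := rfl

theorem expAd_eq (u : L) : expAd u = NormedSpace.exp (adC u) := rfl

@[simp] theorem expAd_zero : expAd (0 : L) = 1 := by
  rw [expAd_eq, map_zero, NormedSpace.exp_zero]

theorem expAd_add_smul (u : L) (s t : ℂ) :
    expAd ((s + t) • u) = expAd (s • u) * expAd (t • u) := by
  let _ : NormedAlgebra ℚ (L →L[ℂ] L) := .restrictScalars ℚ ℂ _
  simp only [expAd_eq, add_smul, map_add]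
  refine NormedSpace.exp_add_of_commute ?_
  simp only [map_smul]
  exact ((Commute.refl _).smul_left _).smul_right _

theorem expAd_neg_mul (u : L) : expAd (-u) * expAd u = 1 := by
  have := expAd_add_smul u (-1) 1
  simpa using this.symm

theorem expAd_mul_neg (u : L) : expAd u * expAd (-u) = 1 := by
  have := expAd_neg_mul (-u)
  simpa using this

theorem expAd_neg_apply (u v : L) : expAd (-u) (expAd u v) = v :=
  congrArg (fun T : L →L[ℂ] L => T v) (expAd_neg_mul u)

theorem expAd_apply_neg (u v : L) : expAd u (expAd (-u) v) = v :=
  congrArg (fun T : L →L[ℂ] L => T v) (expAd_mul_neg u)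

theorem expAd_nsmul (n : ℕ) (u : L) : expAd (n • u) = expAd u ^ n := by
  let _ : NormedAlgebra ℚ (L →L[ℂ] L) := .restrictScalars ℚ ℂ _
  rw [expAd_eq, map_nsmul, NormedSpace.exp_nsmul, expAd_eq]

/-- `exp (ad u)` as an invertible operator. -/
def expEquiv (u : L) : L ≃L[ℂ] L :=
  ContinuousLinearEquiv.equivOfInverse (expAd u) (expAd (-u)) (expAd_neg_apply u)
    (expAd_apply_neg u)

@[simp] theorem coe_expEquiv (u : L) : (expEquiv u : L →L[ℂ] L) = expAd u := rfl

@[simp] theorem expEquiv_apply (u v : L) : expEquiv u v = expAd u v := rfl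

theorem expEquiv_inv (u : L) : (expEquiv u)⁻¹ = expEquiv (-u) := by
  rw [inv_eq_iff_mul_eq_one]
  ext v
  exact expAd_apply_neg u v

theorem hasDerivAt_expAd (u : L) (t : ℂ) :
    HasDerivAt (fun t : ℂ => expAd (t • u)) (adC u * expAd (t • u)) t := by
  simp only [expAd_eq, map_smul]
  exact hasDerivAt_exp_smul_const' (𝕂 := ℂ) (adC u) t

theorem hasDerivAt_expAd_apply (u v : L) (t : ℂ) :
    HasDerivAt (fun t : ℂ => expAd (t • u) v) ⁅u, expAd (t • u) v⁆ t :=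
  (hasDerivAt_expAd u t).clm_apply (hasDerivAt_const t v) |>.congr_deriv (by simp)

theorem adC_comm_expAd (u : L) (t : ℂ) : adC u * expAd (t • u) = expAd (t • u) * adC u := by
  have h : Commute (adC u) (adC (t • u)) := by
    rw [map_smul]; exact (Commute.refl _).smul_right _
  exact (h.exp_right).eq

/-- The bracket as a continuous bilinear map: derivative of a bracket of curves. -/
theorem hasDerivAt_lie {𝕜 : Type*} [NontriviallyNormedField 𝕜] [NormedAlgebra 𝕜 ℂ]
    [NormedSpace 𝕜 L] [IsScalarTower 𝕜 ℂ L] {a b : 𝕜 → L} {a' b' : L} {t : 𝕜}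
    (ha : HasDerivAt a a' t) (hb : HasDerivAt b b' t) :
    HasDerivAt (fun t => ⁅a t, b t⁆) (⁅a t, b'⁆ + ⁅a', b t⁆) t := by
  have h := (((adC (L := L)).restrictScalars 𝕜).hasFDerivAt (x := a t)).comp_hasDerivAt t ha
  have h2 : HasDerivAt (fun t => ((adC (a t)).restrictScalars 𝕜 : L →L[𝕜] L))
      ((adC a').restrictScalars 𝕜) t :=
    ((ContinuousLinearMap.restrictScalarsL ℂ L L 𝕜 𝕜).hasFDerivAt).comp_hasDerivAt t h
  have := h2.clm_apply hb
  simpa [add_comm] using this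

/-- Automorphisms of the Lie algebra. -/
def IsAut (g : L ≃L[ℂ] L) : Prop := ∀ u v, g ⁅u, v⁆ = ⁅g u, g v⁆

/-- The curve `t ↦ exp (-t ad u) ⁅exp (t ad u) a, exp (t ad u) b⁆` has zero derivative by the Jacobi
identity; its values at `0` and `1` are compared. -/
theorem expAd_lie (u a b : L) : expAd u ⁅a, b⁆ = ⁅expAd u a, expAd u b⁆ := by
  set f : ℂ → L := fun t => expAd ((-t) • u) ⁅expAd (t • u) a, expAd (t • u) b⁆ with hf
  have hd : ∀ t, HasDerivAt f 0 t := by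
    intro t
    have h1 : HasDerivAt (fun t : ℂ => expAd ((-t) • u)) (-(adC u * expAd ((-t) • u))) t := by
      have := (hasDerivAt_expAd u (-t)).scomp t (hasDerivAt_neg t)
      simpa [Function.comp_def] using this
    have h2 := hasDerivAt_lie (hasDerivAt_expAd_apply u a t) (hasDerivAt_expAd_apply u b t)
    refine (h1.clm_apply h2).congr_deriv ?_
    rw [adC_comm_expAd]
    change -(expAd (-t • u) ⁅u, ⁅expAd (t • u) a, expAd (t • u) b⁆⁆) + expAd (-t • u) _ = 0
    rw [leibniz_lie u (expAd (t • u) a) (expAd (t • u) b), add_comm (⁅expAd (t • u) a, _⁆)]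
    exact neg_add_cancel _
  have hc := is_const_of_deriv_eq_zero (fun t => (hd t).differentiableAt) (fun t => (hd t).deriv) 1 0
  simp only [hf, neg_zero, zero_smul, one_smul, expAd_zero, neg_smul] at hc
  have := congrArg (expAd u) hc
  rw [expAd_apply_neg] at this
  exact this.symm

theorem isAut_expEquiv (u : L) : IsAut (expEquiv u) := expAd_lie u

theorem IsAut.mul {g k : L ≃L[ℂ] L} (hg : IsAut g) (hk : IsAut k) : IsAut (g * k) := fun u v => by
  change g (k _) = _
  rw [hk, hg]; rfl

theorem IsAut.inv {g : L ≃L[ℂ] L} (hg : IsAut g) : IsAut g⁻¹ := fun u v => by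
  apply g.injective
  change g (g.symm _) = g ⁅g.symm u, g.symm v⁆
  rw [hg]; simp

theorem adGroup_eq (S : Set L) : adGroup S = Subgroup.closure (expEquiv '' S) := by
  unfold adGroup
  congr 1
  ext g
  refine exists_congr fun u => and_congr_right fun _ => ?_
  constructor
  · intro h
    ext v
    exact (congrArg (fun T : L →L[ℂ] L => T v) h).symm
  · rintro rfl; rfl

theorem expEquiv_mem {S : Set L} {u : L} (hu : u ∈ S) : expEquiv u ∈ adGroup S :=
  Subgroup.subset_closure ⟨u, hu, rfl⟩

theorem adGroup_mono {S T : Set L} (h : S ⊆ T) : adGroup S ≤ adGroup T :=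
  Subgroup.closure_mono fun _ ⟨u, hu, e⟩ => ⟨u, h hu, e⟩

theorem adGroup_induction {S : Set L} {p : (L ≃L[ℂ] L) → Prop}
    (hexp : ∀ u ∈ S, p (expEquiv u)) (hone : p 1) (hmul : ∀ g k, p g → p k → p (g * k))
    (hinv : ∀ g, p g → p g⁻¹) {g : L ≃L[ℂ] L} (hg : g ∈ adGroup S) : p g := by
  rw [adGroup_eq] at hg
  induction hg using Subgroup.closure_induction with
  | mem g hg => obtain ⟨u, hu, rfl⟩ := hg; exact hexp u hu
  | one => exact hone
  | mul g k _ _ h1 h2 => exact hmul g k h1 h2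
  | inv g _ h => exact hinv g h

theorem isAut_of_mem {S : Set L} {g : L ≃L[ℂ] L} (hg : g ∈ adGroup S) : IsAut g :=
  adGroup_induction (p := IsAut) (fun u _ => isAut_expEquiv u) (fun _ _ => rfl)
    (fun _ _ => IsAut.mul) (fun _ => IsAut.inv) hg

theorem mem_complexOrbit_self (x : L) : x ∈ complexOrbit x := ⟨1, one_mem _, rfl⟩

theorem apply_mem_complexOrbit {x z : L} {g : L ≃L[ℂ] L} {S : Set L} (hg : g ∈ adGroup S)
    (hz : z ∈ complexOrbit x) : g z ∈ complexOrbit x := by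
  obtain ⟨k, hk, rfl⟩ := hz
  exact ⟨g * k, mul_mem (adGroup_mono (Set.subset_univ S) hg) hk, rfl⟩

end HyperbolicOrbit

namespace HyperbolicOrbit

open Filter Topology Polynomial

variable {L : Type*} [NormedLieRing L] [NormedLieAlgebra ℂ L] [FiniteDimensional ℂ L]

/-! ### Spectral projections of `ad z` -/

/-- The set of `z` such that `ad z` is diagonalizable with all eigenvalues in `S`. -/
def spectralSet (L : Type*) [NormedLieRing L] [NormedLieAlgebra ℂ L] [FiniteDimensional ℂ L]
    (S : Finset ℝ) : Set L :=
  {z | aeval (adC z) (Lagrange.nodal S (fun m : ℝ => (m : ℂ))) = 0}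

/-- A polynomial in `ad z` which is the projection to the `l`-eigenspace if `z ∈ spectralSet L S`. -/
def specProj (S : Finset ℝ) (l : ℝ) (z : L) : L →L[ℂ] L :=
  aeval (adC z) (Lagrange.basis S (fun m : ℝ => (m : ℂ)) l)

open Classical in
/-- The sum of the spectral projections for the eigenvalues in `I`. -/
def specProjOn (S : Finset ℝ) (I : Set ℝ) (z : L) : L →L[ℂ] L :=
  ∑ l ∈ S.filter (· ∈ I), specProj S l z

theorem injOn_ofReal (S : Finset ℝ) : Set.InjOn (fun m : ℝ => (m : ℂ)) S :=
  Complex.ofReal_injective.injOn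

theorem aeval_adC_apply {z u : L} {c : ℂ} (h : ⁅z, u⁆ = c • u) (q : ℂ[X]) :
    aeval (adC z) q u = q.eval c • u := by
  induction q using Polynomial.induction_on' with
  | add p q hp hq => simp [hp, hq, add_smul]
  | monomial n a =>
    have : ∀ n : ℕ, (adC z ^ n) u = c ^ n • u := by
      intro n
      induction n with
      | zero => simp
      | succ n ih => rw [pow_succ, clm_mul_apply]; simp [h, ih, pow_succ, smul_smul, mul_comm]
    simp [aeval_monomial, this, smul_smul, Algebra.algebraMap_eq_smul_one]

variable {S : Finset ℝ}

theorem specProj_apply_self {z u : L} {l : ℝ} (hl : l ∈ S) (h : ⁅z, u⁆ = (l : ℂ) • u) :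
    specProj S l z u = u := by
  rw [specProj, aeval_adC_apply h,
    Lagrange.eval_basis_self (v := fun m : ℝ => (m : ℂ)) (injOn_ofReal S) hl, one_smul]

theorem specProj_apply_of_ne {z u : L} {l m : ℝ} (hm : m ∈ S) (hlm : l ≠ m)
    (h : ⁅z, u⁆ = (m : ℂ) • u) : specProj S l z u = 0 := by
  rw [specProj, aeval_adC_apply h,
    Lagrange.eval_basis_of_ne (v := fun m : ℝ => (m : ℂ)) hlm hm, zero_smul]

theorem eq_zero_of_notMem {z u : L} (hz : z ∈ spectralSet L S) {c : ℝ} (hc : c ∉ S)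
    (h : ⁅z, u⁆ = (c : ℂ) • u) : u = 0 := by
  have h1 := aeval_adC_apply h (Lagrange.nodal S (fun m : ℝ => (m : ℂ)))
  rw [show aeval (adC z) (Lagrange.nodal S (fun m : ℝ => (m : ℂ))) = 0 from hz] at h1
  refine ((smul_eq_zero.mp h1.symm).resolve_left ?_)
  refine Lagrange.eval_nodal_not_at_node fun i hi => ?_
  simp only [ne_eq, Complex.ofReal_inj]
  rintro rfl
  exact hc hi

/-- Up to a scalar, `X - l` times the Lagrange basis polynomial at `l` is the nodal polynomial,
which annihilates `ad z`. -/
theorem lie_specProj {z : L} (hz : z ∈ spectralSet L S) {l : ℝ} (hl : l ∈ S) (u : L) :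
    ⁅z, specProj S l z u⁆ = (l : ℂ) • specProj S l z u := by
  have h : (X - C (l : ℂ)) * Lagrange.basis S (fun m : ℝ => (m : ℂ)) l =
      C (∏ j ∈ S.erase l, ((l : ℂ) - j)⁻¹) * Lagrange.nodal S (fun m : ℝ => (m : ℂ)) := by
    rw [Lagrange.nodal_eq_mul_nodal_erase hl, Lagrange.basis, Lagrange.nodal_eq]
    simp only [Lagrange.basisDivisor, Finset.prod_mul_distrib, map_prod]
    ring
  have h2 := congrArg (aeval (adC z)) h
  rw [map_mul, map_mul, show aeval (adC z) (Lagrange.nodal S (fun m : ℝ => (m : ℂ))) = 0 from hz,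
    mul_zero] at h2
  have h3 := congrArg (fun T : L →L[ℂ] L => T u) h2
  simp only [map_sub, aeval_X, aeval_C,
    Algebra.algebraMap_eq_smul_one] at h3
  exact sub_eq_zero.mp h3

theorem sum_specProj {z : L} (hz : z ∈ spectralSet L S) : ∑ l ∈ S, specProj S l z = 1 := by
  rcases S.eq_empty_or_nonempty with rfl | hS
  · have : aeval (adC z) (Lagrange.nodal ∅ (fun m : ℝ => (m : ℂ))) = 0 := hz
    simpa using this.symm
  · have := congrArg (aeval (adC z)) (Lagrange.sum_basis (injOn_ofReal S) hS)
    simpa [specProj] using this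

theorem sum_specProj_apply {z : L} (hz : z ∈ spectralSet L S) (u : L) :
    ∑ l ∈ S, specProj S l z u = u := by
  have := congrArg (fun T : L →L[ℂ] L => T u) (sum_specProj hz)
  simpa using this

theorem ext_specProj {z : L} (hz : z ∈ spectralSet L S) {u v : L}
    (h : ∀ l ∈ S, specProj S l z u = specProj S l z v) : u = v := by
  rw [← sum_specProj_apply hz u, ← sum_specProj_apply hz v]
  exact Finset.sum_congr rfl h

theorem mem_spectralSet_of_span {z : L} (h : ∀ u : L, ∃ f : ℝ → L, u = ∑ l ∈ S, f l ∧
    ∀ l ∈ S, ⁅z, f l⁆ = (l : ℂ) • f l) : z ∈ spectralSet L S := by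
  ext u
  obtain ⟨f, hu, hf⟩ := h u
  rw [hu, map_sum]
  refine Finset.sum_eq_zero fun l hl => ?_
  rw [aeval_adC_apply (hf l hl), Lagrange.eval_nodal_at_node hl, zero_smul]

/-- Functoriality of the spectral projections. -/
theorem specProj_transfer {z z' : L} (hz : z ∈ spectralSet L S) (φ : L →+ L) {ρ : ℝ → ℝ}
    (hρ : ∀ l, ρ (ρ l) = l) (hS : ∀ l ∈ S, ρ l ∈ S)
    (h : ∀ l ∈ S, ∀ u, ⁅z, u⁆ = (l : ℂ) • u → ⁅z', φ u⁆ = ((ρ l : ℝ) : ℂ) • φ u)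
    (l : ℝ) (u : L) : specProj S l z' (φ u) = φ (specProj S (ρ l) z u) := by
  -- It suffices to compare both sides on eigenvectors. In the applications `ρ` is the identity for
  -- automorphisms and negation when `z' = -φ z`.
  have key : ∀ m ∈ S, specProj S l z' (φ (specProj S m z u)) =
      φ (specProj S (ρ l) z (specProj S m z u)) := by
    intro m hm
    have h1 := lie_specProj hz hm u
    by_cases hml : m = ρ l
    · have hl : ρ m = l := by rw [hml, hρ]
      rw [← hml, specProj_apply_self hm h1]
      refine specProj_apply_self (hl ▸ hS m hm) ?_
      rw [h m hm _ h1, hl]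
    · rw [specProj_apply_of_ne hm (Ne.symm hml) h1, map_zero]
      refine specProj_apply_of_ne (hS m hm) ?_ (h m hm _ h1)
      rintro rfl
      exact hml (hρ m).symm
  conv_lhs => rw [← sum_specProj_apply hz u]
  conv_rhs => rw [← sum_specProj_apply hz u]
  simp only [map_sum]
  exact Finset.sum_congr rfl key

theorem mem_spectralSet_transfer {z z' : L} (hz : z ∈ spectralSet L S) (φ : L →+ L) {ρ : ℝ → ℝ}
    (hρ : ∀ l, ρ (ρ l) = l) (hS : ∀ l ∈ S, ρ l ∈ S) (hφ : Function.Surjective φ)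
    (h : ∀ l ∈ S, ∀ u, ⁅z, u⁆ = (l : ℂ) • u → ⁅z', φ u⁆ = ((ρ l : ℝ) : ℂ) • φ u) :
    z' ∈ spectralSet L S := by
  refine mem_spectralSet_of_span fun u => ?_
  obtain ⟨v, rfl⟩ := hφ u
  refine ⟨fun l => φ (specProj S (ρ l) z v), ?_, fun l hl => ?_⟩
  · rw [← map_sum]
    congr 1
    conv_lhs => rw [← sum_specProj_apply hz v]
    refine Finset.sum_bij' (fun l _ => ρ l) (fun l _ => ρ l) hS hS (fun l _ => hρ l)
      (fun l _ => hρ l) fun l _ => by rw [hρ]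
  · rw [h _ (hS l hl) _ (lie_specProj hz (hS l hl) v), hρ]

theorem specProjOn_apply (I : Set ℝ) (z u : L) [DecidablePred (· ∈ I)] :
    specProjOn S I z u = ∑ l ∈ S, if l ∈ I then specProj S l z u else 0 := by
  rw [specProjOn, _root_.sum_apply, Finset.sum_filter]
  exact Finset.sum_congr rfl fun l _ => by congr

theorem specProjOn_transfer {z z' : L} (hz : z ∈ spectralSet L S) (φ : L →+ L) {ρ : ℝ → ℝ}
    (hρ : ∀ l, ρ (ρ l) = l) (hS : ∀ l ∈ S, ρ l ∈ S)
    (h : ∀ l ∈ S, ∀ u, ⁅z, u⁆ = (l : ℂ) • u → ⁅z', φ u⁆ = ((ρ l : ℝ) : ℂ) • φ u)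
    (I : Set ℝ) (u : L) : specProjOn S I z' (φ u) = φ (specProjOn S (ρ ⁻¹' I) z u) := by
  classical
  simp only [specProjOn_apply, map_sum]
  refine Finset.sum_bij' (fun l _ => ρ l) (fun l _ => ρ l) hS hS (fun l _ => hρ l)
      (fun l _ => hρ l) fun l _ => ?_
  simp only [Set.mem_preimage, hρ]
  split_ifs
  · exact specProj_transfer hz φ hρ hS h l u
  · simp

theorem specProjOn_apply_eigen {z u : L} (hz : z ∈ spectralSet L S) {m : ℝ}
    (h : ⁅z, u⁆ = (m : ℂ) • u) (I : Set ℝ) [Decidable (m ∈ I)] :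
    specProjOn S I z u = if m ∈ I then u else 0 := by
  classical
  by_cases hm : m ∈ S
  · rw [specProjOn_apply, Finset.sum_eq_single m]
    · rw [specProj_apply_self hm h]
      congr
    · intro l _ hl
      rw [specProj_apply_of_ne hm hl h, ite_self]
    · exact fun h => absurd hm h
  · rw [eq_zero_of_notMem hz hm h]
    simp

theorem specProjOn_mul {z : L} (hz : z ∈ spectralSet L S) (I J : Set ℝ) :
    specProjOn S I z * specProjOn S J z = specProjOn S (I ∩ J) z := by
  classical
  ext u
  rw [clm_mul_apply, specProjOn_apply J, specProjOn_apply (I ∩ J), map_sum]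
  refine Finset.sum_congr rfl fun l hl => ?_
  by_cases hJ : l ∈ J <;> simp [hJ, specProjOn_apply_eigen hz (lie_specProj hz hl u)]

theorem specProjOn_idem {z : L} (hz : z ∈ spectralSet L S) (I : Set ℝ) (u : L) :
    specProjOn S I z (specProjOn S I z u) = specProjOn S I z u := by
  have h := congrArg (fun T : L →L[ℂ] L => T u) (specProjOn_mul hz I I)
  rw [Set.inter_self] at h
  exact h

theorem specProjOn_lie {z : L} (hz : z ∈ spectralSet L S) (I : Set ℝ) (u : L) :
    specProjOn S I z ⁅z, u⁆ = ⁅z, specProjOn S I z u⁆ := by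
  classical
  conv_lhs => rw [← sum_specProj_apply hz u]
  rw [lie_sum, map_sum, specProjOn_apply, lie_sum]
  refine Finset.sum_congr rfl fun l hl => ?_
  rw [lie_specProj hz hl, map_smul, specProjOn_apply_eigen hz (lie_specProj hz hl u)]
  split_ifs
  · exact (lie_specProj hz hl u).symm
  · rw [smul_zero, lie_zero]

theorem exists_lie_eq_specProjOn {z : L} (hz : z ∈ spectralSet L S) {I : Set ℝ}
    (h0 : (0 : ℝ) ∉ I) (u : L) :
    ∃ v, specProjOn S I z v = v ∧ ⁅v, z⁆ = specProjOn S I z u := by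
  classical
  -- Away from eigenvalue zero `ad z` is inverted by dividing by the eigenvalue; the sign comes from
  -- `⁅v, z⁆ = -⁅z, v⁆`. At `l = 0` the inverse takes the default value `0`, which is harmless as `0
  -- ∉ I`.
  set w : L := ∑ l ∈ S, (-(l : ℂ)⁻¹) • specProj S l z u with hw
  refine ⟨specProjOn S I z w, specProjOn_idem hz I w, ?_⟩
  rw [← lie_skew, ← specProjOn_lie hz, ← map_neg, lie_skew, hw, sum_lie, map_sum,
    specProjOn_apply]
  refine Finset.sum_congr rfl fun l hl => ?_
  rw [smul_lie, ← lie_skew, lie_specProj hz hl, neg_smul, smul_neg, neg_neg, smul_smul, map_smul,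
    specProjOn_apply_eigen hz (lie_specProj hz hl u)]
  split_ifs with h
  · rw [inv_mul_cancel₀, one_smul]
    intro hl0
    rw [Complex.ofReal_eq_zero] at hl0
    exact h0 (hl0 ▸ h)
  · rw [smul_zero]

theorem specProjOn_univ {z : L} (hz : z ∈ spectralSet L S) : specProjOn S Set.univ z = 1 := by
  rw [← sum_specProj hz, specProjOn]
  simp

theorem specProjOn_empty (z : L) : specProjOn S ∅ z = 0 := by
  rw [specProjOn]
  simp

theorem specProjOn_union {I J : Set ℝ} (h : Disjoint I J) (z : L) :
    specProjOn S (I ∪ J) z = specProjOn S I z + specProjOn S J z := by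
  classical
  ext u
  simp only [specProjOn_apply, _root_.add_apply, ← Finset.sum_add_distrib]
  refine Finset.sum_congr rfl fun l _ => ?_
  by_cases hI : l ∈ I
  · have : l ∉ J := Set.disjoint_left.mp h hI
    simp [hI, this]
  · simp [hI]

theorem specProjOn_add_compl {z : L} (hz : z ∈ spectralSet L S) (I : Set ℝ) :
    specProjOn S I z + specProjOn S Iᶜ z = 1 := by
  rw [← specProjOn_union disjoint_compl_right, Set.union_compl_self, specProjOn_univ hz]

theorem adC_eq_sum {z : L} (hz : z ∈ spectralSet L S) :
    adC z = ∑ l ∈ S, (l : ℂ) • specProj S l z := by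
  ext u
  rw [_root_.sum_apply]
  conv_lhs => rw [← sum_specProj_apply hz u]
  rw [map_sum]
  exact Finset.sum_congr rfl fun l hl => lie_specProj hz hl u

/-- A filtration only controls projections for upper and lower sets; single eigenprojections are
recovered as such differences. -/
theorem specProj_eq_sub {l : ℝ} (hl : l ∈ S) (z : L) :
    specProj S l z = specProjOn S (Set.Ici l) z - specProjOn S (Set.Ioi l) z := by
  rw [eq_sub_iff_add_eq, show Set.Ici l = {l} ∪ Set.Ioi l by rw [Set.singleton_union, Set.Ioi_insert],
    specProjOn_union (by simp)]
  congr 1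
  classical
  ext u
  simp [specProjOn_apply, hl]

theorem contDiff_aeval {E A : Type*} [NormedAddCommGroup E] [NormedSpace ℂ E] [NormedRing A]
    [NormedAlgebra ℂ A] {f : E → A} {n : WithTop ℕ∞} (hf : ContDiff ℂ n f) (q : ℂ[X]) :
    ContDiff ℂ n (fun z => aeval (f z) q) := by
  simp only [aeval_eq_sum_range]
  exact ContDiff.sum fun i _ => (hf.pow i).const_smul _

theorem contDiff_specProj (S : Finset ℝ) (l : ℝ) {n : WithTop ℕ∞} :
    ContDiff ℂ n (specProj (L := L) S l) :=
  contDiff_aeval adC.contDiff _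

theorem contDiff_specProjOn (S : Finset ℝ) (I : Set ℝ) {n : WithTop ℕ∞} :
    ContDiff ℂ n (specProjOn (L := L) S I) := by
  unfold specProjOn
  exact ContDiff.sum fun l _ => contDiff_specProj S l

theorem isClosed_spectralSet : IsClosed (spectralSet L S) :=
  isClosed_eq (contDiff_aeval (n := 0) adC.contDiff _).continuous continuous_const

theorem lie_lie_eigen {z a b : L} {l m : ℝ} (ha : ⁅z, a⁆ = (l : ℂ) • a)
    (hb : ⁅z, b⁆ = (m : ℂ) • b) : ⁅z, ⁅a, b⁆⁆ = ((l + m : ℝ) : ℂ) • ⁅a, b⁆ := by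
  rw [leibniz_lie, ha, hb]
  push_cast
  rw [smul_lie, lie_smul, add_smul]

theorem specProjOn_map {g : L ≃L[ℂ] L} (hg : IsAut g) {z : L} (hz : z ∈ spectralSet L S)
    (I : Set ℝ) (u : L) : specProjOn S I (g z) (g u) = g (specProjOn S I z u) := by
  refine specProjOn_transfer hz (g : L ≃+ L).toAddMonoidHom (ρ := id) (fun _ => rfl)
    (fun _ h => h) (fun l _ u hu => ?_) I u
  change ⁅g z, g u⁆ = _ • g u
  rw [← hg, hu, map_smul]; rfl

theorem map_mem_spectralSet {g : L ≃L[ℂ] L} (hg : IsAut g) {z : L} (hz : z ∈ spectralSet L S) :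
    g z ∈ spectralSet L S := by
  refine mem_spectralSet_transfer hz (g : L ≃+ L).toAddMonoidHom (ρ := id) (fun _ => rfl)
    (fun _ h => h) g.surjective (fun l _ u hu => ?_)
  change ⁅g z, g u⁆ = _ • g u
  rw [← hg, hu, map_smul]; rfl

theorem mem_nilradical_iff {z : L} (hz : z ∈ spectralSet L S) {u : L} :
    u ∈ nilradical z ↔ specProjOn S (Set.Ioi 0) z u = u := by
  classical
  constructor
  · intro hu
    induction hu using Submodule.iSup_induction' with
    | mem c v hv =>
      rw [specProjOn_apply_eigen hz (Module.End.mem_eigenspace_iff.mp hv),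
        if_pos (show (c : ℝ) ∈ Set.Ioi (0 : ℝ) from c.2)]
    | zero => exact map_zero _
    | add v w _ _ hv hw => rw [map_add, hv, hw]
  · intro hu
    rw [← hu, specProjOn_apply]
    refine Submodule.sum_mem _ fun l hl => ?_
    split_ifs with h
    · exact Submodule.mem_iSup_of_mem ⟨l, h⟩
        (Module.End.mem_eigenspace_iff.mpr (lie_specProj hz hl u))
    · exact zero_mem _

theorem map_mem_nilradical {g : L ≃L[ℂ] L} (hg : IsAut g) {z : L} (hz : z ∈ spectralSet L S)
    {u : L} (hu : u ∈ nilradical z) : g u ∈ nilradical (g z) := by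
  rw [mem_nilradical_iff hz] at hu
  rw [mem_nilradical_iff (map_mem_spectralSet hg hz), specProjOn_map hg hz, hu]

/-! ### Equality of filtrations -/

/-- `ad z` and `ad w` define the same filtration by sums of eigenspaces with large eigenvalue. -/
def FilEq (S : Finset ℝ) (z w : L) : Prop :=
  ∀ m ∈ S, ∀ l ∈ S, m < l → ∀ u,
    specProj S m z (specProj S l w u) = 0 ∧ specProj S m w (specProj S l z u) = 0

theorem FilEq.symm {z w : L} (h : FilEq S z w) : FilEq S w z :=
  fun m hm l hl hml u => (h m hm l hl hml u).symm

theorem FilEq.trans {y z w : L} (hz : z ∈ spectralSet L S) (h1 : FilEq S y z) (h2 : FilEq S z w) :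
    FilEq S y w := by
  have key : ∀ {y w : L}, FilEq S y z → FilEq S z w → ∀ m ∈ S, ∀ l ∈ S, m < l → ∀ u,
      specProj S m y (specProj S l w u) = 0 := by
    intro y w h1 h2 m hm l hl hml u
    rw [← sum_specProj_apply hz (specProj S l w u), map_sum]
    refine Finset.sum_eq_zero fun k hk => ?_
    by_cases hkl : k < l
    · rw [(h2 k hk l hl hkl u).1, map_zero]
    · exact (h1 m hm k hk (by linarith) _).1
  exact fun m hm l hl hml u => ⟨key h1 h2 m hm l hl hml u, key h2.symm h1.symm m hm l hl hml u⟩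

theorem FilEq.refl {z : L} (hz : z ∈ spectralSet L S) : FilEq S z z := fun m hm l hl hml u => by
  have := specProj_apply_of_ne (S := S) hl hml.ne (lie_specProj hz hl u)
  exact ⟨this, this⟩

/-- `ad n` strictly raises the degree given by `ad z`. So the lowest component of an eigenvector `e`
of `ad (z + n)` is an eigenvector of `ad z` for the same eigenvalue `m`. Induction on the position
of `k` in `S` removes all degrees below `m`, and all degrees whatsoever once the degree `m`
component is zero. -/
theorem specProj_eq_zero_of_lie_add {z n e : L} (hz : z ∈ spectralSet L S)
    (hn : n ∈ nilradical z) {m : ℝ} (he : ⁅z + n, e⁆ = (m : ℂ) • e) {k : ℝ} (hk : k ∈ S)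
    (h : k < m ∨ specProj S m z e = 0) : specProj S k z e = 0 := by
  classical
  induction hc : (S.filter (· < k)).card using Nat.strong_induction_on generalizing k with
  | _ c ih =>
  have ih' : ∀ j ∈ S, j < k → specProj S j z e = 0 := by
    intro j hj hjk
    refine ih _ ?_ hj (h.imp (fun h => hjk.trans h) id) rfl
    rw [← hc]
    refine Finset.card_lt_card ⟨fun i hi => ?_, fun hs => ?_⟩
    · simp only [Finset.mem_filter] at hi ⊢
      exact ⟨hi.1, hi.2.trans hjk⟩
    · have : j ∈ S.filter (· < k) := by simp [hj, hjk]
      simpa using hs this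
  by_cases hkm : k = m
  · subst hkm
    exact h.resolve_left (lt_irrefl _)
  -- The surviving terms have degree `i + j` with `i > 0` and `j ≥ k`, so none has degree `k`.
  have hne : specProj S k z ⁅n, e⁆ = 0 := by
    rw [← (mem_nilradical_iff hz).mp hn, ← sum_specProj_apply hz e, specProjOn_apply,
      sum_lie, map_sum]
    refine Finset.sum_eq_zero fun i hi => ?_
    split_ifs with h0
    · rw [lie_sum, map_sum]
      refine Finset.sum_eq_zero fun j hj => ?_
      by_cases hjk : j < k
      · rw [ih' j hj hjk, lie_zero, map_zero]
      · have h2 := lie_lie_eigen (lie_specProj hz hi n) (lie_specProj hz hj e)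
        by_cases hij : i + j ∈ S
        · refine specProj_apply_of_ne hij ?_ h2
          have : (0 : ℝ) < i := h0
          intro hh
          linarith
        · rw [eq_zero_of_notMem hz hij h2, map_zero]
    · rw [zero_lie, map_zero]
  have h3 : specProj S k z ⁅z, e⁆ = (k : ℂ) • specProj S k z e := by
    conv_lhs => rw [← sum_specProj_apply hz e, lie_sum, map_sum]
    rw [Finset.sum_eq_single k]
    · rw [lie_specProj hz hk, map_smul, specProj_apply_self hk (lie_specProj hz hk e)]
    · intro j hj hjk
      rw [lie_specProj hz hj, map_smul, specProj_apply_of_ne hj hjk.symm (lie_specProj hz hj e),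
        smul_zero]
    · exact fun h => absurd hk h
  have h4 := congrArg (specProj S k z) he
  rw [add_lie, map_add, hne, h3, add_zero, map_smul, ← sub_eq_zero, ← sub_smul] at h4
  refine (smul_eq_zero.mp h4).resolve_left ?_
  rw [sub_eq_zero]
  exact_mod_cast hkm

/-- All points of `𝒪` in an Iwasawa fibre define the same filtration. -/
theorem filEq_of_mem_iwasawaFiber {z w : L} (hz : z ∈ spectralSet L S)
    (hw : w ∈ spectralSet L S) (h : w ∈ iwasawaFiber z) : FilEq S z w := by
  classical
  obtain ⟨n, hn, rfl⟩ : ∃ n ∈ nilradical z, w = z + n := ⟨w - z, h, by abel⟩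
  have h1 : ∀ m ∈ S, ∀ l ∈ S, m < l → ∀ u, specProj S m z (specProj S l (z + n) u) = 0 :=
    fun m hm l hl hml u =>
      specProj_eq_zero_of_lie_add hz hn (lie_specProj hw hl u) hm (Or.inl hml)
  -- Expand a `z`-eigenvector `e` of degree `l` in eigenvectors of `ad (z + n)`. The `z`-component
  -- of `e` in degree `m` is zero; terms above `m` contribute nothing to it by `h1`, terms below
  -- vanish by induction. So the `m`-term has no `z`-component of degree `m`, and is itself zero.
  have h2 : ∀ l ∈ S, ∀ m ∈ S, m < l → ∀ u, specProj S m (z + n) (specProj S l z u) = 0 := by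
    intro l hl m hm hml u
    induction hc : (S.filter (· < m)).card using Nat.strong_induction_on generalizing m with
    | _ c ih =>
    have ih' : ∀ j ∈ S, j < m → specProj S j (z + n) (specProj S l z u) = 0 := by
      intro j hj hjk
      refine ih _ ?_ j hj (hjk.trans hml) rfl
      rw [← hc]
      refine Finset.card_lt_card ⟨fun i hi => ?_, fun hs => ?_⟩
      · simp only [Finset.mem_filter] at hi ⊢
        exact ⟨hi.1, hi.2.trans hjk⟩
      · have : j ∈ S.filter (· < m) := by simp [hj, hjk]
        simpa using hs this
    set e := specProj S l z u with he
    have h3 : specProj S m z e = 0 := specProj_apply_of_ne hl hml.ne (lie_specProj hz hl u)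
    rw [← sum_specProj_apply hw e, map_sum, Finset.sum_eq_single m] at h3
    · refine ext_specProj hz fun k hk => ?_
      rw [map_zero]
      exact specProj_eq_zero_of_lie_add hz hn (lie_specProj hw hm e) hk (Or.inr h3)
    · intro j hj hjm
      rcases lt_or_gt_of_ne hjm with h | h
      · rw [ih' j hj h, map_zero]
      · exact h1 m hm j hj h e
    · exact fun h => absurd hm h
  exact fun m hm l hl hml u => ⟨h1 m hm l hl hml u, h2 l hl m hm hml u⟩

theorem FilEq.map {g : L ≃L[ℂ] L} (hg : IsAut g) {z w : L} (hz : z ∈ spectralSet L S)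
    (hw : w ∈ spectralSet L S) (h : FilEq S z w) : FilEq S (g z) (g w) := by
  have key : ∀ {z : L}, z ∈ spectralSet L S → ∀ l u,
      specProj S l (g z) (g u) = g (specProj S l z u) := by
    intro z hz l u
    refine specProj_transfer hz (g : L ≃+ L).toAddMonoidHom (ρ := id) (fun _ => rfl)
      (fun _ h => h) (fun l _ u hu => ?_) l u
    change ⁅g z, g u⁆ = _ • g u
    rw [← hg, hu, map_smul]; rfl
  intro m hm l hl hml u
  obtain ⟨v, rfl⟩ := g.surjective u
  have := h m hm l hl hml v
  simp only [key hz, key hw, this, map_zero, and_self]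

theorem FilEq.mul_eq {z w : L} (h : FilEq S z w)
    {I J : Set ℝ} (hIJ : ∀ m ∈ I, ∀ l ∈ J, m < l) :
    specProjOn S I z * specProjOn S J w = 0 := by
  classical
  ext u
  rw [clm_mul_apply, specProjOn_apply, specProjOn_apply]
  refine Finset.sum_eq_zero fun m hm => ?_
  split_ifs with hmI
  · rw [map_sum]
    refine Finset.sum_eq_zero fun l hl => ?_
    split_ifs with hlJ
    · exact (h m hm l hl (hIJ m hmI l hlJ) u).1
    · exact map_zero _
  · rfl

/-- The projections to a step of the filtration absorb each other. -/
theorem FilEq.mul_upper {z w : L} (hz : z ∈ spectralSet L S)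
    (h : FilEq S z w) {I : Set ℝ} (hI : IsUpperSet I) :
    specProjOn S I z * specProjOn S I w = specProjOn S I w := by
  have := h.mul_eq (I := Iᶜ) (J := I) fun m hm l hl => by
    by_contra hh
    exact hm (hI (not_lt.mp hh) hl)
  have h2 := congrArg (· * specProjOn S I w) (specProjOn_add_compl hz I)
  simpa [add_mul, this] using h2

theorem FilEq.mul_lower {z w : L} (hw : w ∈ spectralSet L S)
    (h : FilEq S z w) {I : Set ℝ} (hI : IsLowerSet I) :
    specProjOn S I z * specProjOn S I w = specProjOn S I z := by
  have := h.mul_eq (I := I) (J := Iᶜ) fun m hm l hl => by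
    by_contra hh
    exact hl (hI (not_lt.mp hh) hm)
  have h2 := congrArg (specProjOn S I z * ·) (specProjOn_add_compl hw I)
  simpa [mul_add, this] using h2

theorem FilEq.nilradical_eq {z w : L} (hz : z ∈ spectralSet L S) (hw : w ∈ spectralSet L S)
    (h : FilEq S z w) : nilradical z = nilradical w := by
  have key : ∀ {z w : L}, z ∈ spectralSet L S → w ∈ spectralSet L S → FilEq S z w →
      ∀ u ∈ nilradical w, u ∈ nilradical z := by
    intro z w hz hw h u hu
    rw [mem_nilradical_iff hz]
    rw [mem_nilradical_iff hw] at hu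
    have := congrArg (fun T : L →L[ℂ] L => T u) (h.mul_upper hz (isUpperSet_Ioi 0))
    rw [← hu]
    exact this
  exact le_antisymm (fun u hu => key hw hz h.symm u hu) (fun u hu => key hz hw h u hu)

end HyperbolicOrbit

namespace HyperbolicOrbit

open Filter Topology ComplexConjugate

variable {L : Type*} [NormedLieRing L] [NormedLieAlgebra ℂ L] [FiniteDimensional ℂ L]

/-! ### The Killing form and conjugations -/

theorem killingForm_lie (a b c : L) : killingForm ℂ L ⁅a, b⁆ c = killingForm ℂ L a ⁅b, c⁆ :=
  LieModule.traceForm_apply_lie_apply ℂ L L a b c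

theorem killingForm_comm (a b : L) : killingForm ℂ L a b = killingForm ℂ L b a :=
  LieModule.traceForm_comm ℂ L L a b

theorem killingForm_lie_left (a b c : L) :
    killingForm ℂ L ⁅a, b⁆ c = -killingForm ℂ L b ⁅a, c⁆ := by
  rw [← lie_skew, map_neg, LinearMap.neg_apply, killingForm_lie]

theorem killingForm_map {g : L ≃L[ℂ] L} (hg : IsAut g) (a b : L) :
    killingForm ℂ L (g a) (g b) = killingForm ℂ L a b := by
  let e : L ≃ₗ⁅ℂ⁆ L :=
    { (g : L ≃ₗ[ℂ] L) with map_lie' := fun {u v} => hg u v }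
  exact LieAlgebra.killingForm_of_equiv_apply e a b

/-- Eigenspaces whose eigenvalues do not add up to zero are orthogonal. -/
theorem killingForm_eigen {z a b : L} {l m : ℝ} (ha : ⁅z, a⁆ = (l : ℂ) • a)
    (hb : ⁅z, b⁆ = (m : ℂ) • b) (h : l + m ≠ 0) : killingForm ℂ L a b = 0 := by
  have h1 := killingForm_lie_left z a b
  rw [ha, hb, map_smul, map_smul, LinearMap.smul_apply, smul_eq_mul, smul_eq_mul] at h1
  have h2 : ((l + m : ℝ) : ℂ) * killingForm ℂ L a b = 0 := by
    push_cast
    linear_combination h1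
  exact (mul_eq_zero.mp h2).resolve_left (by exact_mod_cast h)

variable {θ σ : L →ₛₗ[starRingEnd ℂ] L}

/-- The linear coordinates of the image of a basis under a conjugation. -/
def conjBasis {ι : Type*} [Fintype ι] (hθ : ∀ u, θ (θ u) = u) (b : Module.Basis ι ℂ L) :
    Module.Basis ι ℂ L :=
  Module.Basis.ofEquivFun
    { toFun := fun u i => conj (b.equivFun (θ u) i)
      map_add' := fun u v => by ext i; simp
      map_smul' := fun c u => by ext i; simp
      invFun := fun f => θ (b.equivFun.symm fun i => conj (f i))
      left_inv := fun u => by simp [hθ]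
      right_inv := fun f => by
        ext i
        change conj (b.equivFun (θ (θ _)) i) = f i
        rw [hθ, LinearEquiv.apply_symm_apply, Complex.conj_conj] }

theorem conjBasis_repr {ι : Type*} [Fintype ι] (hθ : ∀ u, θ (θ u) = u)
    (b : Module.Basis ι ℂ L) (u : L) (i : ι) :
    (conjBasis hθ b).repr u i = conj (b.repr (θ u) i) := rfl

theorem conjBasis_apply {ι : Type*} [Fintype ι] (hθ : ∀ u, θ (θ u) = u)
    (b : Module.Basis ι ℂ L) (i : ι) : conjBasis hθ b i = θ (b i) := by
  classical
  apply (conjBasis hθ b).repr.injective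
  ext j
  rw [Module.Basis.repr_self, conjBasis_repr, hθ, Module.Basis.repr_self]
  by_cases h : i = j <;> simp [h]

/-- In a basis for `A` and the conjugate basis for `B` the two matrices are entrywise conjugate. -/
theorem trace_conj_eq (hθ : ∀ u, θ (θ u) = u) {A B : Module.End ℂ L}
    (h : ∀ u, B (θ u) = θ (A u)) : LinearMap.trace ℂ L B = conj (LinearMap.trace ℂ L A) := by
  classical
  let b := Module.finBasis ℂ L
  rw [LinearMap.trace_eq_matrix_trace ℂ b A, LinearMap.trace_eq_matrix_trace ℂ (conjBasis hθ b) B,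
    Matrix.trace, Matrix.trace, map_sum]
  refine Finset.sum_congr rfl fun i _ => ?_
  rw [Matrix.diag_apply, Matrix.diag_apply, LinearMap.toMatrix_apply, LinearMap.toMatrix_apply,
    conjBasis_repr, conjBasis_apply, h, hθ]

theorem killingForm_conj (hθ : IsConjugation θ) (a b : L) :
    killingForm ℂ L (θ a) (θ b) = conj (killingForm ℂ L a b) := by
  rw [killingForm_apply_apply, killingForm_apply_apply]
  exact trace_conj_eq hθ.involutive fun u => by simp [hθ.map_lie]

/-- The component of `u` in the real form. -/
def realPart (θ : L →ₛₗ[starRingEnd ℂ] L) (u : L) : L := (1 / 2 : ℂ) • (u + θ u)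

/-- The imaginary component of `u`. -/
def imagPart (θ : L →ₛₗ[starRingEnd ℂ] L) (u : L) : L := (-Complex.I / 2) • (u - θ u)

theorem conj_realPart (hθ : IsConjugation θ) (u : L) : θ (realPart θ u) = realPart θ u := by
  simp only [realPart, LinearMap.map_smulₛₗ, map_add, hθ.involutive, map_div₀, map_one,
    Complex.conj_ofNat, add_comm]

theorem conj_imagPart (hθ : IsConjugation θ) (u : L) : θ (imagPart θ u) = imagPart θ u := by
  simp only [imagPart, LinearMap.map_smulₛₗ, map_sub, hθ.involutive, map_div₀, map_neg,
    Complex.conj_I, Complex.conj_ofNat]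
  rw [← neg_sub u, smul_neg, ← neg_smul]
  congr 1
  ring

theorem realPart_add_imagPart (u : L) :
    realPart θ u + Complex.I • imagPart θ u = u := by
  rw [realPart, imagPart, smul_smul, show Complex.I * (-Complex.I / 2) = 1 / 2 by
    rw [mul_div_assoc', mul_neg, Complex.I_mul_I, neg_neg], ← smul_add]
  rw [show u + θ u + (u - θ u) = (2 : ℂ) • u by rw [two_smul]; abel, smul_smul]
  norm_num

/-- Writing `u = p + i q` over the real form gives `⟨u, θ u⟩ = ⟨p, p⟩ + ⟨q, q⟩`. Thus `-⟨u, θ v⟩` is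
a positive definite Hermitian form. -/
theorem killingForm_neg (hθ : IsCompactConjugation θ) {u : L} (hu : u ≠ 0) :
    (killingForm ℂ L u (θ u)).re < 0 := by
  set p := realPart θ u with hp
  set q := imagPart θ u with hq
  have hpp : θ p = p := conj_realPart hθ.toIsConjugation u
  have hqq : θ q = q := conj_imagPart hθ.toIsConjugation u
  have huv : u = p + Complex.I • q := (realPart_add_imagPart u).symm
  have hle : ∀ {v : L}, θ v = v → (killingForm ℂ L v v).re ≤ 0 := fun {v} hv => by
    by_cases h : v = 0
    · simp [h]
    · exact (hθ.neg_def v hv h).le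
  have key : killingForm ℂ L u (θ u) = killingForm ℂ L p p + killingForm ℂ L q q := by
    rw [huv, map_add θ, LinearMap.map_smulₛₗ, hpp, hqq, Complex.conj_I]
    simp only [map_add, map_smul, LinearMap.add_apply, LinearMap.smul_apply, smul_eq_mul]
    rw [killingForm_comm q p]
    linear_combination (-killingForm ℂ L q q) * Complex.I_mul_I
  rw [key, Complex.add_re]
  by_cases h : p = 0
  · have : q ≠ 0 := by
      rintro h'
      exact hu (by rw [huv, h, h']; simp)
    linarith [hle hpp, hθ.neg_def q hqq this]
  · linarith [hle hqq, hθ.neg_def p hpp h]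

theorem adC_injective (hθ : IsCompactConjugation θ) :
    Function.Injective (adC : L →L[ℂ] L →L[ℂ] L) := by
  rw [injective_iff_map_eq_zero]
  intro z hz
  by_contra h
  have h1 := killingForm_neg hθ h
  have h2 : LieAlgebra.ad ℂ L z = 0 := by
    ext u
    exact congrArg (fun T : L →L[ℂ] L => T u) hz
  rw [killingForm_apply_apply, h2, LinearMap.zero_comp, map_zero] at h1
  exact lt_irrefl _ h1

/-! ### The spectrum of a hyperbolic element -/

/-- The set of real eigenvalues of `ad x`. -/
def realSpectrum (x : L) : Finset ℝ :=
  ((Module.End.finite_hasEigenvalue (LieAlgebra.ad ℂ L x)).preimage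
    (Complex.ofReal_injective.injOn (s := (fun m : ℝ => (m : ℂ)) ⁻¹'
      {c | Module.End.HasEigenvalue (LieAlgebra.ad ℂ L x) c}))).toFinset

theorem mem_realSpectrum {x : L} {l : ℝ} :
    l ∈ realSpectrum x ↔ Module.End.HasEigenvalue (LieAlgebra.ad ℂ L x) (l : ℂ) := by
  simp only [realSpectrum, Set.Finite.mem_toFinset]
  rfl

theorem mem_realSpectrum_of_lie {x u : L} {l : ℝ} (h : ⁅x, u⁆ = (l : ℂ) • u) (hu : u ≠ 0) :
    l ∈ realSpectrum x :=
  mem_realSpectrum.mpr (Module.End.hasEigenvalue_of_hasEigenvector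
    ⟨Module.End.mem_eigenspace_iff.mpr h, hu⟩)

theorem neg_mem_realSpectrum (hθ : IsConjugation θ) {x : L} (hx : θ x = -x) {l : ℝ}
    (hl : l ∈ realSpectrum x) : -l ∈ realSpectrum x := by
  obtain ⟨u, hu, hu0⟩ := (mem_realSpectrum.mp hl).exists_hasEigenvector
  refine mem_realSpectrum_of_lie (u := θ u) ?_ fun h => hu0 (by rw [← hθ.involutive u, h, map_zero])
  have h1 : ⁅x, u⁆ = (l : ℂ) • u := Module.End.mem_eigenspace_iff.mp hu
  have h2 := congrArg θ h1
  rw [hθ.map_lie, hx, LinearMap.map_smulₛₗ, Complex.conj_ofReal, neg_lie] at h2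
  push_cast
  rw [neg_smul, ← h2, neg_neg]

theorem killingForm_ad_symm (hθ : IsConjugation θ) {x : L} (hx : θ x = -x) (a b : L) :
    killingForm ℂ L ⁅x, a⁆ (θ b) = killingForm ℂ L a (θ ⁅x, b⁆) := by
  rw [killingForm_lie_left, hθ.map_lie, hx, neg_lie, map_neg]

/-- `ad x` is self-adjoint for the Hermitian form `-⟨u, θ v⟩`. Hence eigenvalues are real, and
generalized eigenvectors are eigenvectors because `N² w = 0` forces `⟨N w, θ (N w)⟩ = 0` for
self-adjoint `N`. -/
theorem mem_spectralSet_realSpectrum (hθ : IsCompactConjugation θ) {x : L} (hx : θ x = -x) :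
    x ∈ spectralSet L (realSpectrum x) := by
  have hθ' := hθ.toIsConjugation
  have hzero : ∀ {u : L}, killingForm ℂ L u (θ u) = 0 → u = 0 := fun {u} h => by
    by_contra hu
    exact (killingForm_neg hθ hu).ne (by rw [h]; rfl)
  set A : Module.End ℂ L := LieAlgebra.ad ℂ L x with hA
  have hreal : ∀ {c : ℂ}, A.HasEigenvalue c → conj c = c := by
    intro c hc
    obtain ⟨u, hu, hu0⟩ := hc.exists_hasEigenvector
    have h1 : ⁅x, u⁆ = c • u := Module.End.mem_eigenspace_iff.mp hu
    have h2 := killingForm_ad_symm hθ' hx u u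
    rw [h1, map_smul, LinearMap.map_smulₛₗ, map_smul, LinearMap.smul_apply, smul_eq_mul,
      smul_eq_mul] at h2
    exact (mul_right_cancel₀ (fun h => hu0 (hzero h)) h2).symm
  have hsq : ∀ {c : ℂ}, A.HasEigenvalue c → ∀ k : ℕ, ∀ u,
      ((A - algebraMap ℂ _ c) ^ (k + 1)) u = 0 → (A - algebraMap ℂ _ c) u = 0 := by
    intro c hc
    set N := A - algebraMap ℂ _ c with hN
    have hsymm : ∀ a b, killingForm ℂ L (N a) (θ b) = killingForm ℂ L a (θ (N b)) := by
      intro a b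
      simp only [hN, LinearMap.sub_apply, Module.algebraMap_end_apply, map_sub,
        LinearMap.map_smulₛₗ, hreal hc, RingHom.id_apply]
      rw [LinearMap.smul_apply]
      congr 1
      exact killingForm_ad_symm hθ' hx a b
    have h2 : ∀ w, N (N w) = 0 → N w = 0 := fun w hw =>
      hzero (by rw [hsymm, hw, map_zero, map_zero])
    intro k
    induction k with
    | zero => intro u hu; simpa using hu
    | succ k ih =>
      intro u hu
      refine ih u ?_
      rw [pow_succ', Module.End.mul_apply]
      refine h2 _ ?_
      rw [pow_succ', pow_succ'] at hu
      exact hu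
  have key : ∀ c : ℂ, ∀ u ∈ A.maxGenEigenspace c,
      Polynomial.aeval (adC x) (Lagrange.nodal (realSpectrum x) (fun m : ℝ => (m : ℂ))) u = 0 := by
    intro c u hu
    by_cases hu0 : u = 0
    · rw [hu0, map_zero]
    have hc : A.HasEigenvalue c := by
      have : Module.End.HasUnifEigenvalue A c ⊤ := (Submodule.ne_bot_iff _).mpr ⟨u, hu, hu0⟩
      exact this.lt zero_lt_one
    obtain ⟨k, hk⟩ := (Module.End.mem_maxGenEigenspace _ _ _).mp hu
    have h1 : (A - algebraMap ℂ _ c) u = 0 := hsq hc k u (by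
      rw [pow_succ', Module.End.mul_apply]
      have : ((A - algebraMap ℂ _ c) ^ k) u = 0 := hk
      rw [this, map_zero])
    have h2 : ⁅x, u⁆ = c • u := sub_eq_zero.mp h1
    obtain ⟨r, rfl⟩ := Complex.conj_eq_iff_real.mp (hreal hc)
    rw [aeval_adC_apply h2]
    rw [Lagrange.eval_nodal_at_node (v := fun m : ℝ => (m : ℂ)) (mem_realSpectrum.mpr hc), zero_smul]
  ext u
  have hu : u ∈ ⨆ c, A.maxGenEigenspace c := by
    rw [Module.End.iSup_maxGenEigenspace_eq_top]
    trivial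
  induction hu using Submodule.iSup_induction' with
  | mem c v hv => exact key c v hv
  | zero => simp
  | add v w _ _ hv hw => rw [map_add, hv, hw]; simp

/-! ### Conjugations and exponentials -/

/-- A conjugation as a continuous real linear map. -/
def conjR (θ : L →ₛₗ[starRingEnd ℂ] L) : L →L[ℝ] L :=
  LinearMap.toContinuousLinearMap
    { toFun := θ, map_add' := map_add θ, map_smul' := fun r u => by
        have := LinearMap.map_smulₛₗ θ (r : ℂ) u
        rw [Complex.conj_ofReal] at this
        exact this }

theorem continuous_conj (θ : L →ₛₗ[starRingEnd ℂ] L) : Continuous θ := (conjR θ).continuous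

/-- Conjugation of operators by `θ`. -/
def conjOp (hθ : ∀ u, θ (θ u) = u) : (L →L[ℂ] L) →+* (L →L[ℂ] L) where
  toFun T := LinearMap.toContinuousLinearMap (θ.comp ((T : L →ₗ[ℂ] L).comp θ))
  map_one' := by ext u; exact hθ u
  map_mul' A B := by
    ext u
    change θ (A (B (θ u))) = θ (A (θ (θ (B (θ u)))))
    rw [hθ]
  map_zero' := by ext u; exact map_zero θ
  map_add' A B := by ext u; exact map_add θ _ _

theorem conjOp_apply (hθ : ∀ u, θ (θ u) = u) (T : L →L[ℂ] L) (u : L) :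
    conjOp hθ T u = θ (T (θ u)) := rfl

theorem continuous_conjOp (hθ : ∀ u, θ (θ u) = u) : Continuous (conjOp hθ) := by
  let f : (L →L[ℂ] L) →ₗ[ℝ] (L →L[ℂ] L) :=
    { toFun := conjOp hθ
      map_add' := map_add _
      map_smul' := fun r T => by
        ext u
        exact map_smul (conjR θ) r (T (θ u)) }
  exact f.continuous_of_finiteDimensional

theorem conj_expAd (hθ : IsConjugation θ) (u v : L) : θ (expAd u v) = expAd (θ u) (θ v) := by
  let _ : NormedAlgebra ℚ (L →L[ℂ] L) := .restrictScalars ℚ ℂ _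
  have h := NormedSpace.map_exp (conjOp hθ.involutive) (continuous_conjOp hθ.involutive) (adC u)
  have h2 : conjOp hθ.involutive (adC u) = adC (θ u) := by
    ext w
    rw [conjOp_apply, adC_apply, hθ.map_lie, hθ.involutive, adC_apply]
  rw [h2] at h
  have h3 := congrArg (fun T : L →L[ℂ] L => T (θ v)) h
  simp only [conjOp_apply, hθ.involutive] at h3
  exact h3

theorem conj_apply_of_mem (hθ : IsConjugation θ) {g : L ≃L[ℂ] L}
    (hg : g ∈ adGroup {u : L | θ u = u}) (v : L) : θ (g v) = g (θ v) := by
  revert v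
  refine adGroup_induction (p := fun g => ∀ v, θ (g v) = g (θ v)) ?_ ?_ ?_ ?_ hg
  · intro u hu v
    rw [expEquiv_apply, expEquiv_apply, conj_expAd hθ, show θ u = u from hu]
  · intro v; rfl
  · intro g k hg hk v
    change θ (g (k v)) = g (k _)
    rw [hg, hk]
  · intro g hg v
    apply g.injective
    change g (θ (g.symm v)) = g (g.symm (θ v))
    rw [← hg]; simp

/-- Conjugation of `G^ℂ` by `θ`. -/
theorem exists_conj_mem (hθ : IsConjugation θ) {T : Set L} {g : L ≃L[ℂ] L} (hg : g ∈ adGroup T) :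
    ∃ k ∈ adGroup (θ '' T), ∀ v, θ (g v) = k (θ v) := by
  refine adGroup_induction (p := fun g => ∃ k ∈ adGroup (θ '' T), ∀ v, θ (g v) = k (θ v))
    ?_ ?_ ?_ ?_ hg
  · intro u hu
    exact ⟨expEquiv (θ u), expEquiv_mem ⟨u, hu, rfl⟩, fun v => conj_expAd hθ u v⟩
  · exact ⟨1, one_mem _, fun v => rfl⟩
  · rintro g k ⟨g', hg', h1⟩ ⟨k', hk', h2⟩
    refine ⟨g' * k', mul_mem hg' hk', fun v => ?_⟩
    change θ (g (k v)) = g' (k' _)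
    rw [h1, h2]
  · rintro g ⟨g', hg', h1⟩
    refine ⟨g'⁻¹, inv_mem hg', fun v => ?_⟩
    apply g'.injective
    change g' (θ (g.symm v)) = g' (g'.symm (θ v))
    rw [← h1]; simp

end HyperbolicOrbit

namespace HyperbolicOrbit

open Filter Topology ComplexConjugate

variable {L : Type*} [NormedLieRing L] [NormedLieAlgebra ℂ L] [FiniteDimensional ℂ L]
  {S : Finset ℝ} {θ σ : L →ₛₗ[starRingEnd ℂ] L}

/-! ### Local slices -/

theorem expAd_smul_apply_eigen {z u : L} {c : ℂ} (h : ⁅z, u⁆ = c • u) (t : ℂ) :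
    expAd (t • z) u = Complex.exp (t * c) • u := by
  set f : ℂ → L := fun t => Complex.exp (-(t * c)) • expAd (t • z) u with hf
  have hd : ∀ t, HasDerivAt f 0 t := by
    intro t
    have h1 : HasDerivAt (fun t : ℂ => Complex.exp (-(t * c))) (Complex.exp (-(t * c)) * -c) t := by
      have := ((hasDerivAt_id t).mul_const c).neg.cexp
      simpa using this
    refine (h1.smul (hasDerivAt_expAd_apply z u t)).congr_deriv ?_
    have h2 := congrArg (fun T : L →L[ℂ] L => T u) (adC_comm_expAd z t)
    change ⁅z, expAd (t • z) u⁆ = expAd (t • z) ⁅z, u⁆ at h2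
    rw [h2, h, map_smul, smul_smul, ← add_smul]
    simp
  have hc := is_const_of_deriv_eq_zero (fun t => (hd t).differentiableAt) (fun t => (hd t).deriv) t 0
  simp only [hf, zero_mul, neg_zero, Complex.exp_zero, one_smul, zero_smul, expAd_zero] at hc
  have h2 := congrArg (Complex.exp (t * c) • ·) hc
  simp only [smul_smul, ← Complex.exp_add, add_neg_cancel, Complex.exp_zero, one_smul] at h2
  exact h2

theorem commute_specProj {z w : L} (h : ⁅z, w⁆ = 0) (l : ℝ) :
    Commute (specProj S l z) (specProj S l w) := by
  have h1 : Commute (adC z) (adC w) := by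
    ext u
    change ⁅z, ⁅w, u⁆⁆ = ⁅w, ⁅z, u⁆⁆
    rw [leibniz_lie, h, zero_lie, zero_add]
  have h2 : ∀ (T : L →L[ℂ] L) (a : L), Commute T (adC a) → Commute T (specProj S l a) := by
    intro T a hT
    rw [specProj, Polynomial.aeval_eq_sum_range]
    exact Commute.sum_right _ _ _ fun i _ => (hT.pow_right i).smul_right _
  exact h2 _ _ (h2 _ _ h1.symm).symm

/-- Commuting idempotents satisfy `(p - q)³ = p - q`, so a nonzero difference has norm at least `1`.
-/
theorem eq_of_commuting_idempotents {A : Type*} [NormedRing A] {p q : A} (hp : p * p = p)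
    (hq : q * q = q) (h : Commute p q) (hn : ‖p - q‖ < 1) : p = q := by
  have hc : p * q = q * p := h
  have key : (p - q) = (p - q) * (p - q) * (p - q) := by
    have h1 : (p - q) * (p - q) = p + q - 2 • (p * q) := by
      rw [sub_mul, mul_sub, mul_sub, hp, hq, ← hc]; abel
    rw [h1]
    have h2 : p * q * p = p * q := by rw [hc, mul_assoc, hp]
    have h3 : p * q * q = p * q := by rw [mul_assoc, hq]
    rw [sub_mul, add_mul, mul_sub, mul_sub, hp, hq, ← hc, smul_mul_assoc, mul_sub, h2, h3]
    abel
  by_contra hne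
  have h0 : 0 < ‖p - q‖ := norm_pos_iff.mpr (sub_ne_zero.mpr hne)
  have h1 : ‖p - q‖ ≤ ‖p - q‖ * ‖p - q‖ * ‖p - q‖ := by
    conv_lhs => rw [key]
    exact (norm_mul_le _ _).trans (mul_le_mul_of_nonneg_right (norm_mul_le _ _) (norm_nonneg _))
  nlinarith [mul_pos h0 h0]

theorem specProj_mul_self {z : L} (hz : z ∈ spectralSet L S) {l : ℝ} (hl : l ∈ S) :
    specProj S l z * specProj S l z = specProj S l z := by
  ext u
  exact specProj_apply_self hl (lie_specProj hz hl u)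

/-- The automorphisms `exp (-s ad z)` fix `z` and multiply the `l`-component of `q` by `exp (-s l)`.
As `s → ∞` only the component in degree zero survives, and the spectral set is closed and invariant.
-/
theorem add_specProjOn_zero_mem {z q : L} (hz : z ∈ spectralSet L S)
    (hq : specProjOn S (Set.Iio 0) z q = 0) (h : z + q ∈ spectralSet L S) :
    z + specProjOn S {0} z q ∈ spectralSet L S := by
  classical
  have hmem : ∀ s : ℝ, expAd (((-s : ℝ) : ℂ) • z) (z + q) ∈ spectralSet L S := fun s =>
    map_mem_spectralSet (isAut_expEquiv (((-s : ℝ) : ℂ) • z)) h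
  refine isClosed_spectralSet.mem_of_tendsto (b := atTop) ?_ (Eventually.of_forall hmem)
  have hz0 : ∀ t : ℂ, expAd (t • z) z = z := fun t => by
    have : ⁅z, z⁆ = (0 : ℂ) • z := by simp
    rw [expAd_smul_apply_eigen this]; simp
  simp only [map_add, hz0]
  refine tendsto_const_nhds.add ?_
  have hq' : ∀ l ∈ S, l < 0 → specProj S l z q = 0 := by
    intro l hl h0
    have h1 := congrArg (specProj S l z) hq
    rw [map_zero, specProjOn_apply, map_sum, Finset.sum_eq_single l] at h1
    · rwa [if_pos (show l ∈ Set.Iio (0 : ℝ) from h0),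
        specProj_apply_self hl (lie_specProj hz hl q)] at h1
    · intro m hm hml
      split_ifs
      · exact specProj_apply_of_ne hm hml.symm (lie_specProj hz hm q)
      · exact map_zero _
    · exact fun h => absurd hl h
  have hexp : ∀ s : ℝ, expAd (((-s : ℝ) : ℂ) • z) q =
      ∑ l ∈ S, ((Real.exp (-s * l) : ℝ) : ℂ) • specProj S l z q := by
    intro s
    conv_lhs => rw [← sum_specProj_apply hz q]
    rw [map_sum]
    refine Finset.sum_congr rfl fun l hl => ?_
    rw [expAd_smul_apply_eigen (lie_specProj hz hl q)]
    push_cast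
    rfl
  simp only [hexp, specProjOn_apply]
  refine tendsto_finsetSum _ fun l hl => ?_
  rcases lt_trichotomy l 0 with h0 | h0 | h0
  · rw [hq' l hl h0]
    simp
  · subst h0
    simp
  · rw [if_neg (show l ∉ ({0} : Set ℝ) from h0.ne')]
    have h1 : Tendsto (fun s : ℝ => Real.exp (-s * l)) atTop (𝓝 0) := by
      refine Real.tendsto_exp_atBot.comp ?_
      exact (tendsto_neg_atTop_atBot).atBot_mul_const h0
    have h2 := ((Complex.continuous_ofReal.tendsto 0).comp h1).smul_const (specProj S l z q)
    simpa using h2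

/-- Elements of `spectralSet L S` close to `z` in `z + 𝔭(z)` lie in the Iwasawa fibre of `z`. -/
theorem eventually_mem_nilradical (hθ : IsCompactConjugation θ) {z : L}
    (hz : z ∈ spectralSet L S) : ∀ᶠ q in 𝓝 (0 : L), specProjOn S (Set.Iio 0) z q = 0 →
      z + q ∈ spectralSet L S → q ∈ nilradical z := by
  classical
  have h1 : ∀ᶠ q in 𝓝 (0 : L), ∀ l ∈ S,
      ‖specProj S l (z + specProjOn S {0} z q) - specProj S l z‖ < 1 := by
    rw [Filter.eventually_all_finset]
    intro l _
    have hc : Continuous fun q => ‖specProj S l (z + specProjOn S {0} z q) - specProj S l z‖ :=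
      (((contDiff_specProj (L := L) S l (n := 0)).continuous.comp
        (continuous_const.add (specProjOn S {0} z).continuous)).sub continuous_const).norm
    refine hc.continuousAt.eventually_lt continuousAt_const ?_
    simp
  filter_upwards [h1] with q hq hq0 hM
  have hw := add_specProjOn_zero_mem hz hq0 hM
  set w := z + specProjOn S {0} z q with hwdef
  have hlie0 : ⁅z, specProjOn S {0} z q⁆ = 0 := by
    rw [specProjOn_apply, lie_sum]
    refine Finset.sum_eq_zero fun l hl => ?_
    split_ifs with h0
    · rw [lie_specProj hz hl, show l = 0 from h0]; simp
    · simp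
  have hlie : ⁅z, w⁆ = 0 := by rw [hwdef, lie_add, lie_self, zero_add, hlie0]
  -- `z` and `w` commute and have close, hence equal, spectral projections; these determine `ad z`
  -- and `ad w`.
  have heq : w = z := by
    apply adC_injective hθ
    rw [adC_eq_sum hw, adC_eq_sum hz]
    refine Finset.sum_congr rfl fun l hl => ?_
    rw [eq_of_commuting_idempotents (specProj_mul_self hw hl) (specProj_mul_self hz hl)
      (commute_specProj hlie l).symm (hq l hl)]
  have h0 : specProjOn S {0} z q = 0 := by simpa [hwdef] using heq
  rw [mem_nilradical_iff hz]
  have h2 : specProjOn S (Set.Iio 0 ∪ {0}) z q + specProjOn S (Set.Ioi 0) z q = q := by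
    rw [← _root_.add_apply, ← specProjOn_union (by simp [Set.disjoint_left]),
      Set.Iio_union_right, Set.Iic_union_Ioi, specProjOn_univ hz]
    rfl
  rw [specProjOn_union (by simp), _root_.add_apply, hq0, h0, zero_add, zero_add] at h2
  exact h2

/-- If `V + 𝔭(z) = L`, then the points near `z` are `exp V`-translates of points of the Iwasawa
fibre of `z`. -/
theorem eventually_exists_expAd (hθ : IsCompactConjugation θ) {z : L} (hz : z ∈ spectralSet L S)
    (V : Submodule ℝ L)
    (hV : ∀ u, ∃ v ∈ V, specProjOn S (Set.Iio 0) z (u - v) = 0) :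
    ∀ᶠ w in 𝓝 z, w ∈ spectralSet L S →
      ∃ v ∈ V, ∃ q ∈ nilradical z, w = expAd v (z + q) := by
  classical
  let P : Submodule ℝ L := LinearMap.ker ((specProjOn S (Set.Iio 0) z).restrictScalars ℝ).toLinearMap
  have hcV : CompleteSpace V := FiniteDimensional.complete ℝ V
  have hcP : CompleteSpace P := FiniteDimensional.complete ℝ P
  -- The derivative of `Ψ` at the origin is `(v, q) ↦ ⁅v, z⁆ + q`, which is onto because `V + 𝔭(z) =
  -- L`; hence `Ψ` maps neighbourhoods of the origin onto neighbourhoods of `z`.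
  let Ψ : V × P → L := fun p => expAd (p.1 : L) (z + p.2)
  let D : V × P →L[ℝ] L :=
    ((adC.flip z).restrictScalars ℝ ∘L V.subtypeL ∘L ContinuousLinearMap.fst ℝ V P) +
      (P.subtypeL ∘L ContinuousLinearMap.snd ℝ V P)
  have hΨ : HasStrictFDerivAt Ψ D 0 := by
    have h1 : HasStrictFDerivAt (fun p : V × P => adC (p.1 : L))
        ((adC (L := L)).restrictScalars ℝ ∘L V.subtypeL ∘L ContinuousLinearMap.fst ℝ V P) 0 :=
      ((adC (L := L)).restrictScalars ℝ ∘L V.subtypeL ∘L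
        ContinuousLinearMap.fst ℝ V P).hasStrictFDerivAt
    have h2 : HasStrictFDerivAt (NormedSpace.exp : (L →L[ℂ] L) → (L →L[ℂ] L))
        (1 : (L →L[ℂ] L) →L[ℝ] (L →L[ℂ] L)) (adC ((0 : V × P).1 : L)) := by
      simpa using hasStrictFDerivAt_exp_zero (𝕂 := ℝ) (𝔸 := L →L[ℂ] L)
    have h3 := h2.comp (0 : V × P) h1
    have h4 := (ContinuousLinearMap.restrictScalarsL ℂ L L ℝ ℝ).hasStrictFDerivAt.comp (0 : V × P) h3
    have h5 : HasStrictFDerivAt (fun p : V × P => z + (p.2 : L))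
        (P.subtypeL ∘L ContinuousLinearMap.snd ℝ V P) 0 :=
      (P.subtypeL ∘L ContinuousLinearMap.snd ℝ V P).hasStrictFDerivAt.const_add z
    refine (h4.clm_apply h5).congr_fderiv ?_
    ext p <;> simp [D]
  have hsurj : D.range = ⊤ := by
    rw [LinearMap.range_eq_top]
    intro u
    obtain ⟨u', -, hu'⟩ := exists_lie_eq_specProjOn hz (I := Set.Iio 0) (by simp) u
    obtain ⟨v, hv, hp⟩ := hV u'
    refine ⟨(⟨v, hv⟩, ⟨u - ⁅v, z⁆, ?_⟩), ?_⟩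
    · change specProjOn S (Set.Iio 0) z (u - ⁅v, z⁆) = 0
      have h1 : specProjOn S (Set.Iio 0) z ⁅u' - v, z⁆ = 0 := by
        rw [← lie_skew, map_neg, specProjOn_lie hz, hp, lie_zero, neg_zero]
      rwa [sub_lie, hu', map_sub, specProjOn_idem hz, ← map_sub] at h1
    · simp [D]
  have hmap := hΨ.map_nhds_eq_of_surj hsurj
  have hΨ0 : Ψ 0 = z := by simp [Ψ]
  rw [hΨ0] at hmap
  rw [← hmap, eventually_map]
  have hev : ∀ᶠ p : V × P in 𝓝 0, specProjOn S (Set.Iio 0) z (p.2 : L) = 0 →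
      z + p.2 ∈ spectralSet L S → (p.2 : L) ∈ nilradical z := by
    have hc : Tendsto (fun p : V × P => (p.2 : L)) (𝓝 0) (𝓝 0) :=
      (continuous_subtype_val.comp continuous_snd).tendsto (0 : V × P)
    exact hc.eventually (eventually_mem_nilradical hθ hz)
  filter_upwards [hev] with p hp hM
  refine ⟨p.1, p.1.2, p.2, hp p.2.2 ?_, rfl⟩
  have := map_mem_spectralSet (isAut_expEquiv (-(p.1 : L))) hM
  rwa [expEquiv_apply, expAd_neg_apply] at this

end HyperbolicOrbit

namespace HyperbolicOrbit

open Filter Topology ComplexConjugate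

variable {L : Type*} [NormedLieRing L] [NormedLieAlgebra ℂ L] [FiniteDimensional ℂ L]
  {S : Finset ℝ} {θ σ : L →ₛₗ[starRingEnd ℂ] L} {x : L}

/-! ### The Iwasawa projection -/

theorem map_expAd {g : L ≃L[ℂ] L} (hg : IsAut g) (u v : L) :
    g (expAd u v) = expAd (g u) (g v) := by
  let _ : NormedAlgebra ℚ (L →L[ℂ] L) := .restrictScalars ℚ ℂ _
  have h : SemiconjBy (g : L →L[ℂ] L) (adC u) (adC (g u)) := by
    ext w
    exact hg u w
  exact congrArg (fun T : L →L[ℂ] L => T v) h.exp_right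

theorem mem_iwasawaFiber_map {g : L ≃L[ℂ] L} (hg : IsAut g) {y z : L}
    (hy : y ∈ spectralSet L S) (h : z ∈ iwasawaFiber y) : g z ∈ iwasawaFiber (g y) := by
  change g z - g y ∈ nilradical (g y)
  rw [← map_sub]
  exact map_mem_nilradical hg hy h

theorem mem_iwasawaFiber_trans {a b c : L} (hb : b ∈ spectralSet L S) (hc : c ∈ spectralSet L S)
    (h1 : a ∈ iwasawaFiber b) (h2 : b ∈ iwasawaFiber c) : a ∈ iwasawaFiber c := by
  have h3 := (filEq_of_mem_iwasawaFiber hc hb h2).nilradical_eq hc hb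
  change a - c ∈ nilradical c
  rw [← sub_add_sub_cancel a b c]
  refine add_mem ?_ h2
  rw [h3]
  exact h1

theorem compactOrbit_subset : compactOrbit θ x ⊆ complexOrbit x := fun _ ⟨g, hg, h⟩ =>
  ⟨g, adGroup_mono (Set.subset_univ _) hg, h⟩

theorem mem_compactOrbit_self : x ∈ compactOrbit θ x := ⟨1, one_mem _, rfl⟩

theorem conj_eq_neg_of_mem (hθ : IsConjugation θ) (hx : θ x = -x) {y : L}
    (hy : y ∈ compactOrbit θ x) : θ y = -y := by
  obtain ⟨g, hg, rfl⟩ := hy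
  rw [conj_apply_of_mem hθ hg, hx, map_neg]

theorem apply_mem_compactOrbit {y : L} {g : L ≃L[ℂ] L} (hg : g ∈ adGroup {u : L | θ u = u})
    (hy : y ∈ compactOrbit θ x) : g y ∈ compactOrbit θ x := by
  obtain ⟨k, hk, rfl⟩ := hy
  exact ⟨g * k, mul_mem hg hk, rfl⟩

/-- The points of `𝒪` act semisimply with the same spectrum as `x`. -/
theorem complexOrbit_subset (hθ : IsCompactConjugation θ) (hx : θ x = -x) :
    complexOrbit x ⊆ spectralSet L (realSpectrum x) := by
  rintro _ ⟨g, hg, rfl⟩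
  exact map_mem_spectralSet (isAut_of_mem hg) (mem_spectralSet_realSpectrum hθ hx)

theorem neg_lie_eigen {φ : L →+ L} (hφ : ∀ u v, φ ⁅u, v⁆ = ⁅φ u, φ v⁆)
    (hr : ∀ (r : ℝ) u, φ ((r : ℂ) • u) = (r : ℂ) • φ u) {z u : L} {l : ℝ}
    (h : ⁅z, u⁆ = (l : ℂ) • u) : ⁅-φ z, φ u⁆ = ((-l : ℝ) : ℂ) • φ u := by
  rw [neg_lie, ← hφ, h, hr, ← neg_smul, Complex.ofReal_neg]

theorem specProjOn_neg_map {φ : L →+ L} (hφ : ∀ u v, φ ⁅u, v⁆ = ⁅φ u, φ v⁆)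
    (hr : ∀ (r : ℝ) u, φ ((r : ℂ) • u) = (r : ℂ) • φ u) (hS : ∀ l ∈ S, -l ∈ S) {z : L}
    (hz : z ∈ spectralSet L S) (I : Set ℝ) (u : L) :
    specProjOn S I (-φ z) (φ u) = φ (specProjOn S (-I) z u) :=
  specProjOn_transfer hz φ neg_neg hS (fun _ _ _ => neg_lie_eigen hφ hr) I u

theorem neg_map_mem_spectralSet {φ : L →+ L} (hφ : ∀ u v, φ ⁅u, v⁆ = ⁅φ u, φ v⁆)
    (hr : ∀ (r : ℝ) u, φ ((r : ℂ) • u) = (r : ℂ) • φ u) (hs : Function.Surjective φ)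
    (hS : ∀ l ∈ S, -l ∈ S) {z : L} (hz : z ∈ spectralSet L S) : -φ z ∈ spectralSet L S :=
  mem_spectralSet_transfer hz φ neg_neg hS hs (fun _ _ _ => neg_lie_eigen hφ hr)

theorem conj_real_smul (r : ℝ) (u : L) : θ ((r : ℂ) • u) = (r : ℂ) • θ u := by
  rw [LinearMap.map_smulₛₗ, Complex.conj_ofReal]

theorem specProjOn_neg_conj (hθ : IsConjugation θ) (hS : ∀ l ∈ S, -l ∈ S) {z : L}
    (hz : z ∈ spectralSet L S) (I : Set ℝ) (u : L) :
    specProjOn S I (-θ z) (θ u) = θ (specProjOn S (-I) z u) :=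
  specProjOn_neg_map (φ := θ.toAddMonoidHom) hθ.map_lie (fun r u => conj_real_smul r u) hS hz I u

theorem neg_conj_mem_spectralSet (hθ : IsConjugation θ) (hS : ∀ l ∈ S, -l ∈ S) {z : L}
    (hz : z ∈ spectralSet L S) : -θ z ∈ spectralSet L S :=
  neg_map_mem_spectralSet (φ := θ.toAddMonoidHom) hθ.map_lie (fun r u => conj_real_smul r u)
    (fun u => ⟨θ u, hθ.involutive u⟩) hS hz

/-- The compact real form. -/
def realForm (θ : L →ₛₗ[starRingEnd ℂ] L) : Submodule ℝ L where
  carrier := {u | θ u = u}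
  add_mem' {a b} ha hb := by
    change θ (a + b) = a + b
    rw [map_add, show θ a = a from ha, show θ b = b from hb]
  zero_mem' := map_zero θ
  smul_mem' r u hu := (conj_real_smul r u).trans (congrArg _ hu)

/-- `L = 𝔤 + 𝔭(y)` for `y ∈ i𝔤`. -/
theorem exists_realForm_sub (hθ : IsConjugation θ) (hS : ∀ l ∈ S, -l ∈ S) {y : L}
    (hy : y ∈ spectralSet L S) (hθy : θ y = -y) (u : L) :
    ∃ v ∈ realForm θ, specProjOn S (Set.Iio 0) y (u - v) = 0 := by
  set a := specProjOn S (Set.Iio 0) y u with ha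
  refine ⟨a + θ a, ?_, ?_⟩
  · change θ (a + θ a) = a + θ a
    rw [map_add, hθ.involutive, add_comm]
  · have h1 : specProjOn S (Set.Iio 0) y (θ a) = 0 := by
      have h2 := specProjOn_neg_conj hθ hS hy (Set.Iio 0) a
      rw [hθy, neg_neg] at h2
      rw [h2, ha]
      have h3 := congrArg (fun T : L →L[ℂ] L => T u) (specProjOn_mul hy (-Set.Iio 0) (Set.Iio 0))
      have h4 : (-Set.Iio (0 : ℝ)) ∩ Set.Iio 0 = ∅ := by
        ext t; simp; intro h; linarith
      rw [h4, specProjOn_empty] at h3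
      rw [show specProjOn S (-Set.Iio 0) y (specProjOn S (Set.Iio 0) y u) = 0 from h3, map_zero]
    rw [map_sub, map_add, h1, ha, specProjOn_idem hy, add_zero, sub_self]

/-- Compactness of the unit sphere. The bound permits smallness to be measured by `-⟨u, θ u⟩`, which
is invariant under `G`, unlike the chosen norm. -/
theorem exists_pos_mul_sq_le (hθ : IsCompactConjugation θ) :
    ∃ c > 0, ∀ u : L, c * ‖u‖ ^ 2 ≤ -(killingForm ℂ L u (θ u)).re := by
  have hc : Continuous fun u : L => -(killingForm ℂ L u (θ u)).re := by
    have h1 : Continuous fun p : L × L => killingForm ℂ L p.1 p.2 := by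
      have : Continuous fun p : L × L => (LinearMap.toContinuousLinearMap
          ((LinearMap.toContinuousLinearMap (𝕜 := ℂ) (E := L) (F' := ℂ)).toLinearMap ∘ₗ
            (killingForm ℂ L : L →ₗ[ℂ] L →ₗ[ℂ] ℂ)) : L →L[ℂ] L →L[ℂ] ℂ) p.1 p.2 := by fun_prop
      exact this
    exact (Complex.continuous_re.comp (h1.comp (continuous_id.prodMk (continuous_conj θ)))).neg
  have hprop : ProperSpace L := FiniteDimensional.proper ℂ L
  rcases (Metric.sphere (0 : L) 1).eq_empty_or_nonempty with he | hne
  · refine ⟨1, one_pos, fun u => ?_⟩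
    have : u = 0 := by
      by_contra hu
      have h1 : ((‖u‖⁻¹ : ℝ) : ℂ) • u ∈ Metric.sphere (0 : L) 1 := by
        rw [mem_sphere_zero_iff_norm, norm_smul, Complex.norm_real, norm_inv, norm_norm,
          inv_mul_cancel₀ (norm_ne_zero_iff.mpr hu)]
      rw [he] at h1
      exact h1
    simp [this]
  · obtain ⟨v, hv, hmin⟩ := (isCompact_sphere (0 : L) 1).exists_isMinOn hne hc.continuousOn
    have hv0 : v ≠ 0 := by
      rintro rfl
      simp at hv
    refine ⟨_, neg_pos.mpr (killingForm_neg hθ hv0), fun u => ?_⟩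
    by_cases hu : u = 0
    · simp [hu]
    have h1 : ((‖u‖⁻¹ : ℝ) : ℂ) • u ∈ Metric.sphere (0 : L) 1 := by
      rw [mem_sphere_zero_iff_norm, norm_smul, Complex.norm_real, norm_inv, norm_norm,
        inv_mul_cancel₀ (norm_ne_zero_iff.mpr hu)]
    have h2 := hmin h1
    simp only [Set.mem_ofPred_eq, conj_real_smul, map_smul, LinearMap.smul_apply, smul_eq_mul,
      ← mul_assoc, ← Complex.ofReal_mul, Complex.re_ofReal_mul] at h2
    have h3 : 0 < ‖u‖ := norm_pos_iff.mpr hu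
    rw [← mul_neg, ← mul_inv, ← div_eq_inv_mul, le_div_iff₀ (by positivity)] at h2
    rwa [sq]

/-- Iwasawa decomposition: every Iwasawa fibre in `𝒪` meets `X`. -/
theorem exists_mem_compactOrbit (hθ : IsCompactConjugation θ) (hx : θ x = -x) {z : L}
    (hz : z ∈ complexOrbit x) : ∃ y ∈ compactOrbit θ x, z ∈ iwasawaFiber y := by
  have hM := complexOrbit_subset hθ hx
  have hθ' := hθ.toIsConjugation
  have hS : ∀ l ∈ realSpectrum x, -l ∈ realSpectrum x := fun l => neg_mem_realSpectrum hθ' hx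
  let P : L → Prop := fun z => ∃ y ∈ compactOrbit θ x, z ∈ iwasawaFiber y
  have hloc : ∀ᶠ u in 𝓝 (0 : L), P (expAd u x) := by
    have h1 := eventually_exists_expAd hθ (hM (mem_complexOrbit_self x)) (realForm θ)
      (exists_realForm_sub hθ' hS (hM (mem_complexOrbit_self x)) hx)
    have h2 : Tendsto (fun u : L => expAd u x) (𝓝 0) (𝓝 x) := by
      have : Continuous fun u : L => expAd u x := by
        let _ : NormedAlgebra ℚ (L →L[ℂ] L) := .restrictScalars ℚ ℂ _
        simp only [expAd_eq]
        exact (NormedSpace.exp_continuous.comp adC.continuous).clm_apply continuous_const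
      simpa using this.tendsto 0
    filter_upwards [h2.eventually h1] with u hu
    obtain ⟨v, hv, q, hq, h⟩ := hu (map_mem_spectralSet (isAut_expEquiv u)
      (hM (mem_complexOrbit_self x)))
    refine ⟨expEquiv v x, apply_mem_compactOrbit (expEquiv_mem hv) mem_compactOrbit_self, ?_⟩
    rw [h]
    refine mem_iwasawaFiber_map (g := expEquiv v) (isAut_expEquiv v)
      (hM (mem_complexOrbit_self x)) ?_
    change x + q - x ∈ nilradical x
    rwa [add_sub_cancel_left]
  -- Expressed through the `G`-invariant form, the neighbourhood found at `x` has the same size at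
  -- every point of `X`.
  obtain ⟨ε, hε, hball⟩ : ∃ ε > 0, ∀ u : L, -(killingForm ℂ L u (θ u)).re < ε → P (expAd u x) := by
    obtain ⟨δ, hδ, h1⟩ := Metric.eventually_nhds_iff.mp hloc
    obtain ⟨c, hc, h2⟩ := exists_pos_mul_sq_le hθ
    refine ⟨c * δ ^ 2, by positivity, fun u hu => h1 ?_⟩
    rw [dist_zero_right]
    have h3 := lt_of_mul_lt_mul_left ((h2 u).trans_lt hu) hc.le
    exact lt_of_pow_lt_pow_left₀ 2 hδ.le h3
  have hX : ∀ y ∈ compactOrbit θ x, ∀ u : L, -(killingForm ℂ L u (θ u)).re < ε →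
      P (expAd u y) := by
    rintro _ ⟨g, hg, rfl⟩ u hu
    have hga := isAut_of_mem hg
    obtain ⟨v, rfl⟩ := g.surjective u
    rw [conj_apply_of_mem hθ' hg, killingForm_map hga] at hu
    obtain ⟨y, hy, hyz⟩ := hball v hu
    rw [← map_expAd hga]
    exact ⟨g y, apply_mem_compactOrbit hg hy,
      mem_iwasawaFiber_map hga (hM (compactOrbit_subset hy)) hyz⟩
  have hstep : ∀ u : L, -(killingForm ℂ L u (θ u)).re < ε → ∀ z, P z → P (expAd u z) := by
    rintro u hu z ⟨y, hy, hyz⟩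
    obtain ⟨y', hy', h⟩ := hX y hy u hu
    have hyM := hM (compactOrbit_subset hy)
    exact ⟨y', hy', mem_iwasawaFiber_trans (map_mem_spectralSet (isAut_expEquiv u) hyM)
      (hM (compactOrbit_subset hy')) (mem_iwasawaFiber_map (isAut_expEquiv u) hyM hyz) h⟩
  -- Any `exp (ad u)` is a power of `exp (ad v)` with `v` of size below `ε`, and each such factor
  -- preserves `P`.
  have hall : ∀ u : L, ∀ z, P z → P (expAd u z) := by
    intro u z hPz
    obtain ⟨n, hn⟩ := exists_nat_gt (-(killingForm ℂ L u (θ u)).re / ε)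
    set v : L := (((n + 1 : ℕ) : ℝ)⁻¹ : ℝ) • u with hv
    have hv' : v = ((((n + 1 : ℕ) : ℝ)⁻¹ : ℝ) : ℂ) • u := rfl
    have hu : u = (n + 1) • v := by
      rw [hv, ← Nat.cast_smul_eq_nsmul ℝ, smul_smul, mul_inv_cancel₀ (by positivity), one_smul]
    have hsmall : -(killingForm ℂ L v (θ v)).re < ε := by
      rw [hv', conj_real_smul, map_smul, map_smul, LinearMap.smul_apply, smul_eq_mul, smul_eq_mul,
        ← mul_assoc, ← Complex.ofReal_mul, Complex.re_ofReal_mul, ← mul_neg, ← mul_inv,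
        ← div_eq_inv_mul, div_lt_iff₀ (by positivity)]
      rw [div_lt_iff₀ hε] at hn
      have : (n : ℝ) ≤ ((n + 1 : ℕ) : ℝ) * ((n + 1 : ℕ) : ℝ) := by push_cast; nlinarith [(Nat.cast_nonneg n : (0:ℝ) ≤ n)]
      nlinarith
    have hpow : ∀ m : ℕ, P ((expAd v ^ m) z) := by
      intro m
      induction m with
      | zero => exact hPz
      | succ m ih =>
        rw [pow_succ', clm_mul_apply]
        exact hstep v hsmall _ ih
    rw [hu, expAd_nsmul]
    exact hpow (n + 1)
  obtain ⟨g, hg, rfl⟩ := hz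
  have key : (∀ z, P z → P (g z)) ∧ ∀ z, P z → P (g⁻¹ z) := by
    refine adGroup_induction (p := fun g => (∀ z, P z → P (g z)) ∧ ∀ z, P z → P (g⁻¹ z))
      ?_ ?_ ?_ ?_ hg
    · intro u _
      rw [expEquiv_inv]
      exact ⟨hall u, hall (-u)⟩
    · exact ⟨fun z h => h, fun z h => h⟩
    · intro g k hg hk
      rw [mul_inv_rev]
      exact ⟨fun z h => hg.1 _ (hk.1 z h), fun z h => hk.2 _ (hg.2 z h)⟩
    · intro g hg
      rw [inv_inv]
      exact hg.symm
  refine key.1 x ⟨x, mem_compactOrbit_self, ?_⟩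
  change x - x ∈ nilradical x
  rw [sub_self]
  exact zero_mem _

theorem isUpperSet_neg {I : Set ℝ} (hI : IsUpperSet I) : IsLowerSet (-I) :=
  fun _ _ hab ha => hI (neg_le_neg hab) ha

theorem specProjOn_conj_of_eq_neg (hθ : IsConjugation θ) (hS : ∀ l ∈ S, -l ∈ S) {y : L}
    (hy : y ∈ spectralSet L S) (hθy : θ y = -y) (I : Set ℝ) (u : L) :
    specProjOn S I y (θ u) = θ (specProjOn S (-I) y u) := by
  have h2 := specProjOn_neg_conj hθ hS hy I u
  rwa [hθy, neg_neg] at h2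

/-- A point of `i𝔤` is determined by its filtration. -/
theorem eq_of_filEq (hθ : IsCompactConjugation θ) (hS : ∀ l ∈ S, -l ∈ S) {y y' : L}
    (hy : y ∈ spectralSet L S) (hy' : y' ∈ spectralSet L S) (hθy : θ y = -y) (hθy' : θ y' = -y')
    (h : FilEq S y y') : y = y' := by
  have hθ' := hθ.toIsConjugation
  -- For upper `I` the common filtration gives `E_I(y) E_I(y') = E_I(y')`, and for the lower set
  -- `-I` it gives `E_{-I}(y) E_{-I}(y') = E_{-I}(y)`. On `i𝔤` conjugation by `θ` exchanges `I` and
  -- `-I`, which turns the second law into `E_I(y) E_I(y') = E_I(y)`.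
  have key : ∀ I : Set ℝ, IsUpperSet I → specProjOn S I y = specProjOn S I y' := by
    intro I hI
    rw [← h.mul_upper hy hI]
    ext u
    obtain ⟨v, rfl⟩ : ∃ v, θ v = u := ⟨θ u, hθ'.involutive u⟩
    rw [clm_mul_apply, specProjOn_conj_of_eq_neg hθ' hS hy' hθy',
      specProjOn_conj_of_eq_neg hθ' hS hy hθy, specProjOn_conj_of_eq_neg hθ' hS hy hθy]
    exact congrArg (fun T : L →L[ℂ] L => θ (T v)) (h.mul_lower hy' (isUpperSet_neg hI)).symm
  apply adC_injective hθ
  rw [adC_eq_sum hy, adC_eq_sum hy']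
  refine Finset.sum_congr rfl fun l hl => ?_
  rw [specProj_eq_sub hl, specProj_eq_sub hl, key _ (isUpperSet_Ici l), key _ (isUpperSet_Ioi l)]

theorem iwasawaProj_spec (hθ : IsCompactConjugation θ) (hx : θ x = -x) {z : L}
    (hz : z ∈ complexOrbit x) :
    iwasawaProj θ x z ∈ compactOrbit θ x ∧ z ∈ iwasawaFiber (iwasawaProj θ x z) := by
  have h := exists_mem_compactOrbit hθ hx hz
  rw [iwasawaProj, dif_pos h]
  exact h.choose_spec

theorem filEq_iwasawaProj (hθ : IsCompactConjugation θ) (hx : θ x = -x) {z : L}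
    (hz : z ∈ complexOrbit x) : FilEq (realSpectrum x) (iwasawaProj θ x z) z := by
  obtain ⟨h1, h2⟩ := iwasawaProj_spec hθ hx hz
  exact filEq_of_mem_iwasawaFiber (complexOrbit_subset hθ hx (compactOrbit_subset h1))
    (complexOrbit_subset hθ hx hz) h2

theorem iwasawaProj_eq (hθ : IsCompactConjugation θ) (hx : θ x = -x) {y z : L}
    (hz : z ∈ complexOrbit x) (hy : y ∈ compactOrbit θ x) (h : FilEq (realSpectrum x) z y) :
    iwasawaProj θ x z = y := by
  have hθ' := hθ.toIsConjugation
  have hM := complexOrbit_subset hθ hx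
  have h1 := (iwasawaProj_spec hθ hx hz).1
  exact eq_of_filEq hθ (fun l => neg_mem_realSpectrum hθ' hx) (hM (compactOrbit_subset h1))
    (hM (compactOrbit_subset hy)) (conj_eq_neg_of_mem hθ' hx h1) (conj_eq_neg_of_mem hθ' hx hy)
    ((filEq_iwasawaProj hθ hx hz).trans (hM hz) h)

theorem iwasawaProj_self (hθ : IsCompactConjugation θ) (hx : θ x = -x) {y : L}
    (hy : y ∈ compactOrbit θ x) : iwasawaProj θ x y = y :=
  iwasawaProj_eq hθ hx (compactOrbit_subset hy) hy
    (FilEq.refl (complexOrbit_subset hθ hx (compactOrbit_subset hy)))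

end HyperbolicOrbit

namespace HyperbolicOrbit

open Filter Topology ComplexConjugate

variable {L : Type*} [NormedLieRing L] [NormedLieAlgebra ℂ L] [FiniteDimensional ℂ L]
  {S : Finset ℝ} {θ σ : L →ₛₗ[starRingEnd ℂ] L} {x : L}

/-! ### Entire functions and curves in the group -/

theorem eventually_ne_zero_of_entire {f : ℂ → ℂ} (hf : Differentiable ℂ f) {t₀ : ℂ}
    (h : f t₀ ≠ 0) (t : ℂ) : ∀ᶠ s in 𝓝[≠] t, f s ≠ 0 := by
  have ha : AnalyticOnNhd ℂ f Set.univ := fun t _ => hf.analyticAt t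
  rcases (ha t trivial).eventually_eq_zero_or_eventually_ne_zero with h1 | h1
  · exact absurd (ha.eqOn_zero_of_preconnected_of_eventuallyEq_zero isPreconnected_univ trivial h1
      (Set.mem_univ t₀)) h
  · exact h1

/-- The zeros of a nonzero entire function form a discrete, hence countable, set, and the complement
of a countable set in the plane is connected. -/
theorem isPreconnected_ne_zero_of_entire {f : ℂ → ℂ} (hf : Differentiable ℂ f) :
    IsPreconnected {t | f t ≠ 0} := by
  by_cases h : ∃ t₀, f t₀ ≠ 0
  · obtain ⟨t₀, h⟩ := h
    have hd : DiscreteTopology {t | f t = 0} := by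
      rw [discreteTopology_subtype_iff]
      intro t _
      rw [← disjoint_iff, Filter.disjoint_principal_right]
      exact eventually_ne_zero_of_entire hf h t
    have hc : {t | f t = 0}.Countable := by
      rw [← Set.countable_coe_iff]
      exact TopologicalSpace.separableSpace_iff_countable.mp inferInstance
    refine (hc.isConnected_compl_of_one_lt_rank ?_).isPreconnected
    rw [Complex.rank_real_complex]
    exact Cardinal.one_lt_two
  · have : {t | f t ≠ 0} = ∅ := by
      ext t
      simpa using not_exists.mp h t
    rw [this]
    exact isPreconnected_empty

/-- Every element of the group lies on a product of complex one-parameter curves. -/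
theorem exists_curve {T : Set L} {t₁ : ℂ} {a b : L → L} (h : ∀ u ∈ T, a u + t₁ • b u = u)
    {g : L ≃L[ℂ] L} (hg : g ∈ adGroup T) :
    ∃ G : ℂ → (L ≃L[ℂ] L), Differentiable ℂ (fun t => (G t : L →L[ℂ] L)) ∧ G t₁ = g ∧
      ∀ (t : ℂ) (T' : Set L), (∀ u ∈ T, a u + t • b u ∈ T') → G t ∈ adGroup T' := by
  -- The inverse curve must be entire as well for the induction to pass through products and
  -- inverses. Two choices matter later: `a = 0`, `b = id`, `t₁ = 1` gives a curve from the identity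
  -- to `g`; real and imaginary parts with `t₁ = i` give a curve lying in `G` for real `t`.
  have key : ∃ G : ℂ → (L ≃L[ℂ] L), Differentiable ℂ (fun t => (G t : L →L[ℂ] L)) ∧
      Differentiable ℂ (fun t => ((G t)⁻¹ : L ≃L[ℂ] L).toContinuousLinearMap) ∧ G t₁ = g ∧
      ∀ (t : ℂ) (T' : Set L), (∀ u ∈ T, a u + t • b u ∈ T') → G t ∈ adGroup T' := by
    refine adGroup_induction (p := fun g => ∃ G : ℂ → (L ≃L[ℂ] L),
      Differentiable ℂ (fun t => (G t : L →L[ℂ] L)) ∧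
      Differentiable ℂ (fun t => ((G t)⁻¹ : L ≃L[ℂ] L).toContinuousLinearMap) ∧ G t₁ = g ∧
      ∀ (t : ℂ) (T' : Set L), (∀ u ∈ T, a u + t • b u ∈ T') → G t ∈ adGroup T') ?_ ?_ ?_ ?_ hg
    · intro u hu
      have hexp : Differentiable ℂ (NormedSpace.exp : (L →L[ℂ] L) → (L →L[ℂ] L)) := fun A =>
        (NormedSpace.exp_analytic (𝕂 := ℂ) A).differentiableAt
      have hd : Differentiable ℂ (fun t : ℂ => adC (a u + t • b u)) :=
        (adC (L := L)).differentiable.comp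
          ((differentiable_const _).add (differentiable_id.smul_const _))
      refine ⟨fun t => expEquiv (a u + t • b u), hexp.comp hd, ?_, by simp only [h u hu],
        fun t T' hT' => expEquiv_mem (hT' u hu)⟩
      simp only [expEquiv_inv, coe_expEquiv, expAd_eq, map_neg]
      exact hexp.comp hd.neg
    · exact ⟨fun _ => 1, differentiable_const _, differentiable_const _, rfl,
        fun _ _ _ => one_mem _⟩
    · rintro g k ⟨G, h1, h2, h3, h4⟩ ⟨K, k1, k2, k3, k4⟩
      refine ⟨fun t => G t * K t, h1.mul k1, ?_, by simp only [h3, k3],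
        fun t T' hT' => mul_mem (h4 t T' hT') (k4 t T' hT')⟩
      simp only [mul_inv_rev]
      exact k2.mul h2
    · rintro g ⟨G, h1, h2, h3, h4⟩
      refine ⟨fun t => (G t)⁻¹, h2, ?_, by simp only [h3], fun t T' hT' => inv_mem (h4 t T' hT')⟩
      simp only [inv_inv]
      exact h1
  obtain ⟨G, h1, -, h3, h4⟩ := key
  exact ⟨G, h1, h3, h4⟩

/-! ### Determinants -/

theorem isUnit_iff_injective (A : L →L[ℂ] L) : IsUnit A ↔ ∀ u, A u = 0 → u = 0 := by
  constructor
  · rintro ⟨U, rfl⟩ u hu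
    have h := congrArg (fun T : L →L[ℂ] L => T u) U.inv_mul
    change (↑U⁻¹ : L →L[ℂ] L) ((U : L →L[ℂ] L) u) = u at h
    rw [← h, hu, map_zero]
  · intro h
    let e := LinearEquiv.ofInjectiveEndo (A : L →ₗ[ℂ] L) ((injective_iff_map_eq_zero _).mpr h)
    let E := e.toContinuousLinearEquiv
    refine ⟨⟨A, E.symm, ?_, ?_⟩, rfl⟩
    · ext u; exact e.apply_symm_apply u
    · ext u; exact e.symm_apply_apply u

theorem det_ne_zero_iff (A : L →L[ℂ] L) :
    LinearMap.det (A : L →ₗ[ℂ] L) ≠ 0 ↔ ∀ u, A u = 0 → u = 0 := by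
  rw [← isUnit_iff_ne_zero, ← LinearMap.isUnit_iff_isUnit_det, LinearMap.isUnit_iff_ker_eq_bot,
    LinearMap.ker_eq_bot']
  rfl

theorem contDiff_clm_det {n : WithTop ℕ∞} :
    ContDiff ℂ n (fun A : L →L[ℂ] L => LinearMap.det (A : L →ₗ[ℂ] L)) := by
  classical
  let b := Module.finBasis ℂ L
  have h : ∀ A : L →L[ℂ] L, LinearMap.det (A : L →ₗ[ℂ] L) =
      ∑ p : Equiv.Perm (Fin (Module.finrank ℂ L)), ((Equiv.Perm.sign p : ℤ) : ℂ) *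
        ∏ i, b.coord (p i) (A (b i)) := by
    intro A
    rw [← LinearMap.det_toMatrix b, Matrix.det_apply']
    simp [LinearMap.toMatrix_apply]
  simp only [h]
  refine ContDiff.sum fun p _ => contDiff_const.mul (contDiff_prod fun i _ => ?_)
  exact ((LinearMap.toContinuousLinearMap (b.coord (p i))).comp
    (ContinuousLinearMap.apply ℂ L (b i))).contDiff

/-- Polynomial maps to operators. -/
def IsPolyOp (F : L → L →L[ℂ] L) : Prop :=
  ∀ (φ : Module.Dual ℂ L) (v : L), (fun z => φ (F z v)) ∈ polyFun L

theorem IsPolyOp.const (A : L →L[ℂ] L) : IsPolyOp (L := L) fun _ => A := fun φ v =>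
  (polyFun L).algebraMap_mem (φ (A v))

theorem IsPolyOp.add {F G : L → L →L[ℂ] L} (hF : IsPolyOp F) (hG : IsPolyOp G) :
    IsPolyOp fun z => F z + G z := fun φ v => by
  simp only [_root_.add_apply, map_add]
  exact (polyFun L).add_mem (hF φ v) (hG φ v)

theorem IsPolyOp.mul {F G : L → L →L[ℂ] L} (hF : IsPolyOp F) (hG : IsPolyOp G) :
    IsPolyOp fun z => F z * G z := fun φ v => by
  let b := Module.finBasis ℂ L
  have : (fun z => φ ((F z * G z) v)) = ∑ i, (fun z => b.coord i (G z v)) * fun z => φ (F z (b i)) := by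
    ext z
    rw [clm_mul_apply]
    conv_lhs => rw [← b.sum_repr (G z v)]
    simp only [map_sum, map_smul, Finset.sum_apply, Pi.mul_apply, smul_eq_mul,
      Module.Basis.coord_apply]
  rw [this]
  exact (polyFun L).sum_mem fun i _ => (polyFun L).mul_mem (hG _ v) (hF φ _)

theorem IsPolyOp.smul {F : L → L →L[ℂ] L} (hF : IsPolyOp F) (c : ℂ) :
    IsPolyOp fun z => c • F z := fun φ v => by
  have : (fun z => φ ((c • F z) v)) = c • fun z => φ (F z v) := by ext z; simp
  rw [this]
  exact (polyFun L).smul_mem (hF φ v) c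

theorem IsPolyOp.sum {ι : Type*} {s : Finset ι} {F : ι → L → L →L[ℂ] L}
    (hF : ∀ i, IsPolyOp (F i)) : IsPolyOp fun z => ∑ i ∈ s, F i z := by
  classical
  induction s using Finset.induction_on with
  | empty => simpa using IsPolyOp.const (0 : L →L[ℂ] L)
  | insert a s ha ih =>
    simp only [Finset.sum_insert ha]
    exact (hF a).add ih

theorem isPolyOp_adC : IsPolyOp (fun z : L => adC z) := fun φ v => by
  have : (fun z : L => φ (adC z v)) = fun z => (φ ∘ₗ ((adC.flip v : L →L[ℂ] L) : L →ₗ[ℂ] L)) z := rfl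
  rw [this]
  exact Algebra.subset_adjoin ⟨_, rfl⟩

theorem isPolyOp_specProjOn (S : Finset ℝ) (I : Set ℝ) :
    IsPolyOp (specProjOn (L := L) S I) := by
  classical
  have hpow : ∀ n : ℕ, IsPolyOp (fun z : L => adC z ^ n) := by
    intro n
    induction n with
    | zero => simpa using IsPolyOp.const (1 : L →L[ℂ] L)
    | succ n ih =>
      simp only [pow_succ]
      exact ih.mul isPolyOp_adC
  unfold specProjOn specProj
  refine IsPolyOp.sum fun l => ?_
  simp only [Polynomial.aeval_eq_sum_range]
  exact IsPolyOp.sum fun i => (hpow i).smul _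

theorem IsPolyOp.det {F : L → L →L[ℂ] L} (hF : IsPolyOp F) :
    (fun z => LinearMap.det (F z : L →ₗ[ℂ] L)) ∈ polyFun L := by
  classical
  let b := Module.finBasis ℂ L
  have h : (fun z => LinearMap.det (F z : L →ₗ[ℂ] L)) =
      ∑ p : Equiv.Perm (Fin (Module.finrank ℂ L)), ((Equiv.Perm.sign p : ℤ) : ℂ) •
        ∏ i, fun z => b.coord (p i) (F z (b i)) := by
    ext z
    rw [← LinearMap.det_toMatrix b, Matrix.det_apply']
    simp [LinearMap.toMatrix_apply]
  rw [h]
  exact (polyFun L).sum_mem fun p _ => (polyFun L).smul_mem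
    ((polyFun L).prod_mem fun i _ => hF _ _) _

end HyperbolicOrbit

namespace HyperbolicOrbit

open Filter Topology ComplexConjugate

variable {L : Type*} [NormedLieRing L] [NormedLieAlgebra ℂ L] [FiniteDimensional ℂ L]
  {S : Finset ℝ} {θ σ : L →ₛₗ[starRingEnd ℂ] L} {x : L}

/-! ### The involution `θσ` and opposite filtrations -/

/-- The standing assumptions. -/
structure SphericalData (θ σ : L →ₛₗ[starRingEnd ℂ] L) (x : L) : Prop where
  compact : IsCompactConjugation θ
  second : IsConjugation σ
  comm : ∀ u, θ (σ u) = σ (θ u)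
  base_compact : θ x = -x
  base_conj : σ x = x

/-- The complex linear involution `θσ`. -/
def tau (θ σ : L →ₛₗ[starRingEnd ℂ] L) : L →L[ℂ] L :=
  LinearMap.toContinuousLinearMap (θ.comp σ : L →ₗ[ℂ] L)

@[simp] theorem tau_apply (u : L) : tau θ σ u = θ (σ u) := rfl

/-- The operator exchanging the `I` and `-I` parts of `ad z` by means of `τ`. It is invertible iff
the filtrations of `z` and `-τ z` are opposite. -/
def oppOp (τ : L →L[ℂ] L) (S : Finset ℝ) (I : Set ℝ) (z : L) : L →L[ℂ] L :=
  specProjOn S (-I) z * τ * specProjOn S I z + specProjOn S I z * τ * specProjOn S (-I) z +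
    (1 - specProjOn S I z - specProjOn S (-I) z)

/-- The determinant of `oppOp`. -/
def oppDet (τ : L →L[ℂ] L) (S : Finset ℝ) (I : Set ℝ) (z : L) : ℂ :=
  LinearMap.det (oppOp τ S I z : L →ₗ[ℂ] L)

/-- The `I`-part of `ad z` is mapped injectively to the `-I`-part by `τ`. -/
def IsOpp (τ : L →L[ℂ] L) (S : Finset ℝ) (I : Set ℝ) (z : L) : Prop :=
  ∀ u, specProjOn S I z u = u → specProjOn S (-I) z (τ u) = 0 → u = 0

theorem contDiff_oppOp (τ : L →L[ℂ] L) (S : Finset ℝ) (I : Set ℝ) {n : WithTop ℕ∞} :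
    ContDiff ℂ n (oppOp τ S I) := by
  have h1 := contDiff_specProjOn (L := L) S I (n := n)
  have h2 := contDiff_specProjOn (L := L) S (-I) (n := n)
  exact (((h2.mul contDiff_const).mul h1).add ((h1.mul contDiff_const).mul h2)).add
    ((contDiff_const.sub h1).sub h2)

theorem contDiff_oppDet (τ : L →L[ℂ] L) (S : Finset ℝ) (I : Set ℝ) {n : WithTop ℕ∞} :
    ContDiff ℂ n (oppDet τ S I) :=
  contDiff_clm_det.comp (contDiff_oppOp τ S I)

theorem oppDet_mem_polyFun (τ : L →L[ℂ] L) (S : Finset ℝ) (I : Set ℝ) :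
    oppDet τ S I ∈ polyFun L := by
  have h1 := isPolyOp_specProjOn (L := L) S I
  have h2 := isPolyOp_specProjOn (L := L) S (-I)
  have h3 : IsPolyOp (oppOp τ S I) := by
    have h4 := (((h2.mul (IsPolyOp.const τ)).mul h1).add ((h1.mul (IsPolyOp.const τ)).mul h2)).add
      (((IsPolyOp.const 1).add (h1.smul (-1))).add (h2.smul (-1)))
    simp only [neg_smul, one_smul, ← sub_eq_add_neg] at h4
    exact h4
  exact h3.det

/-! ### Block algebra of the exchange operator. -/

section oppOp

variable {τ : L →L[ℂ] L} {I : Set ℝ} {z : L}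

theorem specProjOn_mul_of_disjoint (hz : z ∈ spectralSet L S) {I J : Set ℝ} (h : Disjoint I J) :
    specProjOn S I z * specProjOn S J z = 0 := by
  rw [specProjOn_mul hz, h.inter_eq, specProjOn_empty]

theorem disjoint_neg_of_pos (hI : ∀ t ∈ I, 0 < t) : Disjoint I (-I) :=
  Set.disjoint_left.mpr fun t h1 h2 => by linarith [hI t h1, hI (-t) h2]

theorem specProjOn_self_mul (hz : z ∈ spectralSet L S) (I : Set ℝ) :
    specProjOn S I z * specProjOn S I z = specProjOn S I z := by
  rw [specProjOn_mul hz, Set.inter_self]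

theorem oppOp_mul_pos (hz : z ∈ spectralSet L S) (hI : Disjoint I (-I)) :
    oppOp τ S I z * specProjOn S I z = specProjOn S (-I) z * τ * specProjOn S I z := by
  have h1 := specProjOn_mul_of_disjoint hz hI.symm
  rw [oppOp, add_mul, add_mul, sub_mul, sub_mul, mul_assoc _ (specProjOn S I z),
    mul_assoc _ (specProjOn S (-I) z), h1, specProjOn_self_mul hz]
  simp

theorem oppOp_mul_neg (hz : z ∈ spectralSet L S) (hI : Disjoint I (-I)) :
    oppOp τ S I z * specProjOn S (-I) z = specProjOn S I z * τ * specProjOn S (-I) z := by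
  have h1 := specProjOn_mul_of_disjoint hz hI
  rw [oppOp, add_mul, add_mul, sub_mul, sub_mul, mul_assoc _ (specProjOn S I z),
    mul_assoc _ (specProjOn S (-I) z), h1, specProjOn_self_mul hz]
  simp

theorem pos_mul_oppOp (hz : z ∈ spectralSet L S) (hI : Disjoint I (-I)) :
    specProjOn S I z * oppOp τ S I z = specProjOn S I z * τ * specProjOn S (-I) z := by
  have h1 := specProjOn_mul_of_disjoint hz hI
  simp only [oppOp, mul_add, mul_sub, ← mul_assoc, h1, specProjOn_self_mul hz]
  simp

theorem neg_mul_oppOp (hz : z ∈ spectralSet L S) (hI : Disjoint I (-I)) :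
    specProjOn S (-I) z * oppOp τ S I z = specProjOn S (-I) z * τ * specProjOn S I z := by
  have h1 := specProjOn_mul_of_disjoint hz hI.symm
  simp only [oppOp, mul_add, mul_sub, ← mul_assoc, h1, specProjOn_self_mul hz]
  simp

/-- In block form `oppOp` is the identity on the eigenspaces outside `I ∪ -I` and interchanges the
`I`- and `-I`-parts by the compressions of `τ`. It is injective iff both compressions are. -/
theorem oppDet_ne_zero_iff (hz : z ∈ spectralSet L S) (hI : Disjoint I (-I)) :
    oppDet τ S I z ≠ 0 ↔ IsOpp τ S I z ∧ IsOpp τ S (-I) z := by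
  rw [oppDet, det_ne_zero_iff]
  constructor
  · intro h
    refine ⟨fun u h1 h2 => h u ?_, fun u h1 h2 => h u ?_⟩
    · have h3 := congrArg (fun T : L →L[ℂ] L => T u) (oppOp_mul_pos (τ := τ) hz hI)
      simp only [clm_mul_apply, h1, h2] at h3
      exact h3
    · rw [neg_neg] at h2
      have h3 := congrArg (fun T : L →L[ℂ] L => T u) (oppOp_mul_neg (τ := τ) hz hI)
      simp only [clm_mul_apply, h1, h2] at h3
      exact h3
  · rintro ⟨h1, h2⟩ u hu
    have h3 := congrArg (fun T : L →L[ℂ] L => T u) (pos_mul_oppOp (τ := τ) hz hI)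
    have h4 := congrArg (fun T : L →L[ℂ] L => T u) (neg_mul_oppOp (τ := τ) hz hI)
    simp only [clm_mul_apply, hu, map_zero] at h3 h4
    have h5 : specProjOn S I z u = 0 := h1 _ (specProjOn_idem hz I u) h4.symm
    have h6 : specProjOn S (-I) z u = 0 := by
      refine h2 _ (specProjOn_idem hz (-I) u) ?_
      rw [neg_neg]
      exact h3.symm
    simpa [oppOp, clm_mul_apply, h5, h6] using hu

/-- For an upper set `I` the condition involves only the range of the `I`-projection and the kernel
of the `-I`-projection, and both are steps of the filtration. -/
theorem IsOpp.of_filEq {w : L} (hz : z ∈ spectralSet L S) (hw : w ∈ spectralSet L S)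
    (hI : IsUpperSet I) (h : FilEq S z w) (ho : IsOpp τ S I z) : IsOpp τ S I w := by
  intro u h1 h2
  refine ho u ?_ ?_
  · have h3 := congrArg (fun T : L →L[ℂ] L => T u) (h.mul_upper hz hI)
    simp only [clm_mul_apply, h1] at h3
    exact h3
  · have h3 := congrArg (fun T : L →L[ℂ] L => T (τ u)) (h.mul_lower hw (isUpperSet_neg hI))
    simp only [clm_mul_apply, h2, map_zero] at h3
    exact h3.symm

theorem oppOp_map {g : L ≃L[ℂ] L} (hg : IsAut g) (hz : z ∈ spectralSet L S)
    (hτ : ∀ v, τ (g v) = g (τ v)) (v : L) : oppOp τ S I (g z) (g v) = g (oppOp τ S I z v) := by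
  simp only [oppOp, _root_.add_apply, sub_apply, clm_mul_apply, specProjOn_map hg hz, hτ, map_add,
    map_sub]
  rfl

theorem IsOpp.map {g : L ≃L[ℂ] L} (hg : IsAut g) (hz : z ∈ spectralSet L S)
    (hτ : ∀ v, τ (g v) = g (τ v)) (h : IsOpp τ S I z) : IsOpp τ S I (g z) := by
  intro u h1 h2
  obtain ⟨v, rfl⟩ := g.surjective u
  rw [specProjOn_map hg hz] at h1
  rw [hτ, specProjOn_map hg hz] at h2
  rw [h v (g.injective h1) (g.injective (h2.trans (map_zero g).symm)), map_zero]

end oppOp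

namespace SphericalData

theorem tau_lie (D : SphericalData θ σ x) (u v : L) :
    tau θ σ ⁅u, v⁆ = ⁅tau θ σ u, tau θ σ v⁆ := by
  rw [tau_apply, D.second.map_lie, D.compact.map_lie]; rfl

theorem tau_tau (D : SphericalData θ σ x) (u : L) : tau θ σ (tau θ σ u) = u := by
  rw [tau_apply, tau_apply, ← D.comm, D.compact.involutive, D.second.involutive]

theorem conj_tau (D : SphericalData θ σ x) (u : L) : θ (tau θ σ u) = tau θ σ (θ u) := by
  rw [tau_apply, tau_apply, D.comm]

theorem tau_base (D : SphericalData θ σ x) : tau θ σ x = -x := by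
  rw [tau_apply, D.base_conj, D.base_compact]

theorem neg_mem (D : SphericalData θ σ x) : ∀ l ∈ realSpectrum x, -l ∈ realSpectrum x :=
  fun _ => neg_mem_realSpectrum D.compact.toIsConjugation D.base_compact

theorem mem_spectralSet (D : SphericalData θ σ x) {z : L} (hz : z ∈ complexOrbit x) :
    z ∈ spectralSet L (realSpectrum x) :=
  complexOrbit_subset D.compact D.base_compact hz

theorem conj_eq_neg (D : SphericalData θ σ x) {y : L} (hy : y ∈ compactOrbit θ x) : θ y = -y :=
  conj_eq_neg_of_mem D.compact.toIsConjugation D.base_compact hy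

theorem specProjOn_neg_tau (D : SphericalData θ σ x) {z : L}
    (hz : z ∈ spectralSet L (realSpectrum x)) (I : Set ℝ) (u : L) :
    specProjOn (realSpectrum x) I (-tau θ σ z) (tau θ σ u) =
      tau θ σ (specProjOn (realSpectrum x) (-I) z u) :=
  specProjOn_neg_map (φ := (tau θ σ).toLinearMap.toAddMonoidHom) D.tau_lie
    (fun r u => map_smul (tau θ σ) (r : ℂ) u) D.neg_mem hz I u

/-- On points of `K^ℂ(x)` the involution exchanges positive and negative eigenspaces. -/
theorem specProjOn_tau (D : SphericalData θ σ x) {s : L} (hs : s ∈ spectralSet L (realSpectrum x))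
    (h : tau θ σ s = -s) (I : Set ℝ) (u : L) :
    specProjOn (realSpectrum x) I s (tau θ σ u) =
      tau θ σ (specProjOn (realSpectrum x) (-I) s u) := by
  have := D.specProjOn_neg_tau hs I u
  rwa [h, neg_neg] at this

theorem tau_expAd (D : SphericalData θ σ x) (u v : L) :
    tau θ σ (expAd u v) = expAd (tau θ σ u) (tau θ σ v) := by
  simp only [tau_apply, conj_expAd D.second, conj_expAd D.compact.toIsConjugation]

theorem tau_apply_of_mem (D : SphericalData θ σ x) {k : L ≃L[ℂ] L}
    (hk : k ∈ sphericalGroup θ σ) (v : L) : tau θ σ (k v) = k (tau θ σ v) := by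
  revert v
  refine adGroup_induction (p := fun g => ∀ v, tau θ σ (g v) = g (tau θ σ v)) ?_ ?_ ?_ ?_ hk
  · intro u hu v
    rw [expEquiv_apply, expEquiv_apply, D.tau_expAd, show tau θ σ u = u from hu]
  · intro v; rfl
  · intro g k hg hk v
    change tau θ σ (g (k v)) = g (k _)
    rw [hg, hk]
  · intro g hg v
    apply g.injective
    change g (tau θ σ (g.symm v)) = g (g.symm (tau θ σ v))
    rw [← hg]; simp

theorem tau_of_mem_sphericalOrbit (D : SphericalData θ σ x) {s : L}
    (hs : s ∈ sphericalOrbit θ σ x) : tau θ σ s = -s := by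
  obtain ⟨k, hk, rfl⟩ := hs
  rw [D.tau_apply_of_mem hk, D.tau_base, map_neg]

/-- `θ` commutes with `τ` and carries the `-I`-part of `ad z` to the `I`-part of `ad (-θ z)`. This
relates the second block of `oppOp` to the domain `-θ(𝒜)`. -/
theorem isOpp_neg_iff (D : SphericalData θ σ x) {z : L}
    (hz : z ∈ spectralSet L (realSpectrum x)) (I : Set ℝ) :
    IsOpp (tau θ σ) (realSpectrum x) (-I) z ↔ IsOpp (tau θ σ) (realSpectrum x) I (-θ z) := by
  have hθ := D.compact.toIsConjugation
  have h1 := specProjOn_neg_conj hθ D.neg_mem hz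
  have hinj : Function.Injective θ := Function.LeftInverse.injective hθ.involutive
  constructor
  · intro h u h2 h3
    obtain ⟨v, rfl⟩ : ∃ v, θ v = u := ⟨θ u, hθ.involutive u⟩
    rw [h1] at h2
    rw [← D.conj_tau, h1] at h3
    rw [h v (hinj h2) (hinj (h3.trans (map_zero θ).symm)), map_zero]
  · intro h u h2 h3
    have h4 : θ u = 0 := by
      refine h (θ u) ?_ ?_
      · rw [h1, h2]
      · rw [← D.conj_tau, h1, h3, map_zero]
    exact hinj (h4.trans (map_zero θ).symm)

/-- Since `τ x = -x`, the involution `τ` exchanges the `I`- and `-I`-parts of `ad x` exactly. -/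
theorem isOpp_base (D : SphericalData θ σ x) (I : Set ℝ) :
    IsOpp (tau θ σ) (realSpectrum x) I x := by
  intro u h1 h2
  rw [D.specProjOn_tau (D.mem_spectralSet (mem_complexOrbit_self x)) D.tau_base, neg_neg, h1] at h2
  rw [← D.tau_tau u, h2, map_zero]

end SphericalData

/-- The polynomial whose non-vanishing on `𝒪` defines `ℬ`. -/
def discr (θ σ : L →ₛₗ[starRingEnd ℂ] L) (x z : L) : ℂ :=
  oppDet (tau θ σ) (realSpectrum x) (Set.Ioi 0) z

theorem neg_Ioi_zero : -Set.Ioi (0 : ℝ) = Set.Iio 0 := by ext t; simp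

theorem disjoint_Ioi_zero : Disjoint (Set.Ioi (0 : ℝ)) (-Set.Ioi 0) :=
  disjoint_neg_of_pos fun _ h => h

/-- The Lie algebra of `K^ℂ`. -/
def sphericalForm (θ σ : L →ₛₗ[starRingEnd ℂ] L) : Submodule ℝ L :=
  (LinearMap.ker (tau θ σ - 1).toLinearMap).restrictScalars ℝ

theorem mem_sphericalForm {u : L} : u ∈ sphericalForm θ σ ↔ θ (σ u) = u :=
  sub_eq_zero

theorem eq_one_of_mem_adGroup_zero {g : L ≃L[ℂ] L} (hg : g ∈ adGroup ({0} : Set L)) : g = 1 := by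
  refine adGroup_induction (p := fun g => g = 1) ?_ rfl ?_ ?_ hg
  · rintro u rfl
    ext v
    simp only [expEquiv_apply, expAd_zero]; rfl
  · rintro g k rfl rfl; rfl
  · rintro g rfl; exact inv_one

/-! ### Transitivity of `K^ℂ` on filtrations where `discr` does not vanish. -/

namespace SphericalData

theorem mem_of_discr (D : SphericalData θ σ x) {z : L} (hz : z ∈ spectralSet L (realSpectrum x)) :
    discr θ σ x z ≠ 0 ↔ IsOpp (tau θ σ) (realSpectrum x) (Set.Ioi 0) z ∧
      IsOpp (tau θ σ) (realSpectrum x) (Set.Ioi 0) (-θ z) := by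
  rw [discr, oppDet_ne_zero_iff hz disjoint_Ioi_zero, D.isOpp_neg_iff hz]

theorem discr_ne_zero_iff_of_compact (D : SphericalData θ σ x) {y : L}
    (hy : y ∈ compactOrbit θ x) :
    discr θ σ x y ≠ 0 ↔ IsOpp (tau θ σ) (realSpectrum x) (Set.Ioi 0) y := by
  rw [D.mem_of_discr (D.mem_spectralSet (compactOrbit_subset hy)), D.conj_eq_neg hy, neg_neg,
    and_self]

theorem discr_base (D : SphericalData θ σ x) : discr θ σ x x ≠ 0 :=
  (D.discr_ne_zero_iff_of_compact mem_compactOrbit_self).mpr (D.isOpp_base _)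

/-- This is `𝔨^ℂ + 𝔭(z) = L`. Vectors `n + τ n` with `n ∈ 𝔫(z)` are fixed by `τ`, and their negative
part is that of `τ n`, which is arbitrary when `oppOp` is invertible. -/
theorem exists_sphericalForm_sub (D : SphericalData θ σ x) {z : L}
    (hz : z ∈ spectralSet L (realSpectrum x)) (h : discr θ σ x z ≠ 0) (u : L) :
    ∃ v ∈ sphericalForm θ σ, specProjOn (realSpectrum x) (Set.Iio 0) z (u - v) = 0 := by
  have hU : IsUnit (oppOp (tau θ σ) (realSpectrum x) (Set.Ioi 0) z) :=
    (isUnit_iff_injective _).mpr ((det_ne_zero_iff _).mp h)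
  obtain ⟨U, hU⟩ := hU
  set w : L := (↑U⁻¹ : L →L[ℂ] L) (specProjOn (realSpectrum x) (Set.Iio 0) z u) with hw
  have h1 : oppOp (tau θ σ) (realSpectrum x) (Set.Ioi 0) z w =
      specProjOn (realSpectrum x) (Set.Iio 0) z u := by
    rw [← hU, hw]
    exact congrArg (fun T : L →L[ℂ] L => T _) U.mul_inv
  have h2 := congrArg (fun T : L →L[ℂ] L => T w)
    (neg_mul_oppOp (τ := tau θ σ) hz disjoint_Ioi_zero)
  simp only [clm_mul_apply, h1, neg_Ioi_zero, specProjOn_idem hz] at h2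
  set n := specProjOn (realSpectrum x) (Set.Ioi 0) z w with hn
  refine ⟨tau θ σ n + n, ?_, ?_⟩
  · rw [mem_sphericalForm, ← tau_apply, map_add, D.tau_tau, add_comm]
  · have h3 : specProjOn (realSpectrum x) (Set.Iio 0) z n = 0 := by
      have := specProjOn_mul_of_disjoint hz disjoint_Ioi_zero.symm
      rw [neg_Ioi_zero] at this
      exact congrArg (fun T : L →L[ℂ] L => T w) this
    rw [map_sub, map_add, h3, add_zero, h2, sub_self]

/-- `K^ℂ`-translates of filtrations. -/
def KRel (θ σ : L →ₛₗ[starRingEnd ℂ] L) (x z w : L) : Prop :=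
  ∃ k ∈ sphericalGroup θ σ, FilEq (realSpectrum x) (k z) w

theorem KRel.symm {z w : L} (hz : z ∈ spectralSet L (realSpectrum x))
    (hw : w ∈ spectralSet L (realSpectrum x)) (h : KRel θ σ x z w) : KRel θ σ x w z := by
  obtain ⟨k, hk, h⟩ := h
  have hk' := inv_mem hk
  refine ⟨k⁻¹, hk', ?_⟩
  have h2 := h.symm.map (isAut_of_mem hk') hw (map_mem_spectralSet (isAut_of_mem hk) hz)
  rwa [show k⁻¹ (k z) = z from k.symm_apply_apply z] at h2

theorem KRel.trans {z w v : L} (hz : z ∈ spectralSet L (realSpectrum x))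
    (hw : w ∈ spectralSet L (realSpectrum x)) (h1 : KRel θ σ x z w) (h2 : KRel θ σ x w v) :
    KRel θ σ x z v := by
  obtain ⟨k, hk, h1⟩ := h1
  obtain ⟨k', hk', h2⟩ := h2
  refine ⟨k' * k, mul_mem hk' hk, ?_⟩
  exact (h1.map (isAut_of_mem hk') (map_mem_spectralSet (isAut_of_mem hk) hz) hw).trans
    (map_mem_spectralSet (isAut_of_mem hk') hw) h2

/-- By the local slice with `V = 𝔨^ℂ`, nearby points are `K^ℂ`-translates of points in the Iwasawa
fibre of `z`. -/
theorem eventually_kRel (D : SphericalData θ σ x) {z : L}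
    (hz : z ∈ spectralSet L (realSpectrum x)) (h : discr θ σ x z ≠ 0) :
    ∀ᶠ w in 𝓝 z, w ∈ spectralSet L (realSpectrum x) → KRel θ σ x z w := by
  filter_upwards [eventually_exists_expAd D.compact hz (sphericalForm θ σ)
    (D.exists_sphericalForm_sub hz h)] with w hw hwM
  obtain ⟨v, hv, q, hq, rfl⟩ := hw hwM
  have h1 : z + q ∈ spectralSet L (realSpectrum x) := by
    have := map_mem_spectralSet (isAut_expEquiv (-v)) hwM
    rwa [expEquiv_apply, expAd_neg_apply] at this
  refine ⟨expEquiv v, expEquiv_mem (mem_sphericalForm.mp hv), ?_⟩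
  refine FilEq.map (isAut_expEquiv v) hz h1 (filEq_of_mem_iwasawaFiber hz h1 ?_)
  change z + q - z ∈ nilradical z
  rwa [add_sub_cancel_left]

/-- Any two points of `𝒪` are joined by an entire curve in `𝒪`. -/
theorem exists_curve_joining {z w : L} (hz : z ∈ complexOrbit x) (hw : w ∈ complexOrbit x) :
    ∃ c : ℂ → L, Differentiable ℂ c ∧ c 0 = z ∧ c 1 = w ∧ ∀ t, c t ∈ complexOrbit x := by
  obtain ⟨g, hg, rfl⟩ := hz
  obtain ⟨k, hk, rfl⟩ := hw
  obtain ⟨G, h1, h2, h3⟩ := exists_curve (T := Set.univ) (t₁ := 1) (a := fun _ : L => 0) (b := id)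
    (fun u _ => by simp) (mul_mem hk (inv_mem hg))
  refine ⟨fun t => G t (g x), fun t => ?_, ?_, ?_, fun t => ?_⟩
  · exact (h1 t).clm_apply (differentiableAt_const _)
  · have h4 := eq_one_of_mem_adGroup_zero (h3 0 {0} (fun u _ => by simp))
    simp only [h4]
    rfl
  · simp only [h2]
    change k (g.symm (g x)) = k x
    rw [g.symm_apply_apply]
  · exact apply_mem_complexOrbit (h3 t Set.univ (fun _ _ => trivial)) ⟨g, hg, rfl⟩

theorem differentiable_discr : Differentiable ℂ (discr θ σ x) :=
  (contDiff_oppDet (tau θ σ) (realSpectrum x) (Set.Ioi 0) (n := 1)).differentiable one_ne_zero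

/-- The classes of `KRel` are open where `discr` is nonzero. On an entire curve in `𝒪` from `z` to
`w` this locus is connected, so it meets only one class. -/
theorem kRel_of_discr (D : SphericalData θ σ x) {z w : L} (hz : z ∈ complexOrbit x)
    (hw : w ∈ complexOrbit x) (hz' : discr θ σ x z ≠ 0) (hw' : discr θ σ x w ≠ 0) :
    KRel θ σ x z w := by
  obtain ⟨c, hc, rfl, rfl, hcO⟩ := exists_curve_joining hz hw
  have hM := fun t => D.mem_spectralSet (hcO t)
  refine (isPreconnected_ne_zero_of_entire (differentiable_discr.comp hc)).induction₂
    (fun s t => KRel θ σ x (c s) (c t)) ?_ ?_ ?_ hz' hw'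
  · intro t ht
    have h1 := hc.continuous.continuousAt.eventually (D.eventually_kRel (hM t) ht)
    filter_upwards [mem_nhdsWithin_of_mem_nhds h1] with s hs
    exact hs (hM s)
  · intro r s t _ _ _ h1 h2
    exact h1.trans (hM r) (hM s) h2
  · intro s t _ _ h1
    exact h1.symm (hM s) (hM t)

/-! ### The domains -/

/-- `IsOpp` is constant along Iwasawa fibres. On `X` it amounts to `discr ≠ 0` because `-θ y = y`,
whereas at a general `z` it is only one half of that condition. -/
theorem isOpp_iwasawaProj_iff (D : SphericalData θ σ x) {z : L} (hz : z ∈ complexOrbit x) :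
    discr θ σ x (iwasawaProj θ x z) ≠ 0 ↔ IsOpp (tau θ σ) (realSpectrum x) (Set.Ioi 0) z := by
  have h1 := (iwasawaProj_spec D.compact D.base_compact hz).1
  have h2 := filEq_iwasawaProj D.compact D.base_compact hz
  have hy := D.mem_spectralSet (compactOrbit_subset h1)
  have hzM := D.mem_spectralSet hz
  rw [D.discr_ne_zero_iff_of_compact h1]
  exact ⟨IsOpp.of_filEq hy hzM (isUpperSet_Ioi 0) h2,
    IsOpp.of_filEq hzM hy (isUpperSet_Ioi 0) h2.symm⟩

theorem flagOrbit_eq (D : SphericalData θ σ x) {y : L} (hy : y ∈ compactOrbit θ x)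
    (h : discr θ σ x y ≠ 0) :
    flagOrbit θ σ x y = {y' ∈ compactOrbit θ x | discr θ σ x y' ≠ 0} := by
  have hyO := compactOrbit_subset hy
  ext y'
  constructor
  · rintro ⟨k, hk, rfl⟩
    have hk' : k y ∈ complexOrbit x := apply_mem_complexOrbit hk hyO
    refine ⟨(iwasawaProj_spec D.compact D.base_compact hk').1, ?_⟩
    rw [D.isOpp_iwasawaProj_iff hk']
    exact ((D.discr_ne_zero_iff_of_compact hy).mp h).map (isAut_of_mem hk)
      (D.mem_spectralSet hyO) (D.tau_apply_of_mem hk)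
  · rintro ⟨hy', h'⟩
    obtain ⟨k, hk, hf⟩ := D.kRel_of_discr hyO (compactOrbit_subset hy') h h'
    exact ⟨k, hk, (iwasawaProj_eq D.compact D.base_compact (apply_mem_complexOrbit hk hyO) hy'
      hf).symm⟩

/-- Along a curve from `x` that lies in `X` for real parameter, `discr` is an entire function not
vanishing at `x`. Its zeros are isolated, so real parameters close to `1` give points approximating
the endpoint. -/
theorem compactOrbit_subset_closure (D : SphericalData θ σ x) :
    compactOrbit θ x ⊆ closure {y ∈ compactOrbit θ x | discr θ σ x y ≠ 0} := by
  rintro _ ⟨g, hg, rfl⟩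
  obtain ⟨G, h1, h2, h3⟩ := exists_curve (t₁ := 1) (a := fun _ : L => 0) (b := id)
    (fun u _ => by simp) hg
  have hc : Differentiable ℂ fun t => G t x := fun t =>
    (h1 t).clm_apply (differentiableAt_const _)
  have h0 : discr θ σ x (G 0 x) ≠ 0 := by
    rw [eq_one_of_mem_adGroup_zero (h3 0 {0} (fun u _ => by simp))]
    exact D.discr_base
  have hev := eventually_ne_zero_of_entire (differentiable_discr.comp hc) h0 1
  have hlim : Tendsto (fun r : ℝ => (r : ℂ)) (𝓝[≠] 1) (𝓝[≠] 1) := by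
    refine tendsto_nhdsWithin_iff.mpr ⟨?_, ?_⟩
    · exact (Complex.continuous_ofReal.tendsto' 1 1 (by simp)).mono_left nhdsWithin_le_nhds
    · filter_upwards [self_mem_nhdsWithin] with r hr
      simpa using hr
  refine mem_closure_of_tendsto (b := 𝓝[≠] (1 : ℝ)) (f := fun r : ℝ => G (r : ℂ) x) ?_ ?_
  · have h4 := (hc.continuous.tendsto 1).comp (tendsto_nhds_of_tendsto_nhdsWithin hlim)
    rw [h2] at h4
    exact h4
  · filter_upwards [hlim.eventually hev] with r hr
    refine ⟨⟨G r, h3 r _ fun u hu => ?_, rfl⟩, hr⟩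
    change θ (0 + (r : ℂ) • u) = 0 + (r : ℂ) • u
    rw [zero_add, conj_real_smul, show θ u = u from hu]

theorem isOpen_discr_ne_zero : IsOpen {z : L | discr θ σ x z ≠ 0} :=
  isOpen_ne_fun differentiable_discr.continuous continuous_const

theorem openOrbit_eq (D : SphericalData θ σ x) :
    openOrbit θ σ x = {y ∈ compactOrbit θ x | discr θ σ x y ≠ 0} := by
  ext y
  constructor
  · rintro ⟨hy, -, hd⟩
    refine ⟨hy, ?_⟩
    -- Density makes the orbit of `y` enter the neighbourhood of `x` where `discr` is nonzero; from
    -- there the condition is carried back to `y` by `K^ℂ`.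
    obtain ⟨_, hw, k, hk, rfl⟩ := mem_closure_iff.mp (hd mem_compactOrbit_self) _
      isOpen_discr_ne_zero D.discr_base
    have hyO := compactOrbit_subset hy
    have hk' : k y ∈ complexOrbit x := apply_mem_complexOrbit hk hyO
    have h1 := (D.isOpp_iwasawaProj_iff hk').mp hw
    rw [D.discr_ne_zero_iff_of_compact hy]
    have h2 := h1.map (isAut_of_mem (inv_mem hk)) (D.mem_spectralSet hk')
      (D.tau_apply_of_mem (inv_mem hk))
    rwa [show k⁻¹ (k y) = y from k.symm_apply_apply y] at h2
  · rintro ⟨hy, h⟩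
    refine ⟨hy, ?_, ?_⟩
    · exact ⟨_, isOpen_discr_ne_zero, D.flagOrbit_eq hy h⟩
    · rw [D.flagOrbit_eq hy h]
      exact D.compactOrbit_subset_closure

theorem mem_openOrbit (D : SphericalData θ σ x) {y : L} :
    y ∈ openOrbit θ σ x ↔ y ∈ compactOrbit θ x ∧ discr θ σ x y ≠ 0 := by
  rw [D.openOrbit_eq]; rfl

theorem neg_conj_mem_complexOrbit (D : SphericalData θ σ x) {z : L} (hz : z ∈ complexOrbit x) :
    -θ z ∈ complexOrbit x := by
  obtain ⟨g, hg, rfl⟩ := hz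
  obtain ⟨k, hk, h⟩ := exists_conj_mem D.compact.toIsConjugation hg
  refine ⟨k, adGroup_mono (Set.subset_univ _) hk, ?_⟩
  rw [h, D.base_compact, map_neg, neg_neg]

theorem mem_domainA (D : SphericalData θ σ x) {z : L} :
    z ∈ domainA θ σ x ↔ z ∈ complexOrbit x ∧
      IsOpp (tau θ σ) (realSpectrum x) (Set.Ioi 0) z := by
  constructor
  · rintro ⟨h1, h2⟩
    exact ⟨h1, (D.isOpp_iwasawaProj_iff h1).mp (D.mem_openOrbit.mp h2).2⟩
  · rintro ⟨h1, h2⟩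
    exact ⟨h1, D.mem_openOrbit.mpr ⟨(iwasawaProj_spec D.compact D.base_compact h1).1,
      (D.isOpp_iwasawaProj_iff h1).mpr h2⟩⟩

theorem mem_domainB (D : SphericalData θ σ x) {z : L} :
    z ∈ domainB θ σ x ↔ z ∈ complexOrbit x ∧ discr θ σ x z ≠ 0 := by
  have hθ := D.compact.involutive
  constructor
  · rintro ⟨h1, w, h2, rfl⟩
    rw [D.mem_domainA] at h1 h2
    refine ⟨h1.1, (D.mem_of_discr (D.mem_spectralSet h1.1)).mpr ⟨h1.2, ?_⟩⟩
    rw [map_neg, hθ, neg_neg]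
    exact h2.2
  · rintro ⟨h1, h2⟩
    rw [D.mem_of_discr (D.mem_spectralSet h1)] at h2
    refine ⟨D.mem_domainA.mpr ⟨h1, h2.1⟩, -θ z,
      D.mem_domainA.mpr ⟨D.neg_conj_mem_complexOrbit h1, h2.2⟩, ?_⟩
    change -θ (-θ z) = z
    rw [map_neg, hθ, neg_neg]

theorem openOrbit_subset_domainB (D : SphericalData θ σ x) :
    openOrbit θ σ x ⊆ domainB θ σ x := fun _ hy =>
  D.mem_domainB.mpr ⟨compactOrbit_subset (D.mem_openOrbit.mp hy).1, (D.mem_openOrbit.mp hy).2⟩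

theorem isOpenIn_domainB (D : SphericalData θ σ x) :
    IsOpenIn (complexOrbit x) (domainB θ σ x) :=
  ⟨_, isOpen_discr_ne_zero, Set.ext fun _ => D.mem_domainB⟩

theorem isZariskiOpenIn_domainB (D : SphericalData θ σ x) :
    IsZariskiOpenIn (complexOrbit x) (domainB θ σ x) := by
  refine ⟨{discr θ σ x}, ?_, ?_⟩
  · rintro _ rfl
    exact oppDet_mem_polyFun _ _ _
  · ext z
    rw [D.mem_domainB]
    simp

/-- An entire curve in `𝒪` joining two points of `ℬ` stays connected after removal of the parameters
where `discr` vanishes. -/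
theorem isConnected_domainB (D : SphericalData θ σ x) : IsConnected (domainB θ σ x) := by
  refine ⟨⟨x, D.mem_domainB.mpr ⟨mem_complexOrbit_self x, D.discr_base⟩⟩, ?_⟩
  refine isPreconnected_of_forall_pair fun z hz w hw => ?_
  rw [D.mem_domainB] at hz hw
  obtain ⟨c, hc, h0, h1, hcO⟩ := exists_curve_joining hz.1 hw.1
  refine ⟨c '' {t | discr θ σ x (c t) ≠ 0}, ?_, ⟨0, ?_, h0⟩, ⟨1, ?_, h1⟩, ?_⟩
  · rintro _ ⟨t, ht, rfl⟩
    exact D.mem_domainB.mpr ⟨hcO t, ht⟩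
  · rw [Set.mem_ofPred_eq, h0]; exact hz.2
  · rw [Set.mem_ofPred_eq, h1]; exact hw.2
  · exact (isPreconnected_ne_zero_of_entire (differentiable_discr.comp hc)).image _
      hc.continuous.continuousOn

theorem apply_mem_domainB (D : SphericalData θ σ x) {k : L ≃L[ℂ] L}
    (hk : k ∈ sphericalGroup θ σ) {z : L} (hz : z ∈ domainB θ σ x) : k z ∈ domainB θ σ x := by
  rw [D.mem_domainB] at hz ⊢
  refine ⟨apply_mem_complexOrbit hk hz.1, ?_⟩
  refine (det_ne_zero_iff _).mpr fun u hu => ?_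
  obtain ⟨v, rfl⟩ := k.surjective u
  rw [oppOp_map (isAut_of_mem hk) (D.mem_spectralSet hz.1) (D.tau_apply_of_mem hk)] at hu
  rw [(det_ne_zero_iff _).mp hz.2 v (k.injective (hu.trans (map_zero k).symm)), map_zero]

end SphericalData
end HyperbolicOrbit

namespace HyperbolicOrbit

open Filter Topology ComplexConjugate

variable {L : Type*} [NormedLieRing L] [NormedLieAlgebra ℂ L] [FiniteDimensional ℂ L]
  {S : Finset ℝ} {θ σ : L →ₛₗ[starRingEnd ℂ] L} {x : L}

/-! ### The holomorphic vector field -/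

/-- The inverse of `oppOp` for `I = (0, ∞)`. -/
def oppInv (θ σ : L →ₛₗ[starRingEnd ℂ] L) (x z : L) : L →L[ℂ] L :=
  Ring.inverse (oppOp (tau θ σ) (realSpectrum x) (Set.Ioi 0) z)

/-- `s(z) - z`, where `s(z)` is the point of `K^ℂ(x)` in the Iwasawa fibre of `z`. -/
def sectionVec (θ σ : L →ₛₗ[starRingEnd ℂ] L) (x z : L) : L :=
  -oppInv θ σ x z (specProjOn (realSpectrum x) (Set.Iio 0) z (tau θ σ z))

/-- The analogue of `sectionVec` for the opposite fibres `z + θ 𝔫(-θ z)`. -/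
def sectionVecOpp (θ σ : L →ₛₗ[starRingEnd ℂ] L) (x z : L) : L :=
  -oppInv θ σ x z (specProjOn (realSpectrum x) (Set.Ioi 0) z (tau θ σ z))

/-- The complexification of the gradient field. -/
def gradField (θ σ : L →ₛₗ[starRingEnd ℂ] L) (x z : L) : L :=
  (1 / 2 : ℂ) • (sectionVec θ σ x z + sectionVecOpp θ σ x z)

theorem isUnit_of_discr {z : L} (h : discr θ σ x z ≠ 0) :
    IsUnit (oppOp (tau θ σ) (realSpectrum x) (Set.Ioi 0) z) :=
  (isUnit_iff_injective _).mpr ((det_ne_zero_iff _).mp h)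

theorem oppOp_oppInv {z : L} (h : discr θ σ x z ≠ 0) (u : L) :
    oppOp (tau θ σ) (realSpectrum x) (Set.Ioi 0) z (oppInv θ σ x z u) = u :=
  congrArg (fun T : L →L[ℂ] L => T u) (Ring.mul_inverse_cancel _ (isUnit_of_discr h))

theorem oppOp_injective {z : L} (h : discr θ σ x z ≠ 0) :
    Function.Injective (oppOp (tau θ σ) (realSpectrum x) (Set.Ioi 0) z) :=
  (injective_iff_map_eq_zero _).mpr ((det_ne_zero_iff _).mp h)

theorem contDiffAt_oppInv {z : L} (h : discr θ σ x z ≠ 0) {n : WithTop ℕ∞} :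
    ContDiffAt ℂ n (oppInv θ σ x) z := by
  obtain ⟨U, hU⟩ := isUnit_of_discr h
  have h1 := contDiffAt_ringInverse ℂ (n := n) U
  rw [hU] at h1
  exact h1.comp z (contDiff_oppOp _ _ _).contDiffAt

theorem contDiffAt_sectionVec {z : L} (h : discr θ σ x z ≠ 0) {n : WithTop ℕ∞} :
    ContDiffAt ℂ n (sectionVec θ σ x) z :=
  ((contDiffAt_oppInv h).clm_apply ((contDiff_specProjOn _ _).contDiffAt.clm_apply
    (tau θ σ).contDiff.contDiffAt)).neg

theorem contDiffAt_sectionVecOpp {z : L} (h : discr θ σ x z ≠ 0) {n : WithTop ℕ∞} :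
    ContDiffAt ℂ n (sectionVecOpp θ σ x) z :=
  ((contDiffAt_oppInv h).clm_apply ((contDiff_specProjOn _ _).contDiffAt.clm_apply
    (tau θ σ).contDiff.contDiffAt)).neg

/-- For `n = sectionVec z` in `𝔫(z)` the equation says that `τ (z + n)` has no negative component,
as `τ (z + n) = -(z + n)` requires. It is linear with invertible coefficient, so it has one solution
and this depends holomorphically on `z`. -/
theorem oppOp_sectionVec {z : L} (h : discr θ σ x z ≠ 0) :
    oppOp (tau θ σ) (realSpectrum x) (Set.Ioi 0) z (sectionVec θ σ x z) =
      -specProjOn (realSpectrum x) (Set.Iio 0) z (tau θ σ z) := by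
  rw [sectionVec, map_neg, oppOp_oppInv h]

theorem oppOp_sectionVecOpp {z : L} (h : discr θ σ x z ≠ 0) :
    oppOp (tau θ σ) (realSpectrum x) (Set.Ioi 0) z (sectionVecOpp θ σ x z) =
      -specProjOn (realSpectrum x) (Set.Ioi 0) z (tau θ σ z) := by
  rw [sectionVecOpp, map_neg, oppOp_oppInv h]

/-- `oppOp` interchanges positive and negative parts; this is what places the solution of a negative
equation in `𝔫(z)`. -/
theorem oppOp_comm_pos {z : L} (hz : z ∈ spectralSet L (realSpectrum x)) (u : L) :
    oppOp (tau θ σ) (realSpectrum x) (Set.Ioi 0) z (specProjOn (realSpectrum x) (Set.Ioi 0) z u) =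
      specProjOn (realSpectrum x) (Set.Iio 0) z
        (oppOp (tau θ σ) (realSpectrum x) (Set.Ioi 0) z u) := by
  have h := (oppOp_mul_pos (τ := tau θ σ) hz disjoint_Ioi_zero).trans
    (neg_mul_oppOp (τ := tau θ σ) hz disjoint_Ioi_zero).symm
  rw [neg_Ioi_zero] at h
  exact congrArg (fun T : L →L[ℂ] L => T u) h

theorem oppOp_comm_neg {z : L} (hz : z ∈ spectralSet L (realSpectrum x)) (u : L) :
    oppOp (tau θ σ) (realSpectrum x) (Set.Ioi 0) z (specProjOn (realSpectrum x) (Set.Iio 0) z u) =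
      specProjOn (realSpectrum x) (Set.Ioi 0) z
        (oppOp (tau θ σ) (realSpectrum x) (Set.Ioi 0) z u) := by
  have h := (oppOp_mul_neg (τ := tau θ σ) hz disjoint_Ioi_zero).trans
    (pos_mul_oppOp (τ := tau θ σ) hz disjoint_Ioi_zero).symm
  rw [neg_Ioi_zero] at h
  exact congrArg (fun T : L →L[ℂ] L => T u) h

theorem specProjOn_sectionVec {z : L} (hz : z ∈ spectralSet L (realSpectrum x))
    (h : discr θ σ x z ≠ 0) :
    specProjOn (realSpectrum x) (Set.Ioi 0) z (sectionVec θ σ x z) = sectionVec θ σ x z := by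
  apply oppOp_injective h
  rw [oppOp_comm_pos hz, oppOp_sectionVec h, map_neg, specProjOn_idem hz]

theorem specProjOn_sectionVecOpp {z : L} (hz : z ∈ spectralSet L (realSpectrum x))
    (h : discr θ σ x z ≠ 0) :
    specProjOn (realSpectrum x) (Set.Iio 0) z (sectionVecOpp θ σ x z) = sectionVecOpp θ σ x z := by
  apply oppOp_injective h
  rw [oppOp_comm_neg hz, oppOp_sectionVecOpp h, map_neg, specProjOn_idem hz]

/-- Uniqueness of the point of the fibre on which `τ` acts by `-1`. -/
theorem eq_sectionVec {z m : L} (hz : z ∈ spectralSet L (realSpectrum x))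
    (h : discr θ σ x z ≠ 0) (hm : m ∈ nilradical z) (hτ : tau θ σ (z + m) = -(z + m)) :
    m = sectionVec θ σ x z := by
  classical
  rw [mem_nilradical_iff hz] at hm
  apply oppOp_injective h
  rw [oppOp_sectionVec h]
  have h1 := congrArg (fun T : L →L[ℂ] L => T m)
    (oppOp_mul_pos (τ := tau θ σ) hz disjoint_Ioi_zero)
  simp only [clm_mul_apply, hm, neg_Ioi_zero] at h1
  have h2 : specProjOn (realSpectrum x) (Set.Iio 0) z m = 0 := by
    have := specProjOn_mul_of_disjoint hz disjoint_Ioi_zero.symm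
    rw [neg_Ioi_zero] at this
    have h3 := congrArg (fun T : L →L[ℂ] L => T m) this
    simp only [clm_mul_apply, hm] at h3
    exact h3
  have h3 : specProjOn (realSpectrum x) (Set.Iio 0) z z = 0 := by
    rw [specProjOn_apply_eigen hz (m := 0) (by simp)]
    simp
  have h4 : tau θ σ m = -z - m - tau θ σ z := by
    rw [map_add] at hτ
    rw [eq_sub_iff_add_eq, add_comm, hτ]
    abel
  rw [h1, h4, map_sub, map_sub, map_neg, h2, h3]
  abel

namespace SphericalData

theorem gradField_tangent (D : SphericalData θ σ x) {z : L} (hz : z ∈ domainB θ σ x) :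
    ∃ u : L, gradField θ σ x z = ⁅u, z⁆ := by
  rw [D.mem_domainB] at hz
  have hM := D.mem_spectralSet hz.1
  obtain ⟨v, -, hv⟩ := exists_lie_eq_specProjOn hM (I := Set.Ioi 0) (by simp) (sectionVec θ σ x z)
  obtain ⟨w, -, hw⟩ := exists_lie_eq_specProjOn hM (I := Set.Iio 0) (by simp)
    (sectionVecOpp θ σ x z)
  rw [specProjOn_sectionVec hM hz.2] at hv
  rw [specProjOn_sectionVecOpp hM hz.2] at hw
  exact ⟨(1 / 2 : ℂ) • (v + w), by rw [gradField, smul_lie, add_lie, hv, hw]⟩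

theorem differentiableOn_gradField (D : SphericalData θ σ x) :
    DifferentiableOn ℂ (gradField θ σ x) (domainB θ σ x) := fun z hz => by
  rw [D.mem_domainB] at hz
  exact ((((contDiffAt_sectionVec hz.2 (n := 1)).add
    (contDiffAt_sectionVecOpp hz.2)).const_smul (1 / 2 : ℂ)).differentiableAt
      one_ne_zero).differentiableWithinAt

/-- `K^ℂ` commutes with `τ` and transports spectral projections, so it intertwines the defining
linear equations, whose solutions are unique. -/
theorem gradField_map (D : SphericalData θ σ x) {k : L ≃L[ℂ] L} (hk : k ∈ sphericalGroup θ σ)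
    {z : L} (hz : z ∈ domainB θ σ x) : gradField θ σ x (k z) = k (gradField θ σ x z) := by
  have hkz := D.mem_domainB.mp (D.apply_mem_domainB hk hz)
  rw [D.mem_domainB] at hz
  have hM := D.mem_spectralSet hz.1
  have ha := isAut_of_mem hk
  have hτ := D.tau_apply_of_mem hk
  have h1 : sectionVec θ σ x (k z) = k (sectionVec θ σ x z) := by
    apply oppOp_injective hkz.2
    rw [oppOp_map ha hM hτ, oppOp_sectionVec hz.2, oppOp_sectionVec hkz.2, hτ,
      specProjOn_map ha hM, map_neg]
  have h2 : sectionVecOpp θ σ x (k z) = k (sectionVecOpp θ σ x z) := by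
    apply oppOp_injective hkz.2
    rw [oppOp_map ha hM hτ, oppOp_sectionVecOpp hz.2, oppOp_sectionVecOpp hkz.2, hτ,
      specProjOn_map ha hM, map_neg]
  rw [gradField, gradField, h1, h2, map_smul, map_add]

/-- For `y ∈ X*` the section `K^ℂ(x)` meets the Iwasawa fibre of `y` in `y + sectionVec y`. -/
theorem add_sectionVec_mem (D : SphericalData θ σ x) {y : L} (hy : y ∈ openOrbit θ σ x) :
    y + sectionVec θ σ x y ∈ sphericalOrbit θ σ x := by
  rw [D.mem_openOrbit] at hy
  have h1 : y ∈ flagOrbit θ σ x x := by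
    rw [D.flagOrbit_eq mem_compactOrbit_self D.discr_base]
    exact hy
  obtain ⟨k, hk, rfl⟩ := h1
  set y := iwasawaProj θ x (k x) with hydef
  have hkO : k x ∈ complexOrbit x := apply_mem_complexOrbit hk (mem_complexOrbit_self x)
  have h2 : k x - y ∈ nilradical y := (iwasawaProj_spec D.compact D.base_compact hkO).2
  have hs : k x ∈ sphericalOrbit θ σ x := ⟨k, hk, rfl⟩
  rw [← eq_sectionVec (D.mem_spectralSet (compactOrbit_subset hy.1)) hy.2 h2
    (by rw [add_sub_cancel]; exact D.tau_of_mem_sphericalOrbit hs), add_sub_cancel]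
  exact hs

theorem oppOp_conj (D : SphericalData θ σ x) {y : L} (hy : y ∈ compactOrbit θ x) (u : L) :
    oppOp (tau θ σ) (realSpectrum x) (Set.Ioi 0) y (θ u) =
      θ (oppOp (tau θ σ) (realSpectrum x) (Set.Ioi 0) y u) := by
  have h := specProjOn_conj_of_eq_neg D.compact.toIsConjugation D.neg_mem
    (D.mem_spectralSet (compactOrbit_subset hy)) (D.conj_eq_neg hy)
  simp only [oppOp, _root_.add_apply, sub_apply, clm_mul_apply, h, ← D.conj_tau, neg_neg, map_add,
    map_sub, one_apply_eq_self]
  abel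

/-- Since `-θ y = y`, conjugation by `θ` exchanges the two defining equations up to sign. So with `n
= sectionVec y` the field is `(n - θ n) / 2`, a vector in `i𝔤`. -/
theorem sectionVecOpp_eq (D : SphericalData θ σ x) {y : L} (hy : y ∈ openOrbit θ σ x) :
    sectionVecOpp θ σ x y = -θ (sectionVec θ σ x y) := by
  rw [D.mem_openOrbit] at hy
  have h := specProjOn_conj_of_eq_neg D.compact.toIsConjugation D.neg_mem
    (D.mem_spectralSet (compactOrbit_subset hy.1)) (D.conj_eq_neg hy.1)
  apply oppOp_injective hy.2
  rw [oppOp_sectionVecOpp hy.2, map_neg, D.oppOp_conj hy.1, oppOp_sectionVec hy.2, map_neg,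
    ← neg_Ioi_zero, ← h, D.conj_tau, D.conj_eq_neg hy.1, map_neg, map_neg, neg_neg]

/-- A holomorphic map on `ℬ` is determined by its restriction to `X*`. -/
theorem eqOn_domainB (D : SphericalData θ σ x) {F G : L → L}
    (hF : DifferentiableOn ℂ F (domainB θ σ x)) (hG : DifferentiableOn ℂ G (domainB θ σ x))
    (h : ∀ y ∈ openOrbit θ σ x, F y = G y) : Set.EqOn F G (domainB θ σ x) := by
  intro z hz
  have hθ := D.compact.toIsConjugation
  have hz' := D.mem_domainB.mp hz
  obtain ⟨g, hg, rfl⟩ := hz'.1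
  -- Every generator `u` is replaced by `Re u + t Im u`. For real `t` the curve runs in `X`, and at
  -- `t = i` it reaches `g x`.
  obtain ⟨C, h1, h2, h3⟩ := exists_curve (t₁ := Complex.I) (a := realPart θ) (b := imagPart θ)
    (fun u _ => realPart_add_imagPart u) hg
  set c : ℂ → L := fun t => C t x with hcdef
  have hc : Differentiable ℂ c := fun t => (h1 t).clm_apply (differentiableAt_const _)
  have hcI : c Complex.I = g x := by simp only [hcdef, h2]
  have hcO : ∀ t, c t ∈ complexOrbit x := fun t =>
    apply_mem_complexOrbit (h3 t Set.univ fun _ _ => trivial) (mem_complexOrbit_self x)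
  have hcX : ∀ r : ℝ, c r ∈ compactOrbit θ x := fun r => by
    refine ⟨C r, h3 r _ fun u _ => ?_, rfl⟩
    change θ (realPart θ u + (r : ℂ) • imagPart θ u) = _
    rw [map_add, conj_real_smul, conj_realPart hθ, conj_imagPart hθ]
  set U : Set ℂ := {t | discr θ σ x (c t) ≠ 0} with hU
  have hdc := differentiable_discr (θ := θ) (σ := σ) (x := x) |>.comp hc
  have hUo : IsOpen U := isOpen_ne_fun hdc.continuous continuous_const
  have hIU : Complex.I ∈ U := by
    change discr θ σ x (c Complex.I) ≠ 0
    rw [hcI]; exact hz'.2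
  have hmaps : Set.MapsTo c U (domainB θ σ x) := fun t ht => D.mem_domainB.mpr ⟨hcO t, ht⟩
  have hanal : AnalyticOnNhd ℂ (fun t => F (c t) - G (c t)) U :=
    DifferentiableOn.analyticOnNhd ((hF.comp hc.differentiableOn hmaps).sub
      (hG.comp hc.differentiableOn hmaps)) hUo
  have hlim : ∀ r : ℝ, Tendsto (fun r : ℝ => (r : ℂ)) (𝓝[≠] r) (𝓝[≠] (r : ℂ)) := fun r => by
    refine tendsto_nhdsWithin_iff.mpr ⟨?_, ?_⟩
    · exact (Complex.continuous_ofReal.tendsto r).mono_left nhdsWithin_le_nhds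
    · filter_upwards [self_mem_nhdsWithin] with s hs
      simpa using hs
  have hne := eventually_ne_zero_of_entire hdc (t₀ := Complex.I) hIU
  obtain ⟨r, hr⟩ := ((hlim 0).eventually (hne (0 : ℝ))).exists
  -- Real parameters accumulating at `r` give points of `X*`. The identity theorem on the connected
  -- set `U` then carries the equality to `t = i`.
  have hfreq : ∃ᶠ t in 𝓝[≠] (r : ℂ), F (c t) - G (c t) = 0 := by
    refine (hlim r).frequently ?_
    refine ((hlim r).eventually (hne r)).frequently.mono fun s hs => ?_
    rw [sub_eq_zero]
    exact h _ (D.mem_openOrbit.mpr ⟨hcX s, hs⟩)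
  have hzero := hanal.eqOn_zero_of_preconnected_of_frequently_eq_zero
    (isPreconnected_ne_zero_of_entire hdc) (z₀ := (r : ℂ)) hr hfreq hIU
  simp only [hcI, Pi.zero_apply] at hzero
  exact sub_eq_zero.mp hzero

end SphericalData
end HyperbolicOrbit

namespace HyperbolicOrbit

open Filter Topology ComplexConjugate

variable {L : Type*} [NormedLieRing L] [NormedLieAlgebra ℂ L] [FiniteDimensional ℂ L]
  {S : Finset ℝ} {θ σ : L →ₛₗ[starRingEnd ℂ] L} {x : L}

/-! ### The logarithmic derivative of a determinant -/

/-- The determinant of an operator. -/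
def opDet (A : L →L[ℂ] L) : ℂ := LinearMap.det (A : L →ₗ[ℂ] L)

/-- The trace as a continuous linear form. -/
def opTrace : (L →L[ℂ] L) →L[ℂ] ℂ :=
  LinearMap.toContinuousLinearMap
    ((LinearMap.trace ℂ L).comp (ContinuousLinearMap.coeLM ℂ : (L →L[ℂ] L) →ₗ[ℂ] (L →ₗ[ℂ] L)))

theorem opTrace_apply (A : L →L[ℂ] L) : opTrace A = LinearMap.trace ℂ L (A : L →ₗ[ℂ] L) := rfl

theorem opTrace_mul_comm (A B : L →L[ℂ] L) : opTrace (A * B) = opTrace (B * A) :=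
  LinearMap.trace_mul_comm ℂ (A : L →ₗ[ℂ] L) B

theorem opTrace_adC_mul (a b : L) : opTrace (adC a * adC b) = killingForm ℂ L a b :=
  (killingForm_apply_apply ℂ L a b).symm

theorem opDet_mul (A B : L →L[ℂ] L) : opDet (A * B) = opDet A * opDet B :=
  LinearMap.det_comp (A : L →ₗ[ℂ] L) B

theorem opDet_one_add_smul (A : L →L[ℂ] L) :
    ∃ p : Polynomial ℂ, ∀ t : ℂ, opDet (1 + t • A) = 1 + opTrace A * t + p.eval t * t ^ 2 := by
  classical
  let b := Module.finBasis ℂ L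
  refine ⟨(Matrix.det (1 + (Polynomial.X : Polynomial ℂ) •
    (LinearMap.toMatrix b b (A : L →ₗ[ℂ] L)).map Polynomial.C)).divX.divX, fun t => ?_⟩
  have h := Matrix.det_one_add_smul t (LinearMap.toMatrix b b (A : L →ₗ[ℂ] L))
  rw [← LinearMap.trace_eq_matrix_trace ℂ b, ← opTrace_apply] at h
  rw [← h, opDet, ← LinearMap.det_toMatrix b]
  congr 1
  rw [show ((1 + t • A : L →L[ℂ] L) : L →ₗ[ℂ] L) = LinearMap.id + t • (A : L →ₗ[ℂ] L) from rfl,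
    map_add, map_smul, LinearMap.toMatrix_id]

/-- The determinant is polynomial, hence differentiable, so its derivative can be read off on the
lines `1 + t A`. -/
theorem hasFDerivAt_opDet_one : HasFDerivAt (opDet (L := L)) opTrace 1 := by
  have h0 : DifferentiableAt ℂ (opDet (L := L)) 1 :=
    (contDiff_clm_det (n := 1)).differentiable one_ne_zero 1
  have h1 := h0.hasFDerivAt
  convert h1 using 1
  ext A
  have h2 : HasDerivAt (fun t : ℂ => (1 : L →L[ℂ] L) + t • A) A 0 := by
    simpa using ((hasDerivAt_id (0 : ℂ)).smul_const A).const_add (1 : L →L[ℂ] L)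
  have h1' : HasFDerivAt (opDet (L := L)) (fderiv ℂ opDet 1)
      ((fun t : ℂ => (1 : L →L[ℂ] L) + t • A) 0) := by simpa using h1
  have h3 := h1'.comp_hasDerivAt (0 : ℂ) h2
  obtain ⟨p, hp⟩ := opDet_one_add_smul A
  have h4 : HasDerivAt (fun t : ℂ => 1 + opTrace A * t + p.eval t * t ^ 2) (opTrace A) 0 := by
    have h5 := (((hasDerivAt_id (0 : ℂ)).const_mul (opTrace A)).const_add 1).add
      ((p.hasDerivAt 0).mul ((hasDerivAt_id (0 : ℂ)).pow 2))
    refine h5.congr_deriv ?_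
    simp
  have h6 : (opDet ∘ fun t : ℂ => (1 : L →L[ℂ] L) + t • A) =
      fun t : ℂ => 1 + opTrace A * t + p.eval t * t ^ 2 := funext hp
  rw [h6] at h3
  exact h4.unique h3

theorem hasDerivAt_log_norm {f : ℝ → ℂ} {f' : ℂ} {t : ℝ} (hf : HasDerivAt f f' t)
    (h : f t = 1) : HasDerivAt (fun s => Real.log ‖f s‖) f'.re t := by
  have h1 := hf.clog_real (by rw [h]; exact Complex.one_mem_slitPlane)
  have h2 := Complex.reCLM.hasFDerivAt.comp_hasDerivAt t h1
  rw [h, div_one] at h2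
  refine (h2.congr_deriv rfl).congr_of_eventuallyEq (Eventually.of_forall fun s => ?_)
  exact (Complex.log_re _).symm

/-- Multiplication by the constant inverse `G` of `F t` gives a curve through `1`, where the
derivative of the determinant is the trace; the discarded factor only adds a constant to the
logarithm. -/
theorem hasDerivAt_log_opDet {F : ℝ → L →L[ℂ] L} {F' G : L →L[ℂ] L} {t : ℝ}
    (hF : HasDerivAt F F' t) (hG : G * F t = 1) (hG' : F t * G = 1) :
    HasDerivAt (fun s => Real.log ‖opDet (F s)‖) (opTrace (G * F')).re t := by
  have h1 : HasDerivAt (fun s => G * F s) (G * F') t := hF.const_mul G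
  have h2 : HasFDerivAt (opDet (L := L)) ((opTrace (L := L)).restrictScalars ℝ) (G * F t) := by
    rw [hG]; exact hasFDerivAt_opDet_one.restrictScalars ℝ
  have h3 := h2.comp_hasDerivAt t h1
  have hone : opDet (1 : L →L[ℂ] L) = 1 := LinearMap.det_id
  have h4 := hasDerivAt_log_norm h3 (by simp only [Function.comp, hG, hone])
  have h5 : opDet (F t) * opDet G = 1 := by rw [← opDet_mul, hG', hone]
  have h6 := h4.const_add (Real.log ‖opDet (F t)‖)
  have h7 : ∀ s, opDet (F s) = opDet (F t) * opDet (G * F s) := fun s => by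
    rw [opDet_mul, ← mul_assoc, h5, one_mul]
  have h8 : opDet (F t) ≠ 0 := left_ne_zero_of_mul_eq_one h5
  have h9 : ∀ᶠ s in 𝓝 t, opDet (G * F s) ≠ 0 := by
    refine h3.continuousAt.eventually_ne ?_
    simp only [Function.comp, hG, hone]; exact one_ne_zero
  refine h6.congr_of_eventuallyEq ?_
  filter_upwards [h9] with s hs
  rw [h7 s, norm_mul, Real.log_mul (norm_ne_zero_iff.mpr h8) (norm_ne_zero_iff.mpr hs)]
  rfl

/-! ### The potential -/

/-- The infinitesimal identity behind the derivative of `log ‖oppDet‖`, for idempotents `E`, `F`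
of one filtration and `P`, `Q` of another one on which the involution `τ` exchanges `P`, `Q`. -/
theorem mul_eq_of_exchange {R : Type*} [Ring R] {O E F P Q τ : R} (h1 : O * E = F * τ * E)
    (h2 : E * P = P) (h3 : F * Q = F) (h4 : τ * P = Q * τ) : O * P = F * τ := by
  rw [← h2, ← mul_assoc, h1, mul_assoc, h2, mul_assoc, h4, ← mul_assoc, h3]

/-- `E`, `F` belong to `y`, while `P`, `Q` belong to a point where `τ` exchanges them. Absorption
gives `G F = P τ`, and cyclicity of the trace turns the two halves of the commutator into traces
against `P` and `Q`. -/
theorem opTrace_exchange {O G E F P Q τ V : L →L[ℂ] L} (hG : G * O = 1)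
    (h1 : O * E = F * τ * E) (h2 : E * P = P) (h3 : F * Q = F)
    (h4 : τ * P = Q * τ) (h5 : τ * τ = 1) :
    opTrace (G * (F * (τ * V - V * τ) * E)) = opTrace (V * P) - opTrace (V * Q) := by
  have h6 : G * F * τ = P := by
    rw [mul_assoc, ← mul_eq_of_exchange h1 h2 h3 h4, ← mul_assoc, hG, one_mul]
  have h8 : G * F = P * τ := by rw [← h6, mul_assoc, h5, mul_one]
  have h9 : τ * P * τ = Q := by rw [h4, mul_assoc, h5, mul_one]
  rw [mul_sub, sub_mul, mul_sub, map_sub]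
  congr 1
  · calc opTrace (G * (F * (τ * V) * E)) = opTrace (G * F * τ * V * E) := by simp only [mul_assoc]
      _ = opTrace (E * (P * V)) := by rw [h6, opTrace_mul_comm]
      _ = opTrace (V * P) := by rw [← mul_assoc, h2, opTrace_mul_comm]
  · calc opTrace (G * (F * (V * τ) * E)) = opTrace ((G * F) * (V * τ * E)) := by
          simp only [mul_assoc]
      _ = opTrace (V * (τ * (E * (P * τ)))) := by
          rw [opTrace_mul_comm, h8]; simp only [mul_assoc]
      _ = opTrace (V * Q) := by rw [← mul_assoc E, h2, ← mul_assoc τ, h9]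

/-- Moving the point is traded for conjugating `τ`, so that the spectral projections stay fixed
under differentiation. -/
theorem oppDet_expAd (τ : L →L[ℂ] L) (I : Set ℝ) {z : L} (hz : z ∈ spectralSet L S) (w : L) :
    oppDet τ S I (expAd w z) = oppDet (expAd (-w) * τ * expAd w) S I z := by
  have hg := specProjOn_map (isAut_expEquiv w) hz
  simp only [expEquiv_apply] at hg
  have h1 : oppOp τ S I (expAd w z) =
      expAd w * oppOp (expAd (-w) * τ * expAd w) S I z * expAd (-w) := by
    ext u
    obtain ⟨u, rfl⟩ : ∃ a, expAd w a = u := ⟨expAd (-w) u, expAd_apply_neg w u⟩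
    simp only [oppOp, _root_.add_apply, sub_apply, clm_mul_apply, hg, map_add, map_sub,
      expAd_neg_apply, one_apply_eq_self]
    simp only [← hg, expAd_apply_neg]
  have h2 : opDet (expAd w) * opDet (expAd (-w)) = (1 : ℂ) := by
    rw [← opDet_mul, expAd_mul_neg]; exact LinearMap.det_id
  change opDet _ = opDet _
  rw [h1, opDet_mul, opDet_mul, mul_right_comm, h2, one_mul]

theorem hasDerivAt_expAd_real (v : L) :
    HasDerivAt (fun t : ℝ => expAd ((t : ℂ) • v)) (adC v) 0 := by
  have h := (hasDerivAt_expAd v ((0 : ℝ) : ℂ)).scomp (0 : ℝ) Complex.ofRealCLM.hasDerivAt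
  refine h.congr_deriv ?_
  rw [Complex.ofReal_zero, zero_smul, expAd_zero, mul_one, Complex.ofRealCLM_apply,
    Complex.ofReal_one, one_smul]

theorem hasDerivAt_oppOp (τ : L →L[ℂ] L) (S : Finset ℝ) (I : Set ℝ) (z v : L) :
    HasDerivAt (fun t : ℝ => oppOp (expAd (-((t : ℂ) • v)) * τ * expAd ((t : ℂ) • v)) S I z)
      (specProjOn S (-I) z * (τ * adC v - adC v * τ) * specProjOn S I z +
        specProjOn S I z * (τ * adC v - adC v * τ) * specProjOn S (-I) z) 0 := by
  have h1 := hasDerivAt_expAd_real v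
  have h2 : HasDerivAt (fun t : ℝ => expAd (-((t : ℂ) • v))) (-adC v) 0 := by
    have := hasDerivAt_expAd_real (-v)
    simpa only [smul_neg, map_neg] using this
  have h3 : HasDerivAt (fun t : ℝ => expAd (-((t : ℂ) • v)) * τ * expAd ((t : ℂ) • v))
      (τ * adC v - adC v * τ) 0 := by
    refine ((h2.mul_const τ).mul h1).congr_deriv ?_
    simp only [Complex.ofReal_zero, zero_smul, neg_zero, expAd_zero, mul_one, one_mul]
    rw [neg_mul, neg_add_eq_sub]
  have h4 := (((h3.const_mul (specProjOn S (-I) z)).mul_const (specProjOn S I z)).add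
    ((h3.const_mul (specProjOn S I z)).mul_const (specProjOn S (-I) z))).add_const
      (1 - specProjOn S I z - specProjOn S (-I) z)
  exact h4

theorem specProj_eq_sub_lower {l : ℝ} (hl : l ∈ S) (z : L) :
    specProj S l z = specProjOn S (Set.Iic l) z - specProjOn S (Set.Iio l) z := by
  classical
  rw [eq_sub_iff_add_eq, show Set.Iic l = {l} ∪ Set.Iio l by
    rw [Set.singleton_union, Set.Iio_insert], specProjOn_union (by simp)]
  congr 1
  ext u
  simp [specProjOn_apply, hl]

/-- Differences of consecutive steps are the eigenprojections for `l` and `-l`; weighted by `l` and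
`-l` they add up to `ad z`. This is the origin of the weights in `rawPotential`. -/
theorem sum_pos_eq_adC (hS : ∀ l ∈ S, -l ∈ S) {z : L} (hz : z ∈ spectralSet L S) :
    ∑ l ∈ S with 0 < l, (l : ℂ) •
      ((specProjOn S (Set.Ici l) z - specProjOn S (-Set.Ici l) z) -
        (specProjOn S (Set.Ioi l) z - specProjOn S (-Set.Ioi l) z)) = adC z := by
  have h1 : ∀ l ∈ S, (specProjOn S (Set.Ici l) z - specProjOn S (-Set.Ici l) z) -
      (specProjOn S (Set.Ioi l) z - specProjOn S (-Set.Ioi l) z) =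
      specProj S l z - specProj S (-l) z := fun l hl => by
    rw [specProj_eq_sub hl, specProj_eq_sub_lower (hS l hl), Set.neg_Ici, Set.neg_Ioi]
    abel
  have h2 : ∑ l ∈ S, (if 0 < l then (l : ℂ) • specProj S (-l) z else 0) =
      ∑ l ∈ S, (if l < 0 then ((-l : ℝ) : ℂ) • specProj S l z else 0) := by
    refine Finset.sum_nbij' (fun l => -l) (fun l => -l) hS hS (by simp) (by simp) fun l _ => ?_
    simp
  rw [Finset.sum_filter, adC_eq_sum hz]
  calc _ = ∑ l ∈ S, ((if 0 < l then (l : ℂ) • specProj S l z else 0) -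
        (if 0 < l then (l : ℂ) • specProj S (-l) z else 0)) := by
        refine Finset.sum_congr rfl fun l hl => ?_
        rw [h1 l hl]
        split_ifs
        · rw [smul_sub]
        · rw [sub_zero]
    _ = _ := by
        rw [Finset.sum_sub_distrib, h2, ← Finset.sum_sub_distrib]
        refine Finset.sum_congr rfl fun l _ => ?_
        rcases lt_trichotomy l 0 with h | rfl | h
        · simp [h, h.not_gt]
        · simp
        · simp [h, h.not_gt]

/-- The Kähler potential up to an additive constant. -/
def rawPotential (θ σ : L →ₛₗ[starRingEnd ℂ] L) (x y : L) : ℝ :=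
  -∑ l ∈ realSpectrum x with 0 < l, l *
    (Real.log ‖oppDet (tau θ σ) (realSpectrum x) (Set.Ici l) y‖ -
      Real.log ‖oppDet (tau θ σ) (realSpectrum x) (Set.Ioi l) y‖)

/-- The Kähler potential. -/
def potential (θ σ : L →ₛₗ[starRingEnd ℂ] L) (x y : L) : ℝ :=
  rawPotential θ σ x y - rawPotential θ σ x x

namespace SphericalData

theorem isOpp_of_tau (D : SphericalData θ σ x) {s : L}
    (hs : s ∈ spectralSet L (realSpectrum x)) (h : tau θ σ s = -s) (I : Set ℝ) :
    IsOpp (tau θ σ) (realSpectrum x) I s := by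
  intro u h1 h2
  rw [D.specProjOn_tau hs h, neg_neg, h1] at h2
  rw [← D.tau_tau u, h2, map_zero]

/-- At `s` the involution exchanges the parts exactly, and the condition passes to `y` with the
filtration. On `X` the conditions for `I` and `-I` coincide. -/
theorem oppDet_ne_zero (D : SphericalData θ σ x) {y s : L} (hy : y ∈ compactOrbit θ x)
    (hs : s ∈ spectralSet L (realSpectrum x)) (hτ : tau θ σ s = -s)
    (hys : FilEq (realSpectrum x) y s) {I : Set ℝ} (hI : IsUpperSet I) (hpos : ∀ t ∈ I, 0 < t) :
    oppDet (tau θ σ) (realSpectrum x) I y ≠ 0 := by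
  have hyM := D.mem_spectralSet (compactOrbit_subset hy)
  have h1 := (D.isOpp_of_tau hs hτ I).of_filEq hs hyM hI hys.symm
  rw [oppDet_ne_zero_iff hyM (disjoint_neg_of_pos hpos), D.isOpp_neg_iff hyM, D.conj_eq_neg hy,
    neg_neg]
  exact ⟨h1, h1⟩

theorem tau_mul_specProjOn (D : SphericalData θ σ x) {s : L}
    (hs : s ∈ spectralSet L (realSpectrum x)) (h : tau θ σ s = -s) (I : Set ℝ) :
    tau θ σ * specProjOn (realSpectrum x) I s = specProjOn (realSpectrum x) (-I) s * tau θ σ := by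
  ext u
  have := D.specProjOn_tau hs h (-I) u
  rw [neg_neg] at this
  exact this.symm

/-- The block of `oppOp` on the `I`-part is evaluated with the projections of `s`, the block on the
`-I`-part with those of `-θ s`, which absorb the projections of `y` by conjugating the relations for
`s`. The involution also sends `-θ s` to its negative. -/
theorem hasDerivAt_log_oppDet (D : SphericalData θ σ x) {y s : L} (hy : y ∈ compactOrbit θ x)
    (hs : s ∈ spectralSet L (realSpectrum x)) (hτ : tau θ σ s = -s)
    (hys : FilEq (realSpectrum x) y s) {I : Set ℝ} (hI : IsUpperSet I) (hpos : ∀ t ∈ I, 0 < t)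
    (v : L) :
    HasDerivAt (fun t : ℝ => Real.log ‖oppDet (tau θ σ) (realSpectrum x) I (expAd ((t : ℂ) • v) y)‖)
      (opTrace (adC v * (specProjOn (realSpectrum x) I s - specProjOn (realSpectrum x) (-I) s)) -
        opTrace (adC v * (specProjOn (realSpectrum x) I (-θ s) -
          specProjOn (realSpectrum x) (-I) (-θ s)))).re 0 := by
  have hθ := D.compact.toIsConjugation
  have hyM := D.mem_spectralSet (compactOrbit_subset hy)
  have hdis := disjoint_neg_of_pos hpos
  have hs' : -θ s ∈ spectralSet L (realSpectrum x) := neg_conj_mem_spectralSet hθ D.neg_mem hs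
  have hτ' : tau θ σ (-θ s) = -(-θ s) := by rw [map_neg, ← D.conj_tau, hτ, map_neg]
  have hττ : tau θ σ * tau θ σ = 1 := by ext u; exact D.tau_tau u
  have hcy := specProjOn_conj_of_eq_neg hθ D.neg_mem hyM (D.conj_eq_neg hy)
  have hcs := specProjOn_neg_conj hθ D.neg_mem hs
  have hE1 := hys.mul_upper hyM hI
  have hE2 := hys.mul_lower hs (isUpperSet_neg hI)
  have hE3 : specProjOn (realSpectrum x) (-I) y * specProjOn (realSpectrum x) (-I) (-θ s) =
      specProjOn (realSpectrum x) (-I) (-θ s) := by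
    ext u
    obtain ⟨u, rfl⟩ : ∃ a, θ a = u := ⟨θ u, hθ.involutive u⟩
    rw [clm_mul_apply, hcs, hcy, neg_neg]
    exact congrArg (fun T : L →L[ℂ] L => θ (T u)) hE1
  have hE4 : specProjOn (realSpectrum x) I y * specProjOn (realSpectrum x) I (-θ s) =
      specProjOn (realSpectrum x) I y := by
    ext u
    obtain ⟨u, rfl⟩ : ∃ a, θ a = u := ⟨θ u, hθ.involutive u⟩
    rw [clm_mul_apply, hcs, hcy, hcy]
    exact congrArg (fun T : L →L[ℂ] L => θ (T u)) hE2
  have h4 := D.tau_mul_specProjOn hs hτ I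
  have h4' := D.tau_mul_specProjOn hs' hτ' (-I)
  rw [neg_neg] at h4'
  have hne := D.oppDet_ne_zero hy hs hτ hys hI hpos
  have hU := (isUnit_iff_injective _).mpr ((det_ne_zero_iff _).mp hne)
  have hG := Ring.inverse_mul_cancel _ hU
  have hG' := Ring.mul_inverse_cancel _ hU
  have hF := hasDerivAt_oppOp (tau θ σ) (realSpectrum x) I y v
  have h0 : oppOp (expAd (-(((0 : ℝ) : ℂ) • v)) * tau θ σ * expAd (((0 : ℝ) : ℂ) • v))
      (realSpectrum x) I y = oppOp (tau θ σ) (realSpectrum x) I y := by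
    rw [Complex.ofReal_zero, zero_smul, neg_zero, expAd_zero, one_mul, mul_one]
  have h5 := hasDerivAt_log_opDet (G := Ring.inverse (oppOp (tau θ σ) (realSpectrum x) I y)) hF
    (by rw [h0]; exact hG) (by rw [h0]; exact hG')
  rw [mul_add, map_add, opTrace_exchange hG (oppOp_mul_pos hyM hdis) hE1 hE2 h4 hττ,
    opTrace_exchange hG (oppOp_mul_neg hyM hdis) hE3 hE4 h4' hττ] at h5
  refine (h5.congr_deriv ?_).congr_of_eventuallyEq (Eventually.of_forall fun t => ?_)
  · simp only [mul_sub, map_sub]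
    congr 1
    abel
  · simp only [oppDet_expAd _ _ hyM]
    rfl

/-- The weighted sum of the projections of `s` and `-θ s` is `ad s` and `ad (-θ s)`, and the traces
become Killing products. -/
theorem hasDerivAt_rawPotential (D : SphericalData θ σ x) {y s : L} (hy : y ∈ compactOrbit θ x)
    (hs : s ∈ spectralSet L (realSpectrum x)) (hτ : tau θ σ s = -s)
    (hys : FilEq (realSpectrum x) y s) (v : L) :
    HasDerivAt (fun t : ℝ => rawPotential θ σ x (expAd ((t : ℂ) • v) y))
      (-(killingForm ℂ L v s - killingForm ℂ L v (-θ s)).re) 0 := by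
  have hθ := D.compact.toIsConjugation
  have hs' : -θ s ∈ spectralSet L (realSpectrum x) := neg_conj_mem_spectralSet hθ D.neg_mem hs
  have h1 := HasDerivAt.sum (u := (realSpectrum x).filter (0 < ·)) fun l hl =>
    (((D.hasDerivAt_log_oppDet hy hs hτ hys (isUpperSet_Ici l)
      (fun t ht => (Finset.mem_filter.mp hl).2.trans_le ht) v).sub
    (D.hasDerivAt_log_oppDet hy hs hτ hys (isUpperSet_Ioi l)
      (fun t ht => (Finset.mem_filter.mp hl).2.trans ht) v)).const_mul l)
  refine (h1.neg.congr_deriv ?_).congr_of_eventuallyEq (Eventually.of_forall fun t => ?_)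
  · congr 1
    rw [← opTrace_adC_mul, ← opTrace_adC_mul, ← sum_pos_eq_adC D.neg_mem hs,
      ← sum_pos_eq_adC D.neg_mem hs', Finset.mul_sum, Finset.mul_sum, map_sum, map_sum,
      ← Finset.sum_sub_distrib, Complex.re_sum]
    refine Finset.sum_congr rfl fun l _ => ?_
    simp only [mul_smul_comm, map_smul, smul_eq_mul, mul_sub, map_sub, Complex.sub_re,
      Complex.re_ofReal_mul]
    ring
  · simp [rawPotential]

theorem contDiffAt_rawPotential (D : SphericalData θ σ x) {y s : L}
    (hy : y ∈ compactOrbit θ x) (hs : s ∈ spectralSet L (realSpectrum x)) (hτ : tau θ σ s = -s)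
    (hys : FilEq (realSpectrum x) y s) {n : WithTop ℕ∞} :
    ContDiffAt ℝ n (rawPotential θ σ x) y := by
  have key : ∀ I : Set ℝ, IsUpperSet I → (∀ t ∈ I, 0 < t) →
      ContDiffAt ℝ n (fun y => Real.log ‖oppDet (tau θ σ) (realSpectrum x) I y‖) y :=
    fun I hI hpos => by
      have h0 := D.oppDet_ne_zero hy hs hτ hys hI hpos
      exact (((contDiff_oppDet (tau θ σ) (realSpectrum x) I).restrict_scalars ℝ).contDiffAt.norm
        ℝ h0).log (norm_ne_zero_iff.mpr h0)
  refine ContDiffAt.neg (ContDiffAt.sum fun l hl => contDiffAt_const.mul ?_)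
  exact (key _ (isUpperSet_Ici l) fun t ht => (Finset.mem_filter.mp hl).2.trans_le ht).sub
    (key _ (isUpperSet_Ioi l) fun t ht => (Finset.mem_filter.mp hl).2.trans ht)

theorem section_spec (D : SphericalData θ σ x) {y : L} (hy : y ∈ openOrbit θ σ x) :
    y + sectionVec θ σ x y ∈ spectralSet L (realSpectrum x) ∧
      tau θ σ (y + sectionVec θ σ x y) = -(y + sectionVec θ σ x y) ∧
      y + sectionVec θ σ x y ∈ iwasawaFiber y ∧
      FilEq (realSpectrum x) y (y + sectionVec θ σ x y) := by
  have hs := D.add_sectionVec_mem hy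
  have hy' := D.mem_openOrbit.mp hy
  have hyM := D.mem_spectralSet (compactOrbit_subset hy'.1)
  have hsM : y + sectionVec θ σ x y ∈ spectralSet L (realSpectrum x) := by
    obtain ⟨k, hk, h⟩ := hs
    rw [h]
    exact D.mem_spectralSet (apply_mem_complexOrbit hk (mem_complexOrbit_self x))
  have hf : y + sectionVec θ σ x y ∈ iwasawaFiber y := by
    change y + sectionVec θ σ x y - y ∈ nilradical y
    rw [add_sub_cancel_left, mem_nilradical_iff hyM, specProjOn_sectionVec hyM hy'.2]
  exact ⟨hsM, D.tau_of_mem_sphericalOrbit hs, hf, filEq_of_mem_iwasawaFiber hyM hsM hf⟩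

theorem contDiffAt_potential (D : SphericalData θ σ x) {y : L} (hy : y ∈ openOrbit θ σ x)
    {n : WithTop ℕ∞} : ContDiffAt ℝ n (potential θ σ x) y := by
  obtain ⟨h1, h2, -, h3⟩ := D.section_spec hy
  exact (D.contDiffAt_rawPotential (D.mem_openOrbit.mp hy).1 h1 h2 h3).sub contDiffAt_const

/-- `dh = 2β`. -/
theorem hasDerivAt_potential (D : SphericalData θ σ x) {y : L} (hy : y ∈ openOrbit θ σ x) {v : L}
    (hv : θ v = v) : HasDerivAt (fun t : ℝ => potential θ σ x (expAd ((t : ℂ) • v) y))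
      (2 * (killingForm ℂ L (y - (y + sectionVec θ σ x y)) v).re) 0 := by
  obtain ⟨h1, h2, -, h3⟩ := D.section_spec hy
  have hθ := D.compact.toIsConjugation
  have hyX := (D.mem_openOrbit.mp hy).1
  refine ((D.hasDerivAt_rawPotential hyX h1 h2 h3 v).sub_const _).congr_deriv ?_
  have h4 := killingForm_conj hθ v (y + sectionVec θ σ x y)
  have h5 := killingForm_conj hθ v y
  rw [hv] at h4 h5
  have h6 := congrArg Complex.re h5
  rw [D.conj_eq_neg hyX, map_neg, Complex.conj_re, Complex.neg_re] at h6
  -- `θ v = v` and `θ y = -y` make `⟨v, y⟩` purely imaginary, so `y` can be inserted into `-2 Re ⟨s,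
  -- v⟩`.
  have h7 : (killingForm ℂ L v y).re = 0 := by linarith
  rw [map_neg, h4, killingForm_comm _ v, map_sub, Complex.sub_re, Complex.sub_re, Complex.neg_re,
    Complex.conj_re, h7]
  ring

theorem potential_base : potential θ σ x x = 0 := sub_self _

end SphericalData
end HyperbolicOrbit

namespace HyperbolicOrbit

open Filter Topology ComplexConjugate

variable {L : Type*} [NormedLieRing L] [NormedLieAlgebra ℂ L] [FiniteDimensional ℂ L]
  {S : Finset ℝ} {θ σ : L →ₛₗ[starRingEnd ℂ] L} {x : L}

/-! ### Smoothness of the Iwasawa projection -/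

/-- The orthogonal projection onto the range of `specProjOn S I z`, in terms of the Hermitian form
defined by `θ`. -/
def stepOp (θ : L →ₛₗ[starRingEnd ℂ] L) (S : Finset ℝ) (I : Set ℝ) (z : L) : L →L[ℂ] L :=
  specProjOn S I z * Ring.inverse (1 + specProjOn S I z - specProjOn S I (-θ z))

theorem contDiff_stepOp_aux (θ : L →ₛₗ[starRingEnd ℂ] L) (S : Finset ℝ) (I : Set ℝ)
    {n : WithTop ℕ∞} :
    ContDiff ℝ n fun z : L => 1 + specProjOn S I z - specProjOn S I (-θ z) := by
  have h := (contDiff_specProjOn (L := L) S I (n := n)).restrict_scalars ℝ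
  exact (contDiff_const.add h).sub (h.comp (conjR θ).contDiff.neg)

theorem stepOp_aux_eq_one {y : L} (hy : θ y = -y) (I : Set ℝ) :
    1 + specProjOn S I y - specProjOn S I (-θ y) = 1 := by
  rw [hy, neg_neg, add_sub_cancel_right]

theorem contDiffAt_stepOp {y : L} (hy : θ y = -y) (I : Set ℝ) {n : WithTop ℕ∞} :
    ContDiffAt ℝ n (stepOp θ S I) y := by
  have h := (contDiff_specProjOn (L := L) S I (n := n)).restrict_scalars ℝ
  have h1 := contDiffAt_ringInverse ℝ (n := n) (1 : (L →L[ℂ] L)ˣ)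
  rw [Units.val_one, ← stepOp_aux_eq_one (S := S) hy I] at h1
  exact h.contDiffAt.mul (h1.comp y (contDiff_stepOp_aux θ S I).contDiffAt)

theorem eventually_isUnit_stepOp {y : L} (hy : θ y = -y) (I : Set ℝ) :
    ∀ᶠ z in 𝓝 y, IsUnit (1 + specProjOn S I z - specProjOn S I (-θ z)) := by
  refine (contDiff_stepOp_aux θ S I (n := 0)).continuous.continuousAt.eventually
    (p := fun T => IsUnit T) (Units.isOpen.eventually_mem ?_)
  change IsUnit (1 + specProjOn S I y - specProjOn S I (-θ y))
  rw [stepOp_aux_eq_one hy]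
  exact isUnit_one

/-- Put `E = E_I(z)`, `E' = E_I(-θ z)` and `F = E_I(y)`. The common filtration gives `F E = E` and,
after conjugation, `F E' = F`. Hence `F (1 + E - E') = E`, which is solved for `F` by a formula in
`z` alone. -/
theorem stepOp_eq (hθ : IsConjugation θ) (hS : ∀ l ∈ S, -l ∈ S) {y z : L}
    (hy : y ∈ spectralSet L S) (hz : z ∈ spectralSet L S) (hθy : θ y = -y) (h : FilEq S z y)
    {I : Set ℝ} (hI : IsUpperSet I)
    (hu : IsUnit (1 + specProjOn S I z - specProjOn S I (-θ z))) :
    stepOp θ S I z = specProjOn S I y := by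
  have h1 := h.symm.mul_upper hy hI
  have h2 := h.symm.mul_lower hz (isUpperSet_neg hI)
  have h3 : specProjOn S I y * specProjOn S I (-θ z) = specProjOn S I y := by
    ext u
    obtain ⟨u, rfl⟩ : ∃ a, θ a = u := ⟨θ u, hθ.involutive u⟩
    rw [clm_mul_apply, specProjOn_neg_conj hθ hS hz, specProjOn_conj_of_eq_neg hθ hS hy hθy,
      specProjOn_conj_of_eq_neg hθ hS hy hθy]
    exact congrArg (fun T : L →L[ℂ] L => θ (T u)) h2
  have h4 : specProjOn S I z =
      specProjOn S I y * (1 + specProjOn S I z - specProjOn S I (-θ z)) := by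
    rw [mul_sub, mul_add, h1, h3, mul_one, add_sub_cancel_left]
  rw [stepOp]
  nth_rw 1 [h4]
  rw [mul_assoc, Ring.mul_inverse_cancel _ hu, mul_one]

/-- The point `Π z` is recovered from its spectral projections by `ad y = ∑ l E_l(y)` and a left
inverse of the injective map `ad`. Each `E_l` is a difference of two `stepOp`, which are smooth in a
neighbourhood of `y` in `L`. -/
theorem exists_smooth_iwasawaProj (hθ : IsCompactConjugation θ) (hx : θ x = -x) {y : L}
    (hy : y ∈ compactOrbit θ x) (n : WithTop ℕ∞) :
    ∃ P : L → L, ContDiffAt ℝ n P y ∧ ∀ᶠ z in 𝓝 y, z ∈ complexOrbit x → P z = iwasawaProj θ x z := by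
  have hθ' := hθ.toIsConjugation
  have hM := complexOrbit_subset hθ hx
  have hS : ∀ l ∈ realSpectrum x, -l ∈ realSpectrum x := fun l => neg_mem_realSpectrum hθ' hx
  have hθy := conj_eq_neg_of_mem hθ' hx hy
  obtain ⟨f, hf⟩ := (adC (L := L)).toLinearMap.exists_leftInverse_of_injective
    (LinearMap.ker_eq_bot.mpr (adC_injective hθ))
  let F : (L →L[ℂ] L) →L[ℂ] L := LinearMap.toContinuousLinearMap f
  have hF : ∀ z, F (adC z) = z := fun z => congrArg (fun T : L →ₗ[ℂ] L => T z) hf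
  refine ⟨fun z => F (∑ l ∈ realSpectrum x, (l : ℂ) • (stepOp θ (realSpectrum x) (Set.Ici l) z -
    stepOp θ (realSpectrum x) (Set.Ioi l) z)), ?_, ?_⟩
  · refine (F.restrictScalars ℝ).contDiff.contDiffAt.comp y (ContDiffAt.sum fun l _ => ?_)
    exact ((contDiffAt_stepOp hθy _).sub (contDiffAt_stepOp hθy _)).const_smul (l : ℂ)
  · have h1 : ∀ᶠ z in 𝓝 y, ∀ l ∈ realSpectrum x,
        IsUnit (1 + specProjOn (realSpectrum x) (Set.Ici l) z -
          specProjOn (realSpectrum x) (Set.Ici l) (-θ z)) ∧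
        IsUnit (1 + specProjOn (realSpectrum x) (Set.Ioi l) z -
          specProjOn (realSpectrum x) (Set.Ioi l) (-θ z)) := by
      rw [Filter.eventually_all_finset]
      exact fun l _ => (eventually_isUnit_stepOp hθy _).and (eventually_isUnit_stepOp hθy _)
    filter_upwards [h1] with z hz hzO
    have h2 := (iwasawaProj_spec hθ hx hzO).1
    have h3 := hM (compactOrbit_subset h2)
    have h4 := (filEq_iwasawaProj hθ hx hzO).symm
    have h5 := conj_eq_neg_of_mem hθ' hx h2
    rw [← hF (iwasawaProj θ x z), adC_eq_sum h3]
    congr 1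
    refine Finset.sum_congr rfl fun l hl => ?_
    rw [specProj_eq_sub hl, stepOp_eq hθ' hS h3 (hM hzO) h5 h4 (isUpperSet_Ici l) (hz l hl).1,
      stepOp_eq hθ' hS h3 (hM hzO) h5 h4 (isUpperSet_Ioi l) (hz l hl).2]

/-! ### The parabolic subalgebra -/

/-- Eigenvalues add under brackets, so nonnegative degrees are preserved: `𝔭(y)` is a subalgebra. -/
theorem specProjOn_lie_eq_zero {y a b : L} (hy : y ∈ spectralSet L S)
    (ha : specProjOn S (Set.Iio 0) y a = 0) (hb : specProjOn S (Set.Iio 0) y b = 0) :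
    specProjOn S (Set.Iio 0) y ⁅a, b⁆ = 0 := by
  classical
  have key : ∀ {a : L}, specProjOn S (Set.Iio 0) y a = 0 →
      a = ∑ l ∈ S, if l ∈ Set.Ici (0 : ℝ) then specProj S l y a else 0 := fun {a} ha => by
    have h := congrArg (fun T : L →L[ℂ] L => T a) (specProjOn_add_compl hy (Set.Iio 0))
    simp only [_root_.add_apply, ha, zero_add, one_apply_eq_self, Set.compl_Iio] at h
    rw [← specProjOn_apply, h]
  rw [key ha, key hb, sum_lie, map_sum]
  refine Finset.sum_eq_zero fun l hl => ?_
  rw [lie_sum, map_sum]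
  refine Finset.sum_eq_zero fun m hm => ?_
  split_ifs with h1 h2
  · rw [specProjOn_apply_eigen hy (lie_lie_eigen (lie_specProj hy hl a) (lie_specProj hy hm b)),
      if_neg]
    exact not_lt.mpr (add_nonneg (Set.mem_Ici.mp h1) (Set.mem_Ici.mp h2))
  all_goals simp

theorem expAd_mem_of_lie_mem {W : Submodule ℂ L} {u : L} (h : ∀ a ∈ W, ⁅u, a⁆ ∈ W) {a : L}
    (ha : a ∈ W) : expAd u a ∈ W := by
  let _ : NormedAlgebra ℚ (L →L[ℂ] L) := .restrictScalars ℚ ℂ _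
  have h1 := (NormedSpace.exp_series_hasSum_exp' (𝕂 := ℂ) (adC u)).mapL
    (ContinuousLinearMap.apply ℂ L a)
  refine (Submodule.closed_of_finiteDimensional W).mem_of_tendsto h1
    (Eventually.of_forall fun s => W.sum_mem fun k hk => ?_)
  clear hk
  change ((k.factorial : ℂ)⁻¹ • (adC u) ^ k) a ∈ W
  refine W.smul_mem _ ?_
  induction k with
  | zero => exact ha
  | succ k ih =>
    rw [pow_succ']
    exact h _ ih

/-- A positive and a nonnegative eigenvalue never add up to zero, so `𝔫(y)` and `𝔭(y)` are
orthogonal. -/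
theorem killingForm_eq_zero_of_nilradical {y n p : L} (hy : y ∈ spectralSet L S)
    (hn : specProjOn S (Set.Ioi 0) y n = n) (hp : specProjOn S (Set.Iio 0) y p = 0) :
    killingForm ℂ L n p = 0 := by
  classical
  have h := congrArg (fun T : L →L[ℂ] L => T p) (specProjOn_add_compl hy (Set.Iio 0))
  simp only [_root_.add_apply, hp, zero_add, one_apply_eq_self, Set.compl_Iio] at h
  rw [← hn, ← h, specProjOn_apply, specProjOn_apply, map_sum (killingForm ℂ L),
    LinearMap.sum_apply]
  refine Finset.sum_eq_zero fun l hl => ?_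
  rw [map_sum]
  refine Finset.sum_eq_zero fun m hm => ?_
  split_ifs with h1 h2
  · exact killingForm_eigen (lie_specProj hy hl n) (lie_specProj hy hm p)
      (add_pos_of_pos_of_nonneg (Set.mem_Ioi.mp h1) (Set.mem_Ici.mp h2)).ne'
  all_goals simp

theorem specProjOn_eq_zero_of_lie {y q : L} (hy : y ∈ spectralSet L S) {I : Set ℝ}
    (h0 : (0 : ℝ) ∉ I) (h : specProjOn S I y ⁅y, q⁆ = 0) : specProjOn S I y q = 0 := by
  classical
  rw [specProjOn_lie hy] at h
  have h1 := specProjOn_apply_eigen hy (I := I) (m := 0) (u := specProjOn S I y q) (by rw [h]; simp)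
  rwa [specProjOn_idem hy, if_neg h0] at h1

/-- Bracketing with `y` is injective on negative eigenspaces, so `i v - v'` lies in `𝔭(y)` as soon
as its bracket with `y` lies in `𝔫(y)`. -/
theorem IsJ.specProjOn_eq_zero {y v v' : L} (hy : y ∈ spectralSet L S) (h : IsJ y v v') :
    specProjOn S (Set.Iio 0) y (Complex.I • v - v') = 0 := by
  refine specProjOn_eq_zero_of_lie hy (by simp) ?_
  have h1 : ⁅v', y⁆ - Complex.I • ⁅v, y⁆ ∈ nilradical y := h
  rw [mem_nilradical_iff hy] at h1
  have h2 : ⁅y, Complex.I • v - v'⁆ = ⁅v', y⁆ - Complex.I • ⁅v, y⁆ := by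
    rw [← smul_lie, ← sub_lie, ← lie_skew, ← neg_lie, neg_sub]
  have h3 := specProjOn_mul_of_disjoint hy (I := Set.Iio 0) (J := Set.Ioi 0)
    (Set.disjoint_left.mpr fun t h1 h2 => lt_asymm (Set.mem_Iio.mp h1) (Set.mem_Ioi.mp h2))
  rw [h2, ← h1, ← clm_mul_apply, h3]
  rfl

/-! ### Derivatives along one-parameter groups -/

theorem contDiff_expAd_apply (u z : L) {n : WithTop ℕ∞} :
    ContDiff ℂ n (fun t : ℂ => expAd (t • u) z) :=
  Differentiable.contDiff fun t => (hasDerivAt_expAd_apply u z t).differentiableAt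

theorem hasDerivAt_expAd_apply_real (u z : L) :
    HasDerivAt (fun t : ℝ => expAd ((t : ℂ) • u) z) ⁅u, z⁆ 0 :=
  ((hasDerivAt_expAd_apply u z ((0 : ℝ) : ℂ)).scomp (0 : ℝ)
    Complex.ofRealCLM.hasDerivAt).congr_deriv (by simp)

theorem continuousAt_expAd_apply_real (u z : L) :
    Tendsto (fun t : ℝ => expAd ((t : ℂ) • u) z) (𝓝 0) (𝓝 z) := by
  have := (hasDerivAt_expAd_apply_real u z).continuousAt.tendsto
  simpa using this

theorem expAd_mem_complexOrbit {z : L} (hz : z ∈ complexOrbit x) (u : L) :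
    expAd u z ∈ complexOrbit x :=
  apply_mem_complexOrbit (expEquiv_mem (Set.mem_univ u)) hz

/-- Elements of the parabolic subalgebra generate curves in the Iwasawa fibre. -/
theorem eventually_iwasawaProj_expAd (hθ : IsCompactConjugation θ) (hx : θ x = -x) {y p : L}
    (hy : y ∈ compactOrbit θ x) (hp : specProjOn (realSpectrum x) (Set.Iio 0) y p = 0) :
    ∀ᶠ t : ℝ in 𝓝 0, iwasawaProj θ x (expAd ((t : ℂ) • p) y) = y := by
  have hM := complexOrbit_subset hθ hx
  have hyO := compactOrbit_subset hy
  have hyM := hM hyO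
  let W : Submodule ℂ L := LinearMap.ker (specProjOn (realSpectrum x) (Set.Iio 0) y).toLinearMap
  have hyW : y ∈ W := by
    change specProjOn (realSpectrum x) (Set.Iio 0) y y = 0
    rw [specProjOn_apply_eigen hyM (m := 0) (by simp)]
    simp
  have h1 := ((continuousAt_expAd_apply_real p y).sub_const y).eventually
    (p := fun q => specProjOn (realSpectrum x) (Set.Iio 0) y q = 0 →
      y + q ∈ spectralSet L (realSpectrum x) → q ∈ nilradical y)
    (by rw [sub_self]; exact eventually_mem_nilradical hθ hyM)
  filter_upwards [h1] with t ht
  have h2 := expAd_mem_complexOrbit hyO ((t : ℂ) • p)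
  have h3 : expAd ((t : ℂ) • p) y ∈ W := by
    refine expAd_mem_of_lie_mem (fun a ha => ?_) hyW
    rw [smul_lie]
    exact W.smul_mem _ (specProjOn_lie_eq_zero hyM hp ha)
  have h4 : expAd ((t : ℂ) • p) y ∈ iwasawaFiber y :=
    ht (W.sub_mem h3 hyW) (by rw [add_sub_cancel]; exact hM h2)
  exact iwasawaProj_eq hθ hx h2 hy (filEq_of_mem_iwasawaFiber hyM (hM h2) h4).symm

/-- `Π` depends only on the filtration, and automorphisms preserve equality of filtrations. -/
theorem iwasawaProj_expAd_iwasawaProj (hθ : IsCompactConjugation θ) (hx : θ x = -x) {z : L}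
    (hz : z ∈ complexOrbit x) (u : L) :
    iwasawaProj θ x (expAd u (iwasawaProj θ x z)) = iwasawaProj θ x (expAd u z) := by
  have hM := complexOrbit_subset hθ hx
  have hy := (iwasawaProj_spec hθ hx hz).1
  have hyO := compactOrbit_subset hy
  have h1 := expAd_mem_complexOrbit hz u
  have h2 := expAd_mem_complexOrbit hyO u
  refine iwasawaProj_eq hθ hx h2 (iwasawaProj_spec hθ hx h1).1 ?_
  exact ((filEq_iwasawaProj hθ hx hz).map (isAut_expEquiv u) (hM hyO) (hM hz)).trans (hM h1)
    (filEq_iwasawaProj hθ hx h1).symm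

/-- Split `u` into `w ∈ 𝔤` and `u - w ∈ 𝔭(y)`. The flow of `w` stays in `X`, where `Π` is the
identity; that of `u - w` stays for small time in the fibre of `y`, where `Π` is constant. -/
theorem fderiv_iwasawaProj (hθ : IsCompactConjugation θ) (hx : θ x = -x) {y u w : L} {P : L → L}
    (hy : y ∈ compactOrbit θ x) (hP : DifferentiableAt ℝ P y)
    (hPe : ∀ᶠ z in 𝓝 y, z ∈ complexOrbit x → P z = iwasawaProj θ x z) (hw : θ w = w)
    (hp : specProjOn (realSpectrum x) (Set.Iio 0) y (u - w) = 0) :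
    fderiv ℝ P y ⁅u, y⁆ = ⁅w, y⁆ := by
  have hyO := compactOrbit_subset hy
  have hcurve : ∀ u : L, HasDerivAt (fun t : ℝ => iwasawaProj θ x (expAd ((t : ℂ) • u) y))
      (fderiv ℝ P y ⁅u, y⁆) 0 := fun u => by
    have h1 := hP.hasFDerivAt
    rw [show y = expAd (((0 : ℝ) : ℂ) • u) y by simp] at h1
    have h2 := h1.comp_hasDerivAt (0 : ℝ) (hasDerivAt_expAd_apply_real u y)
    rw [show expAd (((0 : ℝ) : ℂ) • u) y = y by simp] at h2
    refine h2.congr_of_eventuallyEq ?_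
    filter_upwards [(continuousAt_expAd_apply_real u y).eventually hPe] with t ht
    exact (ht (expAd_mem_complexOrbit hyO _)).symm
  have h1 : fderiv ℝ P y ⁅w, y⁆ = ⁅w, y⁆ := by
    refine (hcurve w).unique ((hasDerivAt_expAd_apply_real w y).congr_of_eventuallyEq
      (Eventually.of_forall fun t => ?_))
    refine iwasawaProj_self hθ hx (apply_mem_compactOrbit (expEquiv_mem ?_) hy)
    change θ ((t : ℂ) • w) = (t : ℂ) • w
    rw [conj_real_smul, hw]
  have h2 : fderiv ℝ P y ⁅u - w, y⁆ = 0 := by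
    refine (hcurve (u - w)).unique ((hasDerivAt_const (0 : ℝ) y).congr_of_eventuallyEq ?_)
    exact eventually_iwasawaProj_expAd hθ hx hy hp
  rw [sub_lie, map_sub, h1, sub_eq_zero] at h2
  exact h2

namespace SphericalData

theorem fderiv_potential (D : SphericalData θ σ x) {y : L} (hy : y ∈ openOrbit θ σ x) {v : L}
    (hv : θ v = v) :
    fderiv ℝ (potential θ σ x) y ⁅v, y⁆ = -(2 * (killingForm ℂ L (sectionVec θ σ x y) v).re) := by
  have h1 := ((D.contDiffAt_potential hy (n := 1)).differentiableAt one_ne_zero).hasFDerivAt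
  rw [show y = expAd (((0 : ℝ) : ℂ) • v) y by simp] at h1
  have h2 := h1.comp_hasDerivAt (0 : ℝ) (hasDerivAt_expAd_apply_real v y)
  rw [show expAd (((0 : ℝ) : ℂ) • v) y = y by simp] at h2
  rw [h2.unique (D.hasDerivAt_potential hy hv), sub_add_cancel_left, map_neg, LinearMap.neg_apply,
    Complex.neg_re, mul_neg]

/-- Only the `𝔤`-component `w` of `u` contributes. Replacing it by `u` changes nothing, since
`sectionVec y ∈ 𝔫(y)` is orthogonal to `u - w ∈ 𝔭(y)`. -/
theorem hasDerivAt_potential_iwasawaProj_of_compact (D : SphericalData θ σ x) {y : L}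
    (hy : y ∈ openOrbit θ σ x) (u : L) :
    HasDerivAt (fun t : ℝ => potential θ σ x (iwasawaProj θ x (expAd ((t : ℂ) • u) y)))
      (-(2 * (killingForm ℂ L (sectionVec θ σ x y) u).re)) 0 := by
  have hy' := D.mem_openOrbit.mp hy
  have hyO := compactOrbit_subset hy'.1
  have hyM := D.mem_spectralSet hyO
  obtain ⟨P, hP, hPe⟩ := exists_smooth_iwasawaProj D.compact D.base_compact hy'.1 1
  obtain ⟨w, hw, hp⟩ := exists_realForm_sub D.compact.toIsConjugation D.neg_mem hyM
    (D.conj_eq_neg hy'.1) u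
  have hPd := hP.differentiableAt one_ne_zero
  have hPy : P y = y := by
    rw [hPe.self_of_nhds hyO, iwasawaProj_self D.compact D.base_compact hy'.1]
  have h1 := ((D.contDiffAt_potential hy (n := 1)).differentiableAt one_ne_zero).hasFDerivAt
  rw [← hPy] at h1
  have h2 := h1.comp y hPd.hasFDerivAt
  rw [show y = expAd (((0 : ℝ) : ℂ) • u) y by simp] at h2
  have h3 := h2.comp_hasDerivAt (0 : ℝ) (hasDerivAt_expAd_apply_real u y)
  rw [show expAd (((0 : ℝ) : ℂ) • u) y = y by simp] at h3
  have h4 : killingForm ℂ L (sectionVec θ σ x y) (u - w) = 0 :=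
    killingForm_eq_zero_of_nilradical hyM (specProjOn_sectionVec hyM hy'.2) hp
  rw [map_sub, sub_eq_zero] at h4
  refine (h3.congr_deriv ?_).congr_of_eventuallyEq ?_
  · rw [h4, ← D.fderiv_potential hy hw, ContinuousLinearMap.comp_apply,
      fderiv_iwasawaProj D.compact D.base_compact hy'.1 hPd hPe hw hp, hPy]
  · filter_upwards [(continuousAt_expAd_apply_real u y).eventually hPe] with t ht
    rw [← ht (expAd_mem_complexOrbit hyO _)]
    rfl

/-- `z + sectionVec z` is constant along the Iwasawa fibres. -/
theorem sectionVec_iwasawaProj (D : SphericalData θ σ x) {z : L} (hz : z ∈ complexOrbit x)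
    (h : discr θ σ x z ≠ 0) (hy : iwasawaProj θ x z ∈ openOrbit θ σ x) :
    iwasawaProj θ x z + sectionVec θ σ x (iwasawaProj θ x z) = z + sectionVec θ σ x z := by
  have hzM := D.mem_spectralSet hz
  have hyX := (D.mem_openOrbit.mp hy).1
  have hyM := D.mem_spectralSet (compactOrbit_subset hyX)
  have h1 := (filEq_iwasawaProj D.compact D.base_compact hz).nilradical_eq hyM hzM
  obtain ⟨-, h2, h3, -⟩ := D.section_spec hy
  have h4 := (iwasawaProj_spec D.compact D.base_compact hz).2
  set y := iwasawaProj θ x z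
  set s := y + sectionVec θ σ x y
  change s - y ∈ nilradical y at h3
  change z - y ∈ nilradical y at h4
  rw [h1] at h3 h4
  rw [← eq_sectionVec hzM h (m := s - z) ?_ ?_, add_sub_cancel]
  · have := sub_mem h3 h4
    rwa [sub_sub_sub_cancel_right] at this
  · rw [add_sub_cancel, h2]

theorem hasDerivAt_potential_iwasawaProj (D : SphericalData θ σ x) {z : L}
    (hz : z ∈ complexOrbit x) (h : discr θ σ x z ≠ 0) (u : L) :
    HasDerivAt (fun t : ℝ => potential θ σ x (iwasawaProj θ x (expAd ((t : ℂ) • u) z)))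
      (2 * (killingForm ℂ L (iwasawaProj θ x z - (z + sectionVec θ σ x z)) u).re) 0 := by
  have hy : iwasawaProj θ x z ∈ openOrbit θ σ x :=
    D.mem_openOrbit.mpr ⟨(iwasawaProj_spec D.compact D.base_compact hz).1,
      (D.isOpp_iwasawaProj_iff hz).mpr ((D.mem_of_discr (D.mem_spectralSet hz)).mp h).1⟩
  have h1 := D.hasDerivAt_potential_iwasawaProj_of_compact hy u
  simp only [iwasawaProj_expAd_iwasawaProj D.compact D.base_compact hz] at h1
  refine h1.congr_deriv ?_
  rw [← D.sectionVec_iwasawaProj hz h hy, sub_add_cancel_left, map_neg, LinearMap.neg_apply,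
    Complex.neg_re, mul_neg]

end SphericalData
end HyperbolicOrbit

namespace HyperbolicOrbit

open Filter Topology ComplexConjugate

variable {L : Type*} [NormedLieRing L] [NormedLieAlgebra ℂ L] [FiniteDimensional ℂ L]
  {S : Finset ℝ} {θ σ : L →ₛₗ[starRingEnd ℂ] L} {x : L}

/-! ### The equation `i∂∂̄h = ω` -/

theorem hasDerivAt_ofReal_mul (ζ α : ℂ) : HasDerivAt (fun t : ℝ => ζ + (t : ℂ) * α) α 0 :=
  ((Complex.ofRealCLM.hasDerivAt.mul_const α).const_add ζ).congr_deriv (by simp)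

theorem fderiv_fderiv_of_fderiv {C : ℂ → ℂ} {f : ℂ → ℝ} {α c : ℂ} (hf : ContDiffAt ℝ 2 f 0)
    (hd : ∀ᶠ ζ in 𝓝 0, ∀ α, fderiv ℝ f ζ α = 2 * (α * C ζ).re)
    (hc : HasDerivAt (fun t : ℝ => C (0 + (t : ℂ) * α)) c 0) :
    fderiv ℝ (fderiv ℝ f) 0 α α = 2 * (α * c).re := by
  have hdd : DifferentiableAt ℝ (fderiv ℝ f) 0 :=
    (hf.fderiv_right (m := 1) (by norm_num)).differentiableAt one_ne_zero
  have h0 : (0 : ℂ) + ((0 : ℝ) : ℂ) * α = 0 := by simp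
  have h1 := hdd.hasFDerivAt.comp_hasDerivAt_of_eq (0 : ℝ) (hasDerivAt_ofReal_mul 0 α) h0.symm
  have h2 := (ContinuousLinearMap.apply ℝ ℝ α).hasFDerivAt.comp_hasDerivAt (0 : ℝ) h1
  have h3 := (Complex.reCLM.hasFDerivAt.comp_hasDerivAt (0 : ℝ) (hc.const_mul α)).const_mul 2
  have h5 : Tendsto (fun t : ℝ => 0 + (t : ℂ) * α) (𝓝 0) (𝓝 0) := by
    have := (hasDerivAt_ofReal_mul 0 α).continuousAt.tendsto
    rwa [h0] at this
  refine h2.unique (h3.congr_of_eventuallyEq ?_)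
  filter_upwards [h5.eventually hd] with t ht
  exact ht α

/-- The Laplacian of a function on `ℂ` with differential `α ↦ 2 Re (α C)`. -/
theorem laplacian_of_fderiv {C : ℂ → ℂ} {f : ℂ → ℝ} {a b : ℂ} (hf : ContDiffAt ℝ 2 f 0)
    (hd : ∀ᶠ ζ in 𝓝 0, ∀ α, fderiv ℝ f ζ α = 2 * (α * C ζ).re)
    (ha : HasDerivAt (fun t : ℝ => C (0 + (t : ℂ) * 1)) a 0)
    (hb : HasDerivAt (fun t : ℝ => C (0 + (t : ℂ) * Complex.I)) b 0) :
    Laplacian.laplacian f 0 = 2 * (a + Complex.I * b).re := by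
  rw [InnerProductSpace.laplacian_eq_iteratedFDeriv_complexPlane]
  simp only [iteratedFDeriv_two_apply, Matrix.cons_val_zero, Matrix.cons_val_one]
  rw [fderiv_fderiv_of_fderiv hf hd ha, fderiv_fderiv_of_fderiv hf hd hb, one_mul, Complex.add_re]
  ring

/-- `⟨·, v⟩` as a continuous linear form. -/
def killingCLM (v : L) : L →L[ℂ] ℂ := LinearMap.toContinuousLinearMap ((killingForm ℂ L).flip v)

namespace SphericalData

/-- Along `c ζ = exp (ζ ad v) y` the differential of `h ∘ Π ∘ c` is `α ↦ 2 Re (α C)` with `C = ⟨Π c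
- s(c), v⟩`. As `s ∘ c` is holomorphic, it drops out of the Laplacian at `0`, and only the
derivatives of `⟨Π c, v⟩` remain. -/
theorem potential_equation (D : SphericalData θ σ x) {y v v' : L} (hy : y ∈ openOrbit θ σ x)
    (hv : θ v = v) (hv' : θ v' = v') (hJ : IsJ y v v') :
    ContDiffAt ℝ 2 (fun z : ℂ => potential θ σ x (iwasawaProj θ x (expAd (z • v) y))) 0 ∧
    (1 / 2) * Laplacian.laplacian
      (fun z : ℂ => potential θ σ x (iwasawaProj θ x (expAd (z • v) y))) 0 = kks y v v' := by
  have hy' := D.mem_openOrbit.mp hy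
  have hyO := compactOrbit_subset hy'.1
  have hyM := D.mem_spectralSet hyO
  obtain ⟨P, hP, hPe⟩ := exists_smooth_iwasawaProj D.compact D.base_compact hy'.1 2
  have hPy : P y = y := by
    rw [hPe.self_of_nhds hyO, iwasawaProj_self D.compact D.base_compact hy'.1]
  set c : ℂ → L := fun ζ => expAd (ζ • v) y with hc
  have hc0 : c 0 = y := by simp [hc]
  have hcO : ∀ ζ, c ζ ∈ complexOrbit x := fun ζ => expAd_mem_complexOrbit hyO _
  have hcd : ContDiff ℂ 2 c := contDiff_expAd_apply v y
  have hct : Tendsto c (𝓝 0) (𝓝 y) := by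
    have := hcd.continuous.tendsto 0
    rwa [hc0] at this
  set φ : ℂ → ℝ := fun ζ => potential θ σ x (iwasawaProj θ x (c ζ)) with hφ
  have hφP : φ =ᶠ[𝓝 0] fun ζ => potential θ σ x (P (c ζ)) := by
    filter_upwards [hct.eventually hPe] with ζ hζ
    simp only [hφ, hζ (hcO ζ)]
  have hcR : ContDiffAt ℝ 2 c 0 := (hcd.restrict_scalars ℝ).contDiffAt
  have hφ2 : ContDiffAt ℝ 2 φ 0 := by
    refine ContDiffAt.congr_of_eventuallyEq ?_ hφP
    have h1 : ContDiffAt ℝ 2 (potential θ σ x) (P (c 0)) := by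
      rw [hc0, hPy]; exact D.contDiffAt_potential hy
    have h2 : ContDiffAt ℝ 2 P (c 0) := by rw [hc0]; exact hP
    exact h1.comp (0 : ℂ) (h2.comp (0 : ℂ) hcR)
  refine ⟨hφ2, ?_⟩
  set C : ℂ → ℂ := fun ζ => killingForm ℂ L (P (c ζ) - (c ζ + sectionVec θ σ x (c ζ))) v with hC
  have hd : ∀ᶠ ζ in 𝓝 0, ∀ α, fderiv ℝ φ ζ α = 2 * (α * C ζ).re := by
    have h1 : ∀ᶠ ζ in 𝓝 0, DifferentiableAt ℝ φ ζ :=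
      (hφ2.eventually (by simp)).mono fun ζ h => h.differentiableAt two_ne_zero
    have h2 : ∀ᶠ ζ in 𝓝 0, discr θ σ x (c ζ) ≠ 0 :=
      hct.eventually (isOpen_discr_ne_zero.eventually_mem hy'.2)
    filter_upwards [h1, h2, hct.eventually hPe] with ζ h1 h2 h3 α
    have h5 := h1.hasFDerivAt.comp_hasDerivAt_of_eq (0 : ℝ) (hasDerivAt_ofReal_mul ζ α) (by simp)
    have h6 := D.hasDerivAt_potential_iwasawaProj (hcO ζ) h2 (α • v)
    rw [map_smul, smul_eq_mul, ← h3 (hcO ζ)] at h6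
    refine h5.unique (h6.congr_of_eventuallyEq (Eventually.of_forall fun t => ?_))
    simp only [hφ, hc, Function.comp]
    rw [add_comm ζ, expAd_add_smul, clm_mul_apply, smul_smul]
  have hsec : DifferentiableAt ℂ (fun ζ => c ζ + sectionVec θ σ x (c ζ)) 0 := by
    have h1 : DifferentiableAt ℂ c 0 := hcd.differentiable two_ne_zero 0
    have h2 : DifferentiableAt ℂ (sectionVec θ σ x) (c 0) := by
      rw [hc0]; exact (contDiffAt_sectionVec hy'.2 (n := 1)).differentiableAt one_ne_zero
    exact h1.add (h2.comp (0 : ℂ) h1)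
  obtain ⟨d, hsd⟩ : ∃ d, HasDerivAt (fun ζ => c ζ + sectionVec θ σ x (c ζ)) d 0 :=
    ⟨_, hsec.hasDerivAt⟩
  -- In direction `α` the curve `Π ∘ c` moves by the `𝔤`-component `w` of `α v`: this is `v` for `α
  -- = 1` and, by `hJ`, `v'` for `α = i`.
  have hCd : ∀ {α : ℂ} {w : L}, θ w = w →
      specProjOn (realSpectrum x) (Set.Iio 0) y (α • v - w) = 0 →
      HasDerivAt (fun t : ℝ => C (0 + (t : ℂ) * α))
        (killingForm ℂ L ⁅w, y⁆ v - α * killingForm ℂ L d v) 0 := fun {α w} hw hp => by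
    have h0 : (0 : ℂ) = 0 + ((0 : ℝ) : ℂ) * α := by simp
    have hPd := hP.differentiableAt two_ne_zero
    have h1 : HasDerivAt (fun t : ℝ => P (c (0 + (t : ℂ) * α))) ⁅w, y⁆ 0 := by
      have h2 := hasDerivAt_expAd_apply_real (α • v) y
      simp only [smul_smul] at h2
      rw [← fderiv_iwasawaProj D.compact D.base_compact hy'.1 hPd hPe hw hp]
      simp only [hc, zero_add]
      exact hPd.hasFDerivAt.comp_hasDerivAt_of_eq (0 : ℝ) h2 (by simp)
    have h5 : HasDerivAt (fun t : ℝ => c (0 + (t : ℂ) * α) +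
        sectionVec θ σ x (c (0 + (t : ℂ) * α))) (α • d) 0 :=
      HasDerivAt.scomp_of_eq (0 : ℝ) hsd (hasDerivAt_ofReal_mul 0 α) h0
    have h6 := ((killingCLM v).restrictScalars ℝ).hasFDerivAt.comp_hasDerivAt (0 : ℝ) (h1.sub h5)
    refine h6.congr_deriv ?_
    change killingCLM v (⁅w, y⁆ - α • d) = _
    rw [map_sub, map_smul]
    rfl
  rw [laplacian_of_fderiv hφ2 hd (hCd hv (by rw [one_smul, sub_self, map_zero]))
    (hCd hv' (hJ.specProjOn_eq_zero hyM))]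
  have h1 : killingForm ℂ L ⁅v, y⁆ v = 0 := by
    rw [killingForm_lie_left, lie_self, map_zero, neg_zero]
  have h2 : killingForm ℂ L ⁅v', y⁆ v = killingForm ℂ L y ⁅v, v'⁆ := by
    rw [killingForm_lie_left, ← lie_skew, map_neg, neg_neg]
  -- The holomorphic derivative `d` enters once with factor `-1` and once with `-i² = 1`, and
  -- cancels. The real part of the rest is `-Im ⟨y, ⁅v, v'⁆⟩`.
  have h3 : killingForm ℂ L ⁅v, y⁆ v - 1 * killingForm ℂ L d v + Complex.I *
      (killingForm ℂ L ⁅v', y⁆ v - Complex.I * killingForm ℂ L d v) =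
      Complex.I * killingForm ℂ L y ⁅v, v'⁆ := by
    rw [h1, h2, mul_sub, ← mul_assoc, Complex.I_mul_I]
    ring
  rw [h3, Complex.I_mul_re, kks]
  ring

/-- The function `potential` is a Kähler potential. -/
theorem isKahlerPotential (D : SphericalData θ σ x) :
    IsKahlerPotential θ σ x (potential θ σ x) where
  normalized := potential_base
  primitive y hy := ⟨y + sectionVec θ σ x y, D.add_sectionVec_mem hy, (D.section_spec hy).2.2.1,
    fun _ hv => D.hasDerivAt_potential hy hv⟩
  potential _ hy _ _ hv hv' hJ := D.potential_equation hy hv hv' hJ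

/-- The field `-Λ` is half the gradient of the potential. -/
theorem isHalfGradient (D : SphericalData θ σ x) :
    IsHalfGradient θ σ x (potential θ σ x) (fun y => -gradField θ σ x y) := by
  intro y hy
  have hθ := D.compact.toIsConjugation
  have hy' := D.mem_openOrbit.mp hy
  have hyM := D.mem_spectralSet (compactOrbit_subset hy'.1)
  have hθy := D.conj_eq_neg hy'.1
  have hn := specProjOn_sectionVec hyM hy'.2
  set n := sectionVec θ σ x y with hndef
  -- The gradient should be `-(n - θ n) / 2`. From `⁅m, y⁆ = -n / 2` and `θ y = -y` one gets `⁅θ m,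
  -- y⁆ = θ n / 2`, so `m + θ m ∈ 𝔤` generates it.
  obtain ⟨m, hm, hmy⟩ := exists_lie_eq_specProjOn hyM (I := Set.Ioi 0) (by simp) (-(1 / 2 : ℂ) • n)
  rw [map_smul, hn] at hmy
  have hconj : ⁅θ m, y⁆ = (1 / 2 : ℂ) • θ n := by
    have h := congrArg θ hmy
    rw [hθ.map_lie, hθy, lie_neg, LinearMap.map_smulₛₗ, neg_eq_iff_eq_neg] at h
    rw [h, ← neg_smul]
    simp [Complex.conj_ofNat]
  have hfield : ⁅m + θ m, y⁆ = -gradField θ σ x y := by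
    rw [add_lie, hmy, hconj, gradField, D.sectionVecOpp_eq hy, ← hndef]
    module
  refine ⟨m + θ m, by rw [map_add, hθ.involutive, add_comm], hfield.symm,
    fun v v' hv hv' hJ => (D.hasDerivAt_potential hy hv).congr_deriv ?_⟩
  rw [← hndef, sub_add_cancel_left, map_neg, LinearMap.neg_apply, Complex.neg_re]
  congr 1
  -- `n ∈ 𝔫(y)` is orthogonal to `i v - v' ∈ 𝔭(y)`: paired with `n`, the complex structure `J`
  -- becomes multiplication by `i`.
  have h1 : killingForm ℂ L n v' = Complex.I * killingForm ℂ L n v := by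
    have h := killingForm_eq_zero_of_nilradical hyM hn (hJ.specProjOn_eq_zero hyM)
    rw [map_sub, map_smul, smul_eq_mul, sub_eq_zero] at h
    exact h.symm
  have h2 : killingForm ℂ L y ⁅m + θ m, v'⁆ = -killingForm ℂ L ⁅m + θ m, y⁆ v' := by
    rw [killingForm_lie_left, neg_neg]
  have h3 : killingForm ℂ L (θ n) v' = conj (killingForm ℂ L n v') := by
    rw [← killingForm_conj hθ, hv']
  have h4 : killingForm ℂ L ⁅m + θ m, y⁆ v' =
      -(1 / 2 : ℂ) * killingForm ℂ L n v' + (1 / 2 : ℂ) * conj (killingForm ℂ L n v') := by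
    rw [add_lie, hmy, hconj, map_add, LinearMap.add_apply, map_smul, map_smul,
      LinearMap.smul_apply, LinearMap.smul_apply, h3, smul_eq_mul, smul_eq_mul]
  rw [kks, h2, h4, h1]
  simp
  ring

/-- The field `Λ` is a complexification of `-Y`. -/
theorem isComplexification (D : SphericalData θ σ x) :
    IsComplexification (fun y => - -gradField θ σ x y) (openOrbit θ σ x) (domainB θ σ x)
      (gradField θ σ x) where
  subset := D.openOrbit_subset_domainB
  tangent _ hz := D.gradField_tangent hz
  holomorphic := D.differentiableOn_gradField
  restrict _ _ := (neg_neg _).symm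

end SphericalData
end HyperbolicOrbit

end

/-! ### The main theorem. -/

open HyperbolicOrbit in
theorem mainTheorem3 {L : Type*} [NormedLieRing L] [NormedLieAlgebra ℂ L] [FiniteDimensional ℂ L]
    (θ σ : L →ₛₗ[starRingEnd ℂ] L) (hθ : IsCompactConjugation θ) (hσ : IsConjugation σ)
    (hcomm : ∀ u, θ (σ u) = σ (θ u)) (x : L) (hxθ : θ x = -x) (hxσ : σ x = x) :
    IsOpenIn (complexOrbit x) (domainB θ σ x) ∧
    IsZariskiOpenIn (complexOrbit x) (domainB θ σ x) ∧
    IsConnected (domainB θ σ x) ∧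
    (∀ k ∈ sphericalGroup θ σ, ∀ z ∈ domainB θ σ x, k z ∈ domainB θ σ x) ∧
    ∃ (h : L → ℝ) (Y Λ : L → L),
      IsKahlerPotential θ σ x h ∧
      IsHalfGradient θ σ x h Y ∧
      IsComplexification (fun y => -Y y) (openOrbit θ σ x) (domainB θ σ x) Λ ∧
      (∀ Λ', IsComplexification (fun y => -Y y) (openOrbit θ σ x) (domainB θ σ x) Λ' →
        Set.EqOn Λ' Λ (domainB θ σ x)) ∧
      ∀ k ∈ sphericalGroup θ σ, ∀ z ∈ domainB θ σ x, Λ (k z) = k (Λ z) := by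
  have D : SphericalData θ σ x := ⟨hθ, hσ, hcomm, hxθ, hxσ⟩
  refine ⟨D.isOpenIn_domainB, D.isZariskiOpenIn_domainB, D.isConnected_domainB,
    fun k hk z hz => D.apply_mem_domainB hk hz, potential θ σ x, fun y => -gradField θ σ x y,
    gradField θ σ x, D.isKahlerPotential, D.isHalfGradient, D.isComplexification,
    fun Λ' hΛ' => D.eqOn_domainB hΛ'.holomorphic D.differentiableOn_gradField fun y hy => ?_,
    fun k hk z hz => D.gradField_map hk hz⟩
  rw [hΛ'.restrict y hy, neg_neg]
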